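/- Let $N$ be a von Neumann algebra acting on a Hilbert space $H$, let $J$ be a norm closed two-sided ideal of $N$ with quotient map $\pi:N\to N/J$, and let $(\mathcal A,H,\mathcal D)$ be a unital von Neumann spectral triple relative to $(N,J)$. That is, $\mathcal A$ is a unital $*$-algebra with a unital $*$-representation in $N$, $\mathcal D$ is a self-adjoint operator affiliated to $N$, and for every $a\in\mathcal A$ the commutator $[\mathcal D,a]$ is defined on $\mathrm{Dom}(\mathcal D)$ and extends to a bounded operator, and $a(\lambda-\mathcal D)^{-1}\in J$ for all $\lambda\in\mathbb C\setminus\mathbb R$. Let $A$ be the norm closure of (the image of) $\mathcal A$, and put $F_{\mathcal D}=\mathcal D(1+\mathcal D^2)^{-1/2}$ and $p_F=\tfrac12(F_{\mathcal D}+1)$. Let $B\subseteq J$ be a $\sigma$-unital $C^*$-algebra such that $(\mathcal M_A,F_{\mathcal D})$, where $\mathcal M_A$ denotes left multiplication by elements of $A$, is a Kasparov $A$-$B$-module. That is, $AB\subseteq B$ and $F_{\mathcal D}B\subseteq B$, and the operators $a(F_{\mathcal D}^2-1)$ and $[F_{\mathcal D},a]$ belong to $B$ for all $a\in A$. Let $u\in\mathcal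 A$ be unitary. *Von Neumann spectral flow.* Let $\chi$ be the indicator function of $[0,\infty)$. For a norm continuous path $(B_t)_{t\in[0,1]}$ of self-adjoint operators in $N$ with every $\pi(B_t)$ invertible in $N/J$, choose a partition $0=t_0<\dots<t_n=1$ with $\|\pi(\chi(B_t))-\pi(\chi(B_s))\|<\tfrac12$ for $s,t\in[t_{i-1},t_i]$, put $p_i=\chi(B_{t_i})$, and define $$\mathrm{sf}\{B_t\}=\sum_{i=1}^n\big([(1-p_i)\cap p_{i-1}]-[(1-p_{i-1})\cap p_i]\big)\in K_0(J),$$ where $p\cap q$ is the projection onto $\mathrm{Im}(p)\cap\mathrm{Im}(q)$; this does not depend on the partition. Define $\mathrm{sf}(\mathcal D,u^*\mathcal Du)=\mathrm{sf}\{F_{\mathcal D_t}\}$ for $\mathcal D_t=(1-t)\mathcal D+t\,u^*\mathcal Du$, $t\in[0,1]$. *$C^*$-spectral flow.* Let $\mathcal L(B)$ be the algebra of adjointable operators on $B$ (as a right Hilbert $B$-module with $\langle x,y\rangle=x^*y$), $\pi_B:\mathcal L(B)\to\mathcal C(B)=\mathcal L(B)/B$ the quotient map and $\partial_B:K_1(\mathcal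 C(B))\to K_0(B)$ the boundary map, given by $\partial_B[v]=\big[w\,\mathrm{diag}(1_n,0)\,w^{-1}\big]-\big[\mathrm{diag}(1_n,0)\big]$ for $v\in GL_n(\mathcal C(B))$ and any invertible lift $w\in GL_{2n}(\mathcal L(B))$ of $\mathrm{diag}(v,v^{-1})$. Define $$\mathrm{sf}_B(\mathcal D,u^*\mathcal Du)=\partial_B\big[\pi_B(p_Fup_F+1-p_F)\big]\in K_0(B).$$ Let $i_*:K_0(B)\to K_0(J)$ be the homomorphism induced by the inclusion $i:B\to J$. Then $$\mathrm{sf}(\mathcal D,u^*\mathcal Du)=i_*\big(\mathrm{sf}_B(\mathcal D,u^*\mathcal Du)\big)\quad\text{in }K_0(J).$$ -/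

import Mathlib

noncomputable section

namespace SpectralFlow

open Matrix

section KZero

variable {S T : Type*} [Ring S] [Ring T]

/-- Idempotent matrices of arbitrary finite size over a unital ring `S`. -/
structure IdemMatrix (S : Type*) [Ring S] where
  size : ℕ
  mat : Matrix (Fin size) (Fin size) S
  idem : IsIdempotentElem mat

theorem isIdempotentElem_submatrix {ι κ : Type*} [Fintype ι] [Fintype κ] {e : Matrix ι ι S}
    (he : IsIdempotentElem e) (σ : κ ≃ ι) : IsIdempotentElem (e.submatrix σ σ) := by
  unfold IsIdempotentElem at *
  rw [Matrix.submatrix_mul_equiv, he]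

theorem isIdempotentElem_fromBlocks {ι κ : Type*} [Fintype ι] [Fintype κ] {e : Matrix ι ι S}
    {f : Matrix κ κ S} (he : IsIdempotentElem e) (hf : IsIdempotentElem f) :
    IsIdempotentElem (fromBlocks e 0 0 f) := by
  unfold IsIdempotentElem at *
  simp [Matrix.fromBlocks_multiply, he, hf]

theorem isIdempotentElem_map {ι : Type*} [Fintype ι] {e : Matrix ι ι S}
    (he : IsIdempotentElem e) (φ : S →+* T) : IsIdempotentElem (e.map φ) := by
  unfold IsIdempotentElem at *
  rw [← Matrix.map_mul, he]

/-- The direct sum `e ⊕ f = diag(e, f)` of idempotent matrices. -/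
def IdemMatrix.sum (e f : IdemMatrix S) : IdemMatrix S :=
  ⟨e.size + f.size, (fromBlocks e.mat 0 0 f.mat).submatrix finSumFinEquiv.symm finSumFinEquiv.symm,
    isIdempotentElem_submatrix (isIdempotentElem_fromBlocks e.idem f.idem) _⟩

/-- (Murray–von Neumann, algebraic) equivalence of idempotent matrices `e`, `f`, possibly of
different sizes: there are rectangular matrices `x`, `y` with `x y = e` and `y x = f`. -/
def IdemMatrix.Equivalent (e f : IdemMatrix S) : Prop :=
  ∃ (x : Matrix (Fin e.size) (Fin f.size) S) (y : Matrix (Fin f.size) (Fin e.size) S),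
    x * y = e.mat ∧ y * x = f.mat

/-- The relations `[e] = [f]` for equivalent `e`, `f`, and `[e ⊕ f] = [e] + [f]`. -/
def KZeroUnitalRel (S : Type*) [Ring S] : Set (FreeAbelianGroup (IdemMatrix S)) :=
  {z | ∃ e f : IdemMatrix S, e.Equivalent f ∧
      z = FreeAbelianGroup.of e - FreeAbelianGroup.of f} ∪
  {z | ∃ e f : IdemMatrix S, z = FreeAbelianGroup.of (e.sum f) -
      (FreeAbelianGroup.of e + FreeAbelianGroup.of f)}

/-- `K₀` of a unital ring: the Grothendieck group of the monoid of equivalence classes of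
idempotent matrices under direct sum, given by generators and relations. -/
abbrev KZeroUnital (S : Type*) [Ring S] : Type _ :=
  FreeAbelianGroup (IdemMatrix S) ⧸ AddSubgroup.closure (KZeroUnitalRel S)

/-- The class of a generator. -/
def KZeroUnital.of (e : IdemMatrix S) : KZeroUnital S :=
  QuotientAddGroup.mk' (AddSubgroup.closure (KZeroUnitalRel S)) (FreeAbelianGroup.of e)

theorem KZeroUnital.of_eq {e f : IdemMatrix S} (h : e.Equivalent f) :
    KZeroUnital.of e = KZeroUnital.of f := by
  unfold KZeroUnital.of
  rw [← sub_eq_zero, ← map_sub]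
  exact (QuotientAddGroup.eq_zero_iff _).2
    (AddSubgroup.subset_closure (Or.inl ⟨e, f, h, rfl⟩))

theorem KZeroUnital.of_sum (e f : IdemMatrix S) :
    KZeroUnital.of (e.sum f) = KZeroUnital.of e + KZeroUnital.of f := by
  unfold KZeroUnital.of
  rw [← sub_eq_zero, ← map_add, ← map_sub]
  exact (QuotientAddGroup.eq_zero_iff _).2
    (AddSubgroup.subset_closure (Or.inr ⟨e, f, rfl⟩))

/-- The universal property of `KZeroUnital`. -/
def KZeroUnital.lift {G : Type*} [AddCommGroup G] (φ : IdemMatrix S → G)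
    (h₁ : ∀ e f : IdemMatrix S, e.Equivalent f → φ e = φ f)
    (h₂ : ∀ e f : IdemMatrix S, φ (e.sum f) = φ e + φ f) : KZeroUnital S →+ G :=
  QuotientAddGroup.lift _ (FreeAbelianGroup.lift φ) (by
    rw [AddSubgroup.closure_le]
    rintro z (⟨e, f, h, rfl⟩ | ⟨e, f, rfl⟩)
    · simp [AddMonoidHom.mem_ker, h₁ e f h]
    · simp [AddMonoidHom.mem_ker, h₂ e f])

@[simp]
theorem KZeroUnital.lift_of {G : Type*} [AddCommGroup G] (φ : IdemMatrix S → G)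
    (h₁ : ∀ e f : IdemMatrix S, e.Equivalent f → φ e = φ f)
    (h₂ : ∀ e f : IdemMatrix S, φ (e.sum f) = φ e + φ f) (e : IdemMatrix S) :
    KZeroUnital.lift φ h₁ h₂ (KZeroUnital.of e) = φ e := by
  change FreeAbelianGroup.lift φ (FreeAbelianGroup.of e) = φ e
  simp

/-- The image of an idempotent matrix under a ring homomorphism. -/
def IdemMatrix.map (φ : S →+* T) (e : IdemMatrix S) : IdemMatrix T :=
  ⟨e.size, e.mat.map φ, isIdempotentElem_map e.idem φ⟩

/-- Functoriality of `KZeroUnital`. -/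
def KZeroUnital.map (φ : S →+* T) : KZeroUnital S →+ KZeroUnital T :=
  KZeroUnital.lift (fun e => KZeroUnital.of (e.map φ))
    (by
      rintro e f ⟨x, y, hxy, hyx⟩
      refine KZeroUnital.of_eq ⟨x.map φ, y.map φ, ?_, ?_⟩
      · change _ = e.mat.map φ
        rw [← hxy]
        exact (Matrix.map_mul (f := φ)).symm
      · change _ = f.mat.map φ
        rw [← hyx]
        exact (Matrix.map_mul (f := φ)).symm)
    (by
      intro e f
      rw [← KZeroUnital.of_sum]
      congr 1
      unfold IdemMatrix.map IdemMatrix.sum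
      congr 2
      rw [← Matrix.submatrix_map, Matrix.fromBlocks_map]
      simp [Matrix.map_zero])

theorem KZeroUnital.map_of (φ : S →+* T) (e : IdemMatrix S) :
    KZeroUnital.map φ (KZeroUnital.of e) = KZeroUnital.of (e.map φ) := by
  unfold KZeroUnital.map
  rw [KZeroUnital.lift_of]

theorem KZeroUnital.hom_ext {G : Type*} [AddCommGroup G] {a b : KZeroUnital S →+ G}
    (h : ∀ e : IdemMatrix S, a (KZeroUnital.of e) = b (KZeroUnital.of e)) : a = b := by
  apply QuotientAddGroup.addMonoidHom_ext
  apply FreeAbelianGroup.lift_ext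
  exact h

theorem KZeroUnital.map_comp {U : Type*} [Ring U] (φ : S →+* T) (ψ : T →+* U) :
    (KZeroUnital.map ψ).comp (KZeroUnital.map φ) = KZeroUnital.map (ψ.comp φ) := by
  apply KZeroUnital.hom_ext
  intro e
  rw [AddMonoidHom.comp_apply, KZeroUnital.map_of, KZeroUnital.map_of, KZeroUnital.map_of]
  rfl

/-- The class in `KZeroUnital S` of an idempotent matrix indexed by any finite type. -/
def KZeroUnital.cls {ι : Type*} [Fintype ι] (e : Matrix ι ι S) (he : IsIdempotentElem e) :
    KZeroUnital S :=
  KZeroUnital.of ⟨Fintype.card ι, e.submatrix (Fintype.equivFin ι).symm (Fintype.equivFin ι).symm,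
    isIdempotentElem_submatrix he _⟩

theorem KZeroUnital.cls_eq {ι κ : Type*} [Fintype ι] [Fintype κ] {e : Matrix ι ι S}
    {f : Matrix κ κ S} (he : IsIdempotentElem e) (hf : IsIdempotentElem f)
    (x : Matrix ι κ S) (y : Matrix κ ι S) (hxy : x * y = e) (hyx : y * x = f) :
    KZeroUnital.cls e he = KZeroUnital.cls f hf := by
  refine KZeroUnital.of_eq ⟨x.submatrix (Fintype.equivFin ι).symm (Fintype.equivFin κ).symm,
    y.submatrix (Fintype.equivFin κ).symm (Fintype.equivFin ι).symm, ?_, ?_⟩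
  · rw [Matrix.submatrix_mul_equiv, hxy]
  · rw [Matrix.submatrix_mul_equiv, hyx]

theorem KZeroUnital.cls_submatrix {ι κ : Type*} [Fintype ι] [Fintype κ] {e : Matrix ι ι S}
    (he : IsIdempotentElem e) (σ : κ ≃ ι) :
    KZeroUnital.cls (e.submatrix σ σ) (isIdempotentElem_submatrix he σ) =
      KZeroUnital.cls e he := by
  refine KZeroUnital.cls_eq _ _ (e.submatrix σ id) (e.submatrix id σ) ?_ ?_
  · have := Matrix.submatrix_mul_equiv e e σ (Equiv.refl ι) σ
    simp only [Equiv.coe_refl] at this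
    rw [this, he]
  · rw [Matrix.submatrix_mul_equiv, he, Matrix.submatrix_id_id]

theorem KZeroUnital.cls_fin {n : ℕ} {e : Matrix (Fin n) (Fin n) S} (he : IsIdempotentElem e) :
    KZeroUnital.cls e he = KZeroUnital.of ⟨n, e, he⟩ := by
  refine KZeroUnital.of_eq ⟨e.submatrix (Fintype.equivFin (Fin n)).symm id,
    e.submatrix id (Fintype.equivFin (Fin n)).symm, ?_, ?_⟩
  · have := Matrix.submatrix_mul_equiv e e (Fintype.equivFin (Fin n)).symm (Equiv.refl _)
      (Fintype.equivFin (Fin n)).symm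
    simp only [Equiv.coe_refl] at this
    change _ = e.submatrix _ _
    rw [this, he]
  · rw [Matrix.submatrix_mul_equiv, he, Matrix.submatrix_id_id]

theorem KZeroUnital.cls_fromBlocks {ι κ : Type*} [Fintype ι] [Fintype κ] {e : Matrix ι ι S}
    {f : Matrix κ κ S} (he : IsIdempotentElem e) (hf : IsIdempotentElem f) :
    KZeroUnital.cls (fromBlocks e 0 0 f) (isIdempotentElem_fromBlocks he hf) =
      KZeroUnital.cls e he + KZeroUnital.cls f hf := by
  conv_rhs => unfold KZeroUnital.cls
  rw [← KZeroUnital.of_sum]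
  unfold IdemMatrix.sum
  rw [← KZeroUnital.cls_fin, KZeroUnital.cls_submatrix]
  · rw [← KZeroUnital.cls_submatrix (isIdempotentElem_fromBlocks he hf)
      (Equiv.sumCongr (Fintype.equivFin ι).symm (Fintype.equivFin κ).symm)]
    congr 1
    ext i j
    rcases i with i | i <;> rcases j with j | j <;> rfl
  · exact isIdempotentElem_fromBlocks (isIdempotentElem_submatrix he _)
      (isIdempotentElem_submatrix hf _)

theorem KZeroUnital.map_cls (φ : S →+* T) {ι : Type*} [Fintype ι] {e : Matrix ι ι S}
    (he : IsIdempotentElem e) :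
    KZeroUnital.map φ (KZeroUnital.cls e he) =
      KZeroUnital.cls (e.map φ) (isIdempotentElem_map he φ) := by
  unfold KZeroUnital.cls
  rw [KZeroUnital.map_of]
  rfl

end KZero

section KZeroC

variable {R R' : Type*} [NonUnitalCStarAlgebra R] [NonUnitalCStarAlgebra R']

/-- The canonical character `R⁺ → ℂ` of the unitization. -/
abbrev scalarPart (R : Type*) [NonUnitalCStarAlgebra R] : Unitization ℂ R →+* ℂ :=
  (Unitization.fstHom ℂ R : Unitization ℂ R →+* ℂ)

/-- `K₀` of a (possibly non-unital) C*-algebra `R`: the kernel of the map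
`K₀(R⁺) → K₀(ℂ)` induced by the canonical character of the unitization `R⁺`. -/
abbrev KZero (R : Type*) [NonUnitalCStarAlgebra R] : Type _ :=
  (KZeroUnital.map (scalarPart R)).ker

theorem unitization_fst_comp (φ : R →⋆ₙₐ[ℂ] R') (x : Unitization ℂ R) :
    (Unitization.starMap φ x).fst = x.fst := by
  induction x using Unitization.ind with
  | inl_add_inr r a => simp [Unitization.algebraMap_eq_inl]

/-- The homomorphism `φ_* : K₀(R) → K₀(R')` induced by a `*`-homomorphism `φ : R → R'`. -/
def KZero.map (φ : R →⋆ₙₐ[ℂ] R') : KZero R →+ KZero R' :=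
  ((KZeroUnital.map (Unitization.starMap φ : Unitization ℂ R →+* Unitization ℂ R')).comp
    (AddSubgroup.subtype _)).codRestrict _ (by
      rintro ⟨z, hz⟩
      rw [AddMonoidHom.mem_ker] at hz ⊢
      rw [← hz]
      rw [AddMonoidHom.comp_apply, ← AddMonoidHom.comp_apply, KZeroUnital.map_comp]
      congr 2
      ext x
      exact unitization_fst_comp φ x)

/-- The formal difference `[e] - [f] ∈ K₀(R)` of idempotent matrices over `R⁺` with the same
scalar part. -/
def KZero.diff {ι : Type*} [Fintype ι] (e f : Matrix ι ι (Unitization ℂ R))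
    (he : IsIdempotentElem e) (hf : IsIdempotentElem f)
    (h : e.map (scalarPart R) = f.map (scalarPart R)) : KZero R :=
  ⟨KZeroUnital.cls e he - KZeroUnital.cls f hf, by
    rw [AddMonoidHom.mem_ker, map_sub, KZeroUnital.map_cls, KZeroUnital.map_cls, sub_eq_zero]
    congr 1⟩

end KZeroC

section KOne

variable {Q : Type*} [Ring Q] [TopologicalSpace Q]

/-- Invertible matrices of arbitrary finite size over a unital ring `Q`. -/
structure InvMatrix (Q : Type*) [Ring Q] where
  size : ℕ
  mat : (Matrix (Fin size) (Fin size) Q)ˣ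

/-- The block diagonal invertible matrix `diag(u, v)`. -/
def unitsFromBlocks {ι κ : Type*} [Fintype ι] [Fintype κ] [DecidableEq ι] [DecidableEq κ]
    (u : (Matrix ι ι Q)ˣ) (v : (Matrix κ κ Q)ˣ) : (Matrix (ι ⊕ κ) (ι ⊕ κ) Q)ˣ where
  val := fromBlocks u.val 0 0 v.val
  inv := fromBlocks u⁻¹.val 0 0 v⁻¹.val
  val_inv := by simp [Matrix.fromBlocks_multiply, Matrix.fromBlocks_one]
  inv_val := by simp [Matrix.fromBlocks_multiply, Matrix.fromBlocks_one]

/-- Reindexing of invertible matrices. -/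
def unitsReindex {ι κ : Type*} [Fintype ι] [Fintype κ] [DecidableEq ι] [DecidableEq κ]
    (σ : κ ≃ ι) (u : (Matrix ι ι Q)ˣ) : (Matrix κ κ Q)ˣ where
  val := u.val.submatrix σ σ
  inv := u⁻¹.val.submatrix σ σ
  val_inv := by rw [Matrix.submatrix_mul_equiv, Units.mul_inv, Matrix.submatrix_one_equiv]
  inv_val := by rw [Matrix.submatrix_mul_equiv, Units.inv_mul, Matrix.submatrix_one_equiv]

/-- The direct sum `u ⊕ v = diag(u, v)` of invertible matrices. -/
def InvMatrix.sum (u v : InvMatrix Q) : InvMatrix Q :=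
  ⟨u.size + v.size, unitsReindex finSumFinEquiv.symm (unitsFromBlocks u.mat v.mat)⟩

/-- The relations `[u] = [v]` if `u`, `v` are joined by a path in `GL_n(Q)`, `[1_n] = 0`, and
`[u ⊕ v] = [u] + [v]`. -/
def KOneRel (Q : Type*) [Ring Q] [TopologicalSpace Q] : Set (FreeAbelianGroup (InvMatrix Q)) :=
  {z | ∃ (n : ℕ) (u v : (Matrix (Fin n) (Fin n) Q)ˣ), Joined u v ∧
      z = FreeAbelianGroup.of ⟨n, u⟩ - FreeAbelianGroup.of ⟨n, v⟩} ∪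
  {z | ∃ n : ℕ, z = FreeAbelianGroup.of (⟨n, 1⟩ : InvMatrix Q)} ∪
  {z | ∃ u v : InvMatrix Q, z = FreeAbelianGroup.of (u.sum v) -
      (FreeAbelianGroup.of u + FreeAbelianGroup.of v)}

/-- (Topological) `K₁` of a unital topological ring: homotopy classes of invertible matrices,
with addition given by direct sums, described by generators and relations. -/
abbrev KOne (Q : Type*) [Ring Q] [TopologicalSpace Q] : Type _ :=
  FreeAbelianGroup (InvMatrix Q) ⧸ AddSubgroup.closure (KOneRel Q)

/-- The class in `K₁` of an invertible matrix. -/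
def KOne.of (u : InvMatrix Q) : KOne Q :=
  QuotientAddGroup.mk' (AddSubgroup.closure (KOneRel Q)) (FreeAbelianGroup.of u)

/-- The class in `K₁(Q)` of an invertible element of `Q`, viewed as a `1 × 1` matrix. -/
def KOne.ofUnit (u : Qˣ) : KOne Q :=
  KOne.of ⟨1, Units.map (Matrix.scalar (Fin 1) : Q →+* Matrix (Fin 1) (Fin 1) Q).toMonoidHom u⟩

/-- The universal property of `KOne`. -/
def KOne.lift {G : Type*} [AddCommGroup G] (φ : InvMatrix Q → G)
    (h₁ : ∀ (n : ℕ) (u v : (Matrix (Fin n) (Fin n) Q)ˣ), Joined u v → φ ⟨n, u⟩ = φ ⟨n, v⟩)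
    (h₂ : ∀ n : ℕ, φ ⟨n, 1⟩ = 0)
    (h₃ : ∀ u v : InvMatrix Q, φ (u.sum v) = φ u + φ v) : KOne Q →+ G :=
  QuotientAddGroup.lift _ (FreeAbelianGroup.lift φ) (by
    rw [AddSubgroup.closure_le]
    rintro z ((⟨n, u, v, h, rfl⟩ | ⟨n, rfl⟩) | ⟨u, v, rfl⟩)
    · simp [AddMonoidHom.mem_ker, h₁ n u v h]
    · simp [AddMonoidHom.mem_ker, h₂ n]
    · simp [AddMonoidHom.mem_ker, h₃ u v])

end KOne

section Calkin

open scoped DoubleCentralizer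

variable (R : Type*) [NonUnitalCStarAlgebra R]

/-- The C*-algebra `ℒ(R)` of adjointable operators on `R`, viewed as a right Hilbert module over
itself with `⟨x, y⟩ = x* y`. A double centralizer `(L, R')` satisfies `R'(x) y = x L(y)`, that is,
`⟨x* , L y⟩ = ⟨R'(x)*, y⟩`, so it is the same as an operator `L` together with its adjoint
`x ↦ R'(x*)*`. -/
abbrev Adjointable : Type _ := DoubleCentralizer ℂ R

/-- The embedding of `R` in `ℒ(R)` by left multiplication. -/
abbrev leftReg : R →⋆ₙₐ[ℂ] Adjointable R := DoubleCentralizer.coeHom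

variable {R} in
theorem eq_of_mul_left_eq {x y : R} (h : ∀ z : R, z * x = z * y) : x = y := by
  rw [← sub_eq_zero, ← CStarRing.star_mul_self_eq_zero_iff, mul_sub, h, sub_self]

variable {R} in
theorem mul_leftReg (T : Adjointable R) (b : R) : T * leftReg R b = leftReg R (T.fst b) := by
  have key : ∀ x y : R, T.snd x * y = x * T.fst y := T.central
  refine DoubleCentralizer.ext ℂ R _ _ (Prod.ext ?_ ?_)
  · ext x
    change T.fst (b * x) = T.fst b * x
    refine eq_of_mul_left_eq fun z => ?_
    rw [← key, ← mul_assoc, key, mul_assoc]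
  · ext x
    change T.snd x * b = x * T.fst b
    exact key x b

variable {R} in
theorem leftReg_mul (T : Adjointable R) (b : R) : leftReg R b * T = leftReg R (T.snd b) := by
  have h := congrArg star (mul_leftReg (star T) (star b))
  rw [star_mul, star_star, map_star, star_star, ← map_star, DoubleCentralizer.star_fst,
    star_star, star_star] at h
  exact h

theorem leftReg_injective : Function.Injective (leftReg R) := by
  intro a b h
  have h' := congrArg (fun T : Adjointable R => T.snd) h
  refine eq_of_mul_left_eq fun z => ?_
  exact congrArg (fun T : R →L[ℂ] R => T z) h'

/-- The ideal `𝒦(R) = R` of compact operators in `ℒ(R)`: the left multiplications by elements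
of `R`. -/
def compacts : Ideal (Adjointable R) where
  carrier := Set.range (leftReg R)
  add_mem' := by
    rintro _ _ ⟨a, rfl⟩ ⟨b, rfl⟩
    exact ⟨a + b, map_add _ _ _⟩
  zero_mem' := ⟨0, map_zero _⟩
  smul_mem' := by
    rintro T _ ⟨b, rfl⟩
    exact ⟨T.fst b, (mul_leftReg T b).symm⟩

instance : (compacts R).IsTwoSided where
  mul_mem_of_left := by
    rintro _ T ⟨b, rfl⟩
    exact ⟨T.snd b, (leftReg_mul T b).symm⟩

/-- The generalized Calkin algebra `𝒞(R) = ℒ(R) / R`. -/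
abbrev Calkin : Type _ := Adjointable R ⧸ compacts R

/-- The quotient map `π_R : ℒ(R) → 𝒞(R)`. -/
abbrev toCalkin : Adjointable R →+* Calkin R := Ideal.Quotient.mk (compacts R)

/-- The quotient (norm) topology on the Calkin algebra. -/
instance : TopologicalSpace (Calkin R) := TopologicalSpace.coinduced (toCalkin R) inferInstance

theorem isOpenQuotientMap_toCalkin : IsOpenQuotientMap (toCalkin R) := by
  have h := QuotientAddGroup.isOpenQuotientMap_mk (N := (compacts R).toAddSubgroup)
  refine ⟨Ideal.Quotient.mk_surjective, continuous_coinduced_rng, ?_⟩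
  exact h.isOpenMap

instance : IsTopologicalRing (Calkin R) where
  continuous_add := by
    have hq := (isOpenQuotientMap_toCalkin R).prodMap (isOpenQuotientMap_toCalkin R)
    rw [hq.isQuotientMap.continuous_iff]
    exact (isOpenQuotientMap_toCalkin R).continuous.comp continuous_add
  continuous_mul := by
    have hq := (isOpenQuotientMap_toCalkin R).prodMap (isOpenQuotientMap_toCalkin R)
    rw [hq.isQuotientMap.continuous_iff]
    exact (isOpenQuotientMap_toCalkin R).continuous.comp continuous_mul
  continuous_neg := by
    rw [(isOpenQuotientMap_toCalkin R).isQuotientMap.continuous_iff]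
    exact (isOpenQuotientMap_toCalkin R).continuous.comp continuous_neg

end Calkin

section Boundary

set_option linter.unusedSectionVars false

variable {R : Type*} [NonUnitalCStarAlgebra R]

/-- The homomorphism `R⁺ → ℒ(R)`, `(λ, r) ↦ λ + r`. -/
def unitizationToAdjointable (R : Type*) [NonUnitalCStarAlgebra R] :
    Unitization ℂ R →+* Adjointable R :=
  (Unitization.starLift (leftReg R) : Unitization ℂ R →⋆ₐ[ℂ] Adjointable R)

/-- The scalars in the Calkin algebra. -/
def scalarCalkin (R : Type*) [NonUnitalCStarAlgebra R] : ℂ →+* Calkin R :=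
  (toCalkin R).comp (algebraMap ℂ (Adjointable R))

/-- For a matrix `X` over `ℒ(R)` that agrees modulo `R` with the scalar matrix `s`, the matrix over
`R⁺` with scalar part `s` and `R`-part `X - s`. -/
def pullMatrix {ι κ : Type*} (s : Matrix ι κ ℂ) (X : Matrix ι κ (Adjointable R)) :
    Matrix ι κ (Unitization ℂ R) :=
  Matrix.of fun i j => Unitization.inl (s i j) +
    Unitization.inr (Function.invFun (leftReg R) (X i j - algebraMap ℂ (Adjointable R) (s i j)))

theorem pullMatrix_scalarPart {ι κ : Type*} (s : Matrix ι κ ℂ)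
    (X : Matrix ι κ (Adjointable R)) : (pullMatrix s X).map (scalarPart R) = s := by
  ext i j
  simp [pullMatrix, scalarPart]

theorem unitizationToAdjointable_apply (r : ℂ) (a : R) :
    unitizationToAdjointable R (Unitization.inl r + Unitization.inr a) =
      algebraMap ℂ (Adjointable R) r + leftReg R a := by
  change algebraMap ℂ (Adjointable R) (Unitization.inl r + Unitization.inr a : Unitization ℂ R).fst +
    leftReg R (Unitization.inl r + Unitization.inr a : Unitization ℂ R).snd = _
  simp only [Unitization.fst_add, Unitization.snd_add, Unitization.fst_inl, Unitization.fst_inr,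
    Unitization.snd_inl, Unitization.snd_inr, add_zero, zero_add]

theorem pullMatrix_map {ι κ : Type*} {s : Matrix ι κ ℂ} {X : Matrix ι κ (Adjointable R)}
    (h : X.map (toCalkin R) = s.map (scalarCalkin R)) :
    (pullMatrix s X).map (unitizationToAdjointable R) = X := by
  ext1 i j
  have hij : toCalkin R (X i j) = toCalkin R (algebraMap ℂ (Adjointable R) (s i j)) :=
    congrFun (congrFun h i) j
  have hm : ∃ b, leftReg R b = X i j - algebraMap ℂ (Adjointable R) (s i j) :=
    (Ideal.Quotient.mk_eq_mk_iff_sub_mem _ _).1 hij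
  change unitizationToAdjointable R (Unitization.inl _ + Unitization.inr _) = _
  rw [unitizationToAdjointable_apply, Function.invFun_eq hm]
  abel

theorem unitizationMatrix_ext {ι κ : Type*} {E F : Matrix ι κ (Unitization ℂ R)}
    (h₁ : E.map (scalarPart R) = F.map (scalarPart R))
    (h₂ : E.map (unitizationToAdjointable R) = F.map (unitizationToAdjointable R)) : E = F := by
  ext1 i j
  have e₁ : (E i j).fst = (F i j).fst := congrFun (congrFun h₁ i) j
  have e₂ : unitizationToAdjointable R (E i j) = unitizationToAdjointable R (F i j) :=
    congrFun (congrFun h₂ i) j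
  rw [← Unitization.inl_fst_add_inr_snd_eq (E i j), ← Unitization.inl_fst_add_inr_snd_eq (F i j),
    unitizationToAdjointable_apply, unitizationToAdjointable_apply, e₁, add_right_inj] at e₂
  exact Unitization.ext e₁ (leftReg_injective R e₂)

theorem pullMatrix_mul {ι κ μ : Type*} [Fintype κ] {s : Matrix ι κ ℂ} {t : Matrix κ μ ℂ}
    {X : Matrix ι κ (Adjointable R)} {Y : Matrix κ μ (Adjointable R)}
    (hX : X.map (toCalkin R) = s.map (scalarCalkin R))
    (hY : Y.map (toCalkin R) = t.map (scalarCalkin R)) :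
    pullMatrix s X * pullMatrix t Y = pullMatrix (s * t) (X * Y) := by
  have hXY : (X * Y).map (toCalkin R) = (s * t).map (scalarCalkin R) := by
    rw [Matrix.map_mul, hX, hY, Matrix.map_mul]
  apply unitizationMatrix_ext
  · rw [Matrix.map_mul, pullMatrix_scalarPart, pullMatrix_scalarPart, pullMatrix_scalarPart]
  · rw [Matrix.map_mul, pullMatrix_map hX, pullMatrix_map hY, pullMatrix_map hXY]

theorem pullMatrix_idem {ι : Type*} [Fintype ι] {s : Matrix ι ι ℂ}
    {X : Matrix ι ι (Adjointable R)} (hX : X.map (toCalkin R) = s.map (scalarCalkin R))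
    (hs : IsIdempotentElem s) (h : IsIdempotentElem X) : IsIdempotentElem (pullMatrix s X) := by
  unfold IsIdempotentElem at *
  rw [pullMatrix_mul hX hX, hs, h]

theorem cls_pullMatrix_eq {ι : Type*} [Fintype ι] [DecidableEq ι] {s : Matrix ι ι ℂ}
    {e e' : Matrix ι ι (Adjointable R)} (he : e.map (toCalkin R) = s.map (scalarCalkin R))
    (he' : e'.map (toCalkin R) = s.map (scalarCalkin R)) (hs : IsIdempotentElem s)
    (hi : IsIdempotentElem e) (hi' : IsIdempotentElem e') (z : (Matrix ι ι (Adjointable R))ˣ)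
    (hz : z.val.map (toCalkin R) = 1) (hze : z.val * e = e' * z.val) :
    KZeroUnital.cls (pullMatrix s e') (pullMatrix_idem he' hs hi') =
      KZeroUnital.cls (pullMatrix s e) (pullMatrix_idem he hs hi) := by
  have hz' : z⁻¹.val.map (toCalkin R) = 1 := by
    have h1 : (z⁻¹.val * z.val).map (toCalkin R) = 1 := by
      rw [Units.inv_mul]; exact Matrix.map_one _ (map_zero _) (map_one _)
    rw [Matrix.map_mul, hz, mul_one] at h1
    exact h1
  have h₁ : (z.val * e).map (toCalkin R) = s.map (scalarCalkin R) := by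
    rw [Matrix.map_mul, hz, one_mul, he]
  have h₂ : (e * z⁻¹.val).map (toCalkin R) = s.map (scalarCalkin R) := by
    rw [Matrix.map_mul, hz', mul_one, he]
  refine KZeroUnital.cls_eq _ _ (pullMatrix s (z.val * e)) (pullMatrix s (e * z⁻¹.val)) ?_ ?_
  · rw [pullMatrix_mul h₁ h₂, hs]
    congr 1
    calc z.val * e * (e * z⁻¹.val) = z.val * (e * e) * z⁻¹.val := by simp only [mul_assoc]
      _ = e' * (z.val * z⁻¹.val) := by rw [hi, hze, mul_assoc]
      _ = e' := by rw [Units.mul_inv, mul_one]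
  · rw [pullMatrix_mul h₂ h₁, hs]
    congr 1
    calc e * z⁻¹.val * (z.val * e) = e * (z⁻¹.val * z.val) * e := by simp only [mul_assoc]
      _ = e := by rw [Units.inv_mul, mul_one, hi]

variable {ι κ : Type*} [Fintype ι] [Fintype κ] [DecidableEq ι] [DecidableEq κ]

/-- The idempotent `diag(1, 0)` in `M_{2n}`. -/
def cornerProj (ι S : Type*) [DecidableEq ι] [Ring S] : Matrix (ι ⊕ ι) (ι ⊕ ι) S :=
  fromBlocks 1 0 0 0

theorem cornerProj_idem (S : Type*) [Ring S] : IsIdempotentElem (cornerProj ι S) := by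
  simp [IsIdempotentElem, cornerProj, Matrix.fromBlocks_multiply]

theorem cornerProj_map {S T : Type*} [Ring S] [Ring T] (φ : S →+* T) :
    (cornerProj ι S).map φ = cornerProj ι T := by
  simp [cornerProj, Matrix.fromBlocks_map]

/-- `w` is an invertible lift of `diag(u, u⁻¹)` to matrices over `ℒ(R)`. -/
def IsDiagLift (u : (Matrix ι ι (Calkin R))ˣ)
    (w : (Matrix (ι ⊕ ι) (ι ⊕ ι) (Adjointable R))ˣ) : Prop :=
  w.val.map (toCalkin R) = fromBlocks u.val 0 0 u⁻¹.val

theorem exists_isDiagLift (u : (Matrix ι ι (Calkin R))ˣ) :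
    ∃ w : (Matrix (ι ⊕ ι) (ι ⊕ ι) (Adjointable R))ˣ, IsDiagLift u w := by
  have hs : ∀ X : Matrix ι ι (Calkin R), ∃ a : Matrix ι ι (Adjointable R),
      a.map (toCalkin R) = X := by
    intro X
    choose a ha using fun i j => Ideal.Quotient.mk_surjective (I := compacts R) (X i j)
    exact ⟨Matrix.of a, by ext1 i j; exact ha i j⟩
  obtain ⟨a, ha⟩ := hs u.val
  obtain ⟨b, hb⟩ := hs u⁻¹.val
  refine ⟨⟨fromBlocks (2 * a - a * b * a) (a * b - 1) (1 - b * a) b,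
    fromBlocks b (1 - b * a) (a * b - 1) (2 * a - a * b * a), ?_, ?_⟩, ?_⟩
  · rw [Matrix.fromBlocks_multiply, ← Matrix.fromBlocks_one]
    congr 1 <;> noncomm_ring
  · rw [Matrix.fromBlocks_multiply, ← Matrix.fromBlocks_one]
    congr 1 <;> noncomm_ring
  · have h1 : (1 : Matrix ι ι (Adjointable R)).map (toCalkin R) = 1 :=
      Matrix.map_one _ (map_zero _) (map_one _)
    have hab : (a * b).map (toCalkin R) = 1 := by rw [Matrix.map_mul, ha, hb, Units.mul_inv]
    have hba : (b * a).map (toCalkin R) = 1 := by rw [Matrix.map_mul, ha, hb, Units.inv_mul]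
    have hsub : ∀ X Y : Matrix ι ι (Adjointable R),
        (X - Y).map (toCalkin R) = X.map (toCalkin R) - Y.map (toCalkin R) :=
      fun X Y => Matrix.map_sub _ (fun _ _ => map_sub _ _ _) X Y
    unfold IsDiagLift
    rw [Matrix.fromBlocks_map, hsub, hsub, hsub, h1, hab, hba, hb, two_mul,
      Matrix.map_add _ (fun _ _ => map_add _ _ _), Matrix.map_mul, hab, ha]
    simp

/-- The idempotent `w diag(1, 0) w⁻¹`. -/
def conjCorner (w : (Matrix (ι ⊕ ι) (ι ⊕ ι) (Adjointable R))ˣ) :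
    Matrix (ι ⊕ ι) (ι ⊕ ι) (Adjointable R) :=
  w.val * cornerProj ι (Adjointable R) * w⁻¹.val

theorem conjCorner_idem (w : (Matrix (ι ⊕ ι) (ι ⊕ ι) (Adjointable R))ˣ) :
    IsIdempotentElem (conjCorner w) := by
  have h := cornerProj_idem (ι := ι) (Adjointable R)
  unfold IsIdempotentElem at *
  unfold conjCorner
  calc _ = w.val * cornerProj ι (Adjointable R) * (w⁻¹.val * w.val) *
        cornerProj ι (Adjointable R) * w⁻¹.val := by simp only [mul_assoc]
    _ = w.val * (cornerProj ι (Adjointable R) * cornerProj ι (Adjointable R)) * w⁻¹.val := by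
        rw [Units.inv_mul, mul_one, mul_assoc w.val]
    _ = _ := by rw [h]

theorem IsDiagLift.inv {u : (Matrix ι ι (Calkin R))ˣ}
    {w : (Matrix (ι ⊕ ι) (ι ⊕ ι) (Adjointable R))ˣ} (h : IsDiagLift u w) :
    w⁻¹.val.map (toCalkin R) = fromBlocks u⁻¹.val 0 0 u.val := by
  have h1 : (w⁻¹.val * w.val).map (toCalkin R) = 1 := by
    rw [Units.inv_mul]; exact Matrix.map_one _ (map_zero _) (map_one _)
  rw [Matrix.map_mul, h] at h1
  calc w⁻¹.val.map (toCalkin R)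
      = w⁻¹.val.map (toCalkin R) * (fromBlocks u.val 0 0 u⁻¹.val *
          fromBlocks u⁻¹.val 0 0 u.val) := by
        simp [Matrix.fromBlocks_multiply, Matrix.fromBlocks_one]
    _ = _ := by rw [← mul_assoc, h1, one_mul]

theorem IsDiagLift.conjCorner_map {u : (Matrix ι ι (Calkin R))ˣ}
    {w : (Matrix (ι ⊕ ι) (ι ⊕ ι) (Adjointable R))ˣ} (h : IsDiagLift u w) :
    (conjCorner w).map (toCalkin R) = (cornerProj ι ℂ).map (scalarCalkin R) := by
  unfold conjCorner
  rw [Matrix.map_mul, Matrix.map_mul, h, h.inv, cornerProj_map, cornerProj_map]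
  simp [cornerProj, Matrix.fromBlocks_multiply]

/-- The class `[w diag(1, 0) w⁻¹] - [diag(1, 0)] ∈ K₀(R)` for an invertible lift `w` of
`diag(u, u⁻¹)`. -/
def boundaryOfLift (u : (Matrix ι ι (Calkin R))ˣ)
    (w : (Matrix (ι ⊕ ι) (ι ⊕ ι) (Adjointable R))ˣ) (h : IsDiagLift u w) : KZero R :=
  KZero.diff (pullMatrix (cornerProj ι ℂ) (conjCorner w)) (cornerProj ι (Unitization ℂ R))
    (pullMatrix_idem h.conjCorner_map (cornerProj_idem ℂ) (conjCorner_idem w))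
    (cornerProj_idem _) (by rw [pullMatrix_scalarPart, cornerProj_map])

theorem boundaryOfLift_eq {u u' : (Matrix ι ι (Calkin R))ˣ}
    {w w' : (Matrix (ι ⊕ ι) (ι ⊕ ι) (Adjointable R))ˣ} (h : IsDiagLift u w)
    (h' : IsDiagLift u' w') (z : (Matrix (ι ⊕ ι) (ι ⊕ ι) (Adjointable R))ˣ)
    (hz : z.val.map (toCalkin R) = 1)
    (hzw : z.val * conjCorner w = conjCorner w' * z.val) :
    boundaryOfLift u w h = boundaryOfLift u' w' h' := by
  apply Subtype.ext
  change _ - _ = _ - _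
  congr 1
  exact (cls_pullMatrix_eq h.conjCorner_map h'.conjCorner_map (cornerProj_idem ℂ)
    (conjCorner_idem w) (conjCorner_idem w') z hz hzw).symm

theorem boundaryOfLift_unique {u : (Matrix ι ι (Calkin R))ˣ}
    {w w' : (Matrix (ι ⊕ ι) (ι ⊕ ι) (Adjointable R))ˣ} (h : IsDiagLift u w)
    (h' : IsDiagLift u w') : boundaryOfLift u w h = boundaryOfLift u w' h' := by
  refine boundaryOfLift_eq h h' (w' * w⁻¹) ?_ ?_
  · rw [Units.val_mul, Matrix.map_mul, h', h.inv]
    simp [Matrix.fromBlocks_multiply, Matrix.fromBlocks_one]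
  · simp only [conjCorner, Units.val_mul]
    calc _ = w'.val * (w⁻¹.val * w.val) * cornerProj ι (Adjointable R) * w⁻¹.val := by
          simp only [mul_assoc]
      _ = w'.val * cornerProj ι (Adjointable R) * (w'⁻¹.val * w'.val) * w⁻¹.val := by
          rw [Units.inv_mul, Units.inv_mul]; simp only [mul_one]
      _ = _ := by simp only [mul_assoc]

/-- The value `[w diag(1, 0) w⁻¹] - [diag(1, 0)]` of the boundary map on an invertible matrix `u`
over the Calkin algebra, where `w` is any invertible lift of `diag(u, u⁻¹)`. -/
def boundaryInv (u : (Matrix ι ι (Calkin R))ˣ) : KZero R :=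
  boundaryOfLift u (exists_isDiagLift u).choose (exists_isDiagLift u).choose_spec

theorem boundaryInv_eq {u : (Matrix ι ι (Calkin R))ˣ}
    {w : (Matrix (ι ⊕ ι) (ι ⊕ ι) (Adjointable R))ˣ} (h : IsDiagLift u w) :
    boundaryInv u = boundaryOfLift u w h :=
  boundaryOfLift_unique _ _

theorem boundaryInv_one : boundaryInv (1 : (Matrix ι ι (Calkin R))ˣ) = 0 := by
  have h : IsDiagLift (1 : (Matrix ι ι (Calkin R))ˣ) 1 := by
    unfold IsDiagLift
    rw [inv_one, Units.val_one, Units.val_one, Matrix.fromBlocks_one]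
    exact Matrix.map_one _ (map_zero _) (map_one _)
  rw [boundaryInv_eq h]
  apply Subtype.ext
  change _ - _ = (0 : KZeroUnital (Unitization ℂ R))
  rw [sub_eq_zero]
  congr 1
  apply unitizationMatrix_ext
  · rw [pullMatrix_scalarPart, cornerProj_map]
  · rw [pullMatrix_map h.conjCorner_map, cornerProj_map]
    simp [conjCorner]

theorem fromBlocks_reindex {S μ : Type*} [Zero S] (σ : μ ≃ ι ⊕ κ) (A D : Matrix ι ι S)
    (A' D' : Matrix κ κ S) :
    (fromBlocks (fromBlocks A 0 0 D) 0 0 (fromBlocks A' 0 0 D')).submatrix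
        ((Equiv.sumCongr σ σ).trans (Equiv.sumSumSumComm ι κ ι κ))
        ((Equiv.sumCongr σ σ).trans (Equiv.sumSumSumComm ι κ ι κ)) =
      fromBlocks ((fromBlocks A 0 0 A').submatrix σ σ) 0 0
        ((fromBlocks D 0 0 D').submatrix σ σ) := by
  have key : (fromBlocks (fromBlocks A 0 0 D) 0 0 (fromBlocks A' 0 0 D')).submatrix
        (Equiv.sumSumSumComm ι κ ι κ) (Equiv.sumSumSumComm ι κ ι κ) =
      fromBlocks (fromBlocks A 0 0 A') 0 0 (fromBlocks D 0 0 D') := by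
    ext1 i j
    rcases i with (i | i) | (i | i) <;> rcases j with (j | j) | (j | j) <;> rfl
  have key2 : ∀ X Y : Matrix (ι ⊕ κ) (ι ⊕ κ) S,
      (fromBlocks X 0 0 Y).submatrix (Equiv.sumCongr σ σ) (Equiv.sumCongr σ σ) =
        fromBlocks (X.submatrix σ σ) 0 0 (Y.submatrix σ σ) := by
    intro X Y
    ext1 i j
    rcases i with i | i <;> rcases j with j | j <;> rfl
  rw [← key2, ← key]
  rfl

theorem cornerProj_reindex {μ : Type*} [Fintype μ] [DecidableEq μ] (σ : μ ≃ ι ⊕ κ) (S : Type*)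
    [Ring S] :
    (fromBlocks (cornerProj ι S) 0 0 (cornerProj κ S)).submatrix
        ((Equiv.sumCongr σ σ).trans (Equiv.sumSumSumComm ι κ ι κ))
        ((Equiv.sumCongr σ σ).trans (Equiv.sumSumSumComm ι κ ι κ)) = cornerProj μ S := by
  unfold cornerProj
  rw [fromBlocks_reindex, Matrix.fromBlocks_one, Matrix.submatrix_one_equiv]
  simp [Matrix.fromBlocks_zero]

theorem boundaryInv_sum {μ : Type*} [Fintype μ] [DecidableEq μ] (σ : μ ≃ ι ⊕ κ)
    (u : (Matrix ι ι (Calkin R))ˣ) (v : (Matrix κ κ (Calkin R))ˣ) :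
    boundaryInv (unitsReindex σ (unitsFromBlocks u v)) = boundaryInv u + boundaryInv v := by
  obtain ⟨w, hw⟩ := exists_isDiagLift u
  obtain ⟨x, hx⟩ := exists_isDiagLift v
  set τ : μ ⊕ μ ≃ (ι ⊕ ι) ⊕ (κ ⊕ κ) :=
    (Equiv.sumCongr σ σ).trans (Equiv.sumSumSumComm ι κ ι κ) with hτ
  have hW : IsDiagLift (unitsReindex σ (unitsFromBlocks u v))
      (unitsReindex τ (unitsFromBlocks w x)) := by
    unfold IsDiagLift at *
    change ((fromBlocks w.val 0 0 x.val).submatrix τ τ).map (toCalkin R) = _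
    rw [← Matrix.submatrix_map, Matrix.fromBlocks_map, hw, hx,
      Matrix.map_zero _ (map_zero _), Matrix.map_zero _ (map_zero _), hτ, fromBlocks_reindex]
    rfl
  have hC : conjCorner (unitsReindex τ (unitsFromBlocks w x)) =
      (fromBlocks (conjCorner w) 0 0 (conjCorner x)).submatrix τ τ := by
    unfold conjCorner
    change (fromBlocks w.val 0 0 x.val).submatrix τ τ * _ *
      (fromBlocks w⁻¹.val 0 0 x⁻¹.val).submatrix τ τ = _
    rw [← cornerProj_reindex σ, ← hτ, Matrix.submatrix_mul_equiv, Matrix.submatrix_mul_equiv,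
      Matrix.fromBlocks_multiply, Matrix.fromBlocks_multiply]
    simp
  rw [boundaryInv_eq hW, boundaryInv_eq hw, boundaryInv_eq hx]
  have hE : pullMatrix (cornerProj μ ℂ) (conjCorner (unitsReindex τ (unitsFromBlocks w x))) =
      (fromBlocks (pullMatrix (cornerProj ι ℂ) (conjCorner w)) 0 0
        (pullMatrix (cornerProj κ ℂ) (conjCorner x))).submatrix τ τ := by
    apply unitizationMatrix_ext
    · rw [pullMatrix_scalarPart, ← Matrix.submatrix_map, Matrix.fromBlocks_map,
        pullMatrix_scalarPart, pullMatrix_scalarPart, Matrix.map_zero _ (map_zero _),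
        Matrix.map_zero _ (map_zero _), hτ, cornerProj_reindex]
    · rw [pullMatrix_map hW.conjCorner_map, ← Matrix.submatrix_map, Matrix.fromBlocks_map,
        pullMatrix_map hw.conjCorner_map, pullMatrix_map hx.conjCorner_map,
        Matrix.map_zero _ (map_zero _), Matrix.map_zero _ (map_zero _), hC]
  have i₁ := pullMatrix_idem hw.conjCorner_map (cornerProj_idem ℂ) (conjCorner_idem w)
  have i₂ := pullMatrix_idem hx.conjCorner_map (cornerProj_idem ℂ) (conjCorner_idem x)
  have j₁ := cornerProj_idem (ι := ι) (Unitization ℂ R)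
  have j₂ := cornerProj_idem (ι := κ) (Unitization ℂ R)
  have c₁ : KZeroUnital.cls (pullMatrix (cornerProj μ ℂ)
      (conjCorner (unitsReindex τ (unitsFromBlocks w x))))
      (pullMatrix_idem hW.conjCorner_map (cornerProj_idem ℂ) (conjCorner_idem _)) =
      KZeroUnital.cls _ i₁ + KZeroUnital.cls _ i₂ := by
    rw [← KZeroUnital.cls_fromBlocks i₁ i₂,
      ← KZeroUnital.cls_submatrix (isIdempotentElem_fromBlocks i₁ i₂) τ]
    congr 1
  have c₂ : KZeroUnital.cls (cornerProj μ (Unitization ℂ R)) (cornerProj_idem _) =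
      KZeroUnital.cls _ j₁ + KZeroUnital.cls _ j₂ := by
    rw [← KZeroUnital.cls_fromBlocks j₁ j₂,
      ← KZeroUnital.cls_submatrix (isIdempotentElem_fromBlocks j₁ j₂) τ]
    congr 1
    rw [hτ, cornerProj_reindex]
  apply Subtype.ext
  change _ - _ = (_ - _) + (_ - _)
  rw [c₁, c₂]
  abel

theorem isOpenMap_matrixMap :
    IsOpenMap (fun X : Matrix ι κ (Adjointable R) => X.map (toCalkin R)) := by
  have h := IsOpenMap.piMap (ι := ι) (f := fun _ => Pi.map (fun _ : κ => toCalkin R))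
    (fun _ => IsOpenMap.piMap (fun _ => (isOpenQuotientMap_toCalkin R).isOpenMap)
      (Filter.Eventually.of_forall fun _ => (isOpenQuotientMap_toCalkin R).surjective))
    (Filter.Eventually.of_forall fun _ => Function.Surjective.piMap
      fun _ => (isOpenQuotientMap_toCalkin R).surjective)
  exact h

theorem hasSummableGeomSeries_of_complete (A : Type*) [inst : NormedRing A]
    (h : @CompleteSpace A inst.toMetricSpace.toUniformSpace) : HasSummableGeomSeries A :=
  inferInstance

theorem matrix_inverse_near_one {A : Type*} [NormedRing A] [CompleteSpace A] :
    {X : Matrix ι ι A | IsUnit X} ∈ nhds (1 : Matrix ι ι A) ∧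
      ContinuousAt Ring.inverse (1 : Matrix ι ι A) := by
  let inst : NormedRing (Matrix ι ι A) := Matrix.linftyOpNormedRing
  have hc : @CompleteSpace (Matrix ι ι A) inst.toMetricSpace.toUniformSpace := by
    have : CompleteSpace (ι → ι → A) := inferInstance
    exact this
  have hs : HasSummableGeomSeries (Matrix ι ι A) := hasSummableGeomSeries_of_complete _ hc
  exact ⟨Units.nhds (1 : (Matrix ι ι A)ˣ), NormedRing.inverse_continuousAt (1 : (Matrix ι ι A)ˣ)⟩

theorem boundaryInv_eventually_eq (u : (Matrix ι ι (Calkin R))ˣ) :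
    ∀ᶠ v in nhds u, boundaryInv v = boundaryInv u := by
  obtain ⟨w, hw⟩ := exists_isDiagLift u
  set e := conjCorner w with he
  have hei : e * e = e := conjCorner_idem w
  -- the intertwiner of `e` and `k e k⁻¹`
  set Z : Matrix (ι ⊕ ι) (ι ⊕ ι) (Adjointable R) → Matrix (ι ⊕ ι) (ι ⊕ ι) (Adjointable R) :=
    fun k => k * e * Ring.inverse k * e + (1 - k * e * Ring.inverse k) * (1 - e) with hZ
  have hZ1 : Z 1 = 1 := by
    simp only [hZ, Ring.inverse_one, one_mul, mul_one, mul_sub, sub_mul, hei]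
    abel
  have hZc : ContinuousAt Z 1 := by
    have hinv := (matrix_inverse_near_one (A := Adjointable R) (ι := ι ⊕ ι)).2
    have h1 : ContinuousAt (fun k : Matrix (ι ⊕ ι) (ι ⊕ ι) (Adjointable R) =>
        k * e * Ring.inverse k) 1 := (continuousAt_id.mul continuousAt_const).mul hinv
    exact (h1.mul continuousAt_const).add ((continuousAt_const.sub h1).mul continuousAt_const)
  have hU : ∀ᶠ k in nhds (1 : Matrix (ι ⊕ ι) (ι ⊕ ι) (Adjointable R)),
      IsUnit k ∧ IsUnit (Z k) := by
    refine Filter.Eventually.and matrix_inverse_near_one.1 ?_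
    have : {X : Matrix (ι ⊕ ι) (ι ⊕ ι) (Adjointable R) | IsUnit X} ∈ nhds (Z 1) := by
      rw [hZ1]; exact matrix_inverse_near_one.1
    exact hZc this
  have hπ : ∀ᶠ X in nhds (1 : Matrix (ι ⊕ ι) (ι ⊕ ι) (Calkin R)),
      ∃ k : Matrix (ι ⊕ ι) (ι ⊕ ι) (Adjointable R),
        (IsUnit k ∧ IsUnit (Z k)) ∧ k.map (toCalkin R) = X := by
    have h := (isOpenMap_matrixMap (R := R) (ι := ι ⊕ ι) (κ := ι ⊕ ι)).image_mem_nhds hU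
    rw [Matrix.map_one _ (map_zero _) (map_one _)] at h
    filter_upwards [h] with X hX
    obtain ⟨k, hk, rfl⟩ := hX
    exact ⟨k, hk, rfl⟩
  have hc : ContinuousAt (fun v : (Matrix ι ι (Calkin R))ˣ =>
      (fromBlocks (v * u⁻¹).val 0 0 (v⁻¹ * u).val : Matrix (ι ⊕ ι) (ι ⊕ ι) (Calkin R))) u := by
    apply Continuous.continuousAt
    refine Continuous.matrix_fromBlocks ?_ continuous_const continuous_const ?_
    · simp only [Units.val_mul]
      exact Units.continuous_val.mul continuous_const
    · simp only [Units.val_mul]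
      exact Units.continuous_coe_inv.mul continuous_const
  have h1 : (fromBlocks (u * u⁻¹).val 0 0 (u⁻¹ * u).val :
      Matrix (ι ⊕ ι) (ι ⊕ ι) (Calkin R)) = 1 := by simp
  rw [← h1] at hπ
  have hev := hc.eventually hπ
  filter_upwards [hev] with v hv
  obtain ⟨k, ⟨⟨k, rfl⟩, ⟨z, hz⟩⟩, hk⟩ := hv
  have hw' : IsDiagLift v (k * w) := by
    unfold IsDiagLift at *
    rw [Units.val_mul, Matrix.map_mul, hk, hw]
    simp [Matrix.fromBlocks_multiply, mul_assoc]
  have hconj : conjCorner (k * w) = k.val * e * k⁻¹.val := by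
    rw [he]
    unfold conjCorner
    rw [_root_.mul_inv_rev, Units.val_mul, Units.val_mul]
    simp only [mul_assoc]
  have hzv : z.val = conjCorner (k * w) * e + (1 - conjCorner (k * w)) * (1 - e) := by
    rw [hz, hconj, hZ]
    simp only [Ring.inverse_unit]
  have hei' : conjCorner (k * w) * conjCorner (k * w) = conjCorner (k * w) :=
    conjCorner_idem (k * w)
  rw [boundaryInv_eq hw, boundaryInv_eq hw']
  refine (boundaryOfLift_eq hw hw' z ?_ ?_).symm
  · have hone : (1 : Matrix (ι ⊕ ι) (ι ⊕ ι) (Adjointable R)).map (toCalkin R) = 1 :=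
      Matrix.map_one _ (map_zero _) (map_one _)
    have hsub : ∀ X Y : Matrix (ι ⊕ ι) (ι ⊕ ι) (Adjointable R),
        (X - Y).map (toCalkin R) = X.map (toCalkin R) - Y.map (toCalkin R) :=
      fun X Y => Matrix.map_sub _ (fun _ _ => map_sub _ _ _) X Y
    have hP : (cornerProj ι (Calkin R)) * cornerProj ι (Calkin R) = cornerProj ι (Calkin R) :=
      cornerProj_idem _
    rw [hzv, Matrix.map_add _ (fun _ _ => map_add _ _ _), Matrix.map_mul, Matrix.map_mul, hsub,
      hsub, hone, hw'.conjCorner_map, he, hw.conjCorner_map, cornerProj_map, hP, mul_sub, sub_mul,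
      sub_mul, hP]
    simp
  · rw [← he, hzv]
    have a1 : (conjCorner (k * w) * e + (1 - conjCorner (k * w)) * (1 - e)) * e =
        conjCorner (k * w) * e := by
      have h0 : (1 - e) * e = 0 := by rw [sub_mul, one_mul, hei, sub_self]
      rw [add_mul, mul_assoc, hei, mul_assoc, h0, mul_zero, add_zero]
    have a2 : conjCorner (k * w) * (conjCorner (k * w) * e +
        (1 - conjCorner (k * w)) * (1 - e)) = conjCorner (k * w) * e := by
      have h0 : conjCorner (k * w) * (1 - conjCorner (k * w)) = 0 := by
        rw [mul_sub, mul_one, hei', sub_self]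
      rw [mul_add, ← mul_assoc, hei', ← mul_assoc, h0, zero_mul, add_zero]
    rw [a1, a2]

theorem boundaryInv_joined {u v : (Matrix ι ι (Calkin R))ˣ} (h : Joined u v) :
    boundaryInv u = boundaryInv v := by
  have hl : IsLocallyConstant (boundaryInv : (Matrix ι ι (Calkin R))ˣ → KZero R) :=
    (IsLocallyConstant.iff_eventually_eq _).2 boundaryInv_eventually_eq
  obtain ⟨γ⟩ := h
  have h2 : IsLocallyConstant (boundaryInv ∘ γ) := hl.comp_continuous γ.continuous
  have h3 := h2.apply_eq_of_preconnectedSpace 0 1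
  simpa using h3

variable (R) in
/-- The boundary (index) map `∂_R : K₁(𝒞(R)) → K₀(R)` of the extension
`0 → R → ℒ(R) → 𝒞(R) → 0`. On the class of `u ∈ GL_n(𝒞(R))` it is
`[w diag(1, 0) w⁻¹] - [diag(1, 0)]` for any `w ∈ GL_{2n}(ℒ(R))` lifting `diag(u, u⁻¹)`. -/
def boundaryMap : KOne (Calkin R) →+ KZero R :=
  KOne.lift (fun u => boundaryInv u.mat) (fun _ _ _ h => boundaryInv_joined h)
    (fun _ => boundaryInv_one) (fun u v => boundaryInv_sum _ u.mat v.mat)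

end Boundary

section FlowVN

variable {H : Type*} [NormedAddCommGroup H] [InnerProductSpace ℂ H] [CompleteSpace H]

/-- `J` is a two-sided ideal of the von Neumann algebra `N` (norm-closedness is required
separately, as `IsClosed (J : Set _)`). -/
structure IsIdealIn (N : VonNeumannAlgebra H) (J : NonUnitalStarSubalgebra ℂ (H →L[ℂ] H)) :
    Prop where
  le : ∀ x ∈ J, x ∈ N
  mul_left : ∀ a ∈ N, ∀ x ∈ J, a * x ∈ J
  mul_right : ∀ a ∈ N, ∀ x ∈ J, x * a ∈ J

/-- The spectral projection `χ(T)` of a self-adjoint operator `T`, where `χ` is the indicator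
function of `[0, ∞)`: the orthogonal projection onto the kernel of the negative part of `T`. -/
def nonnegProj (T : H →L[ℂ] H) : H →L[ℂ] H :=
  (LinearMap.ker (T⁻).toLinearMap).topologicalClosure.starProjection

/-- The projection `p ∩ q` onto `Im p ∩ Im q` (which is closed when `p`, `q` are projections). -/
def projMeet (p q : H →L[ℂ] H) : H →L[ℂ] H :=
  (LinearMap.range p.toLinearMap ⊓ LinearMap.range q.toLinearMap).topologicalClosure.starProjection

variable (J : NonUnitalStarSubalgebra ℂ (H →L[ℂ] H))

/-- The norm of the class `π(x)` of `x` in the quotient by `J`. -/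
def quotNorm (x : H →L[ℂ] H) : ℝ := Metric.infDist x (J : Set (H →L[ℂ] H))

/-- `0 = t 0 < t 1 < ⋯ < t n = 1` is a partition such that
`‖π(χ(B_s)) - π(χ(B_r))‖ < 1/2` whenever `s` and `r` lie in the same interval. -/
structure IsFlowPartition (B : ℝ → H →L[ℂ] H) (n : ℕ) (t : ℕ → ℝ) : Prop where
  zero : t 0 = 0
  one : t n = 1
  lt : ∀ i < n, t i < t (i + 1)
  close : ∀ i < n, ∀ s ∈ Set.Icc (t i) (t (i + 1)), ∀ r ∈ Set.Icc (t i) (t (i + 1)),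
    quotNorm J (nonnegProj (B s) - nonnegProj (B r)) < 1 / 2

variable [IsClosed (J : Set (H →L[ℂ] H))]

/-- The class `[e] ∈ K₀(J)` of a projection `e ∈ J` (and, by convention, `0` for other operators
`e`). -/
def projClass (e : H →L[ℂ] H) : KZero J :=
  open scoped Classical in
  if h : e ∈ J ∧ IsIdempotentElem e then
    KZero.diff (Matrix.of fun _ _ : Fin 1 => Unitization.inr (⟨e, h.1⟩ : J)) 0
      (by
        ext1 i j
        rw [Matrix.mul_apply, Finset.univ_unique, Finset.sum_singleton, Matrix.of_apply,
          Matrix.of_apply, Matrix.of_apply, ← Unitization.inr_mul]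
        exact congrArg _ (Subtype.ext h.2))
      (by simp [IsIdempotentElem])
      (by ext1 i j; simp [scalarPart])
  else 0

/-- The index `[(1 - q) ∩ p] - [(1 - p) ∩ q] ∈ K₀(J)` of the pair of projections `p`, `q`. -/
def projPairIndex (p q : H →L[ℂ] H) : KZero J :=
  projClass J (projMeet (1 - q) p) - projClass J (projMeet (1 - p) q)

/-- The spectral flow `sf{B_t} ∈ K₀(J)` of a norm continuous path `(B_t)`, `t ∈ [0, 1]`, of
self-adjoint `J`-Fredholm operators: the sum `∑ [(1 - p_i) ∩ p_{i-1}] - [(1 - p_{i-1}) ∩ p_i]` with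
`p_i = χ(B_{t_i})`, for a partition as in `IsFlowPartition`. -/
def spectralFlow (B : ℝ → H →L[ℂ] H) : KZero J :=
  open scoped Classical in
  if h : ∃ nt : ℕ × (ℕ → ℝ), IsFlowPartition J B nt.1 nt.2 then
    ∑ i ∈ Finset.range h.choose.1,
      projPairIndex J (nonnegProj (B (h.choose.2 i))) (nonnegProj (B (h.choose.2 (i + 1))))
  else 0

end FlowVN

section Unbounded

variable {H : Type*} [NormedAddCommGroup H] [InnerProductSpace ℂ H] [CompleteSpace H]

/-- `R = (1 + D²)⁻¹`: for every `y`, the vector `R y` lies in the domain of `D²` and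
`(1 + D²) R y = y`. -/
def IsInvOneAddSq (D : H →ₗ.[ℂ] H) (R : H →L[ℂ] H) : Prop :=
  ∀ y, ∃ (h₁ : R y ∈ D.domain) (h₂ : D ⟨R y, h₁⟩ ∈ D.domain), R y + D ⟨D ⟨R y, h₁⟩, h₂⟩ = y

/-- The bounded operator `(1 + D²)⁻¹` of a self-adjoint operator `D`. -/
def invOneAddSq (D : H →ₗ.[ℂ] H) : H →L[ℂ] H :=
  open scoped Classical in
  if h : ∃ R, IsInvOneAddSq D R then h.choose else 0

/-- The bounded transform `F_D = D (1 + D²)^{-1/2}` of a self-adjoint operator `D`: the bounded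
operator whose value at `x` is `D ((1 + D²)^{-1/2} x)`. -/
def boundedTransform (D : H →ₗ.[ℂ] H) : H →L[ℂ] H :=
  open scoped Classical in
  if h : ∃ F : H →L[ℂ] H, ∀ x, ∃ hx : CFC.sqrt (invOneAddSq D) x ∈ D.domain,
    F x = D ⟨CFC.sqrt (invOneAddSq D) x, hx⟩ then h.choose else 0

/-- The operator `u* D u`, with domain `{x | u x ∈ Dom(D)}`. -/
def conjUnbounded (u : H →L[ℂ] H) (D : H →ₗ.[ℂ] H) : H →ₗ.[ℂ] H where
  domain := D.domain.comap u.toLinearMap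
  toFun := (star u).toLinearMap ∘ₗ D.toFun ∘ₗ
    (u.toLinearMap.restrict (p := D.domain.comap u.toLinearMap) (q := D.domain) fun _ hx => hx)

/-- The operator `D_t = (1 - t) D + t u* D u`. -/
def pathUnbounded (D : H →ₗ.[ℂ] H) (u : H →L[ℂ] H) (t : ℝ) : H →ₗ.[ℂ] H :=
  ((1 - t : ℝ) : ℂ) • D + (t : ℂ) • conjUnbounded u D

/-- The von Neumann spectral flow `sf(D, u* D u) ∈ K₀(J)`: the spectral flow of the path
`t ↦ F_{D_t}`, `D_t = (1 - t) D + t u* D u`. -/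
def vonNeumannSpectralFlow (J : NonUnitalStarSubalgebra ℂ (H →L[ℂ] H))
    [IsClosed (J : Set (H →L[ℂ] H))] (D : H →ₗ.[ℂ] H) (u : H →L[ℂ] H) : KZero J :=
  spectralFlow J fun t => boundedTransform (pathUnbounded D u t)

/-- `D` is affiliated to `N`: every element of the commutant of `N` maps the domain of `D` to itself
and commutes with `D` there. -/
def IsAffiliated (N : VonNeumannAlgebra H) (D : H →ₗ.[ℂ] H) : Prop :=
  ∀ S ∈ N.commutant, ∀ x : D.domain, ∃ h : S x ∈ D.domain, D ⟨S x, h⟩ = S (D x)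

/-- `R = (c - D)⁻¹` is the resolvent of `D` at `c`. -/
def IsResolventAt (D : H →ₗ.[ℂ] H) (c : ℂ) (R : H →L[ℂ] H) : Prop :=
  (∀ y, ∃ h : R y ∈ D.domain, c • R y - D ⟨R y, h⟩ = y) ∧
    ∀ x : D.domain, R (c • (x : H) - D x) = x

/-- A unital von Neumann spectral triple `(𝒜, H, D)` relative to `(N, J)`: a unital
`*`-representation `ρ` of a `*`-algebra `𝒜` in `N`, and a self-adjoint operator `D` affiliated to
`N`, such that the commutators `[D, ρ(a)]` are defined on `Dom(D)` and bounded there, and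
`ρ(a) (c - D)⁻¹ ∈ J` for all `a` and all non-real `c`. -/
structure IsVonNeumannSpectralTriple {𝒜 : Type*} [Ring 𝒜] [StarRing 𝒜] [Algebra ℂ 𝒜]
    (N : VonNeumannAlgebra H) (J : NonUnitalStarSubalgebra ℂ (H →L[ℂ] H))
    (ρ : 𝒜 →⋆ₐ[ℂ] (H →L[ℂ] H)) (D : H →ₗ.[ℂ] H) : Prop where
  ideal : IsIdealIn N J
  rep_mem : ∀ a, ρ a ∈ N
  selfAdjoint : IsSelfAdjoint D
  affiliated : IsAffiliated N D
  commutator : ∀ a, ∃ T : H →L[ℂ] H, ∀ x : D.domain, ∃ h : ρ a x ∈ D.domain,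
    D ⟨ρ a x, h⟩ - ρ a (D x) = T x
  resolvent : ∀ a, ∀ c : ℂ, c.im ≠ 0 → ∃ R, IsResolventAt D c R ∧ ρ a * R ∈ J

end Unbounded

section FlowCStar

/-- A C*-algebra is σ-unital if it has a countable approximate unit. -/
def IsSigmaUnital (R : Type*) [NonUnitalCStarAlgebra R] : Prop :=
  ∃ e : ℕ → R, ∀ x : R, Filter.Tendsto (fun n => e n * x) Filter.atTop (nhds x) ∧
    Filter.Tendsto (fun n => x * e n) Filter.atTop (nhds x)

variable {H : Type*} [NormedAddCommGroup H] [InnerProductSpace ℂ H] [CompleteSpace H]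

/-- Left multiplication by `T` is an adjointable operator on the Hilbert module `B`. -/
structure IsMultiplier (B : NonUnitalStarSubalgebra ℂ (H →L[ℂ] H)) (T : H →L[ℂ] H) : Prop where
  mul_mem : ∀ b ∈ B, T * b ∈ B
  star_mul_mem : ∀ b ∈ B, star T * b ∈ B

theorem IsMultiplier.mem_mul {B : NonUnitalStarSubalgebra ℂ (H →L[ℂ] H)} {T : H →L[ℂ] H}
    (h : IsMultiplier B T) : ∀ b ∈ B, b * T ∈ B := by
  intro b hb
  have := star_mem (h.star_mul_mem _ (star_mem hb))
  rwa [star_mul, star_star, star_star] at this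

/-- The pair `(ℳ_A, F)`, with `ℳ_A` the action of `A` on `B` by left multiplication, is a Kasparov
`A`-`B`-module: `A` and `F` act on the right Hilbert module `B` by left multiplication as adjointable
operators, and the operators `a (F² - 1)`, `a (F - F*)` and `[F, a]` are in `B`, the algebra of
compact operators on the Hilbert module `B`, for all `a ∈ A`. -/
structure IsKasparovModule (A : StarSubalgebra ℂ (H →L[ℂ] H)) (F : H →L[ℂ] H)
    (B : NonUnitalStarSubalgebra ℂ (H →L[ℂ] H)) : Prop where
  multiplier : ∀ a ∈ A, IsMultiplier B a
  multiplier_op : IsMultiplier B F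
  sq_sub_one : ∀ a ∈ A, a * (F ^ 2 - 1) ∈ B
  sub_star : ∀ a ∈ A, a * (F - star F) ∈ B
  commutator : ∀ a ∈ A, F * a - a * F ∈ B

variable {B : NonUnitalStarSubalgebra ℂ (H →L[ℂ] H)} [IsClosed (B : Set (H →L[ℂ] H))]

/-- The adjointable operator on `B` given by left multiplication by `T`. -/
def leftMul {T : H →L[ℂ] H} (h : IsMultiplier B T) : Adjointable B where
  fst := LinearMap.mkContinuous
    { toFun := fun b => (⟨T * b, h.mul_mem b b.2⟩ : B)
      map_add' := fun x y => Subtype.ext (mul_add T (x : H →L[ℂ] H) y)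
      map_smul' := fun c x => Subtype.ext (mul_smul_comm c T (x : H →L[ℂ] H)) } ‖T‖
    (fun b => norm_mul_le T (b : H →L[ℂ] H))
  snd := LinearMap.mkContinuous
    { toFun := fun b => (⟨b * T, h.mem_mul b b.2⟩ : B)
      map_add' := fun x y => Subtype.ext (add_mul (x : H →L[ℂ] H) y T)
      map_smul' := fun c x => Subtype.ext (smul_mul_assoc c (x : H →L[ℂ] H) T) } ‖T‖
    (fun b => (norm_mul_le (b : H →L[ℂ] H) T).trans_eq (mul_comm _ _))
  central := fun x y => Subtype.ext (mul_assoc (x : H →L[ℂ] H) T y)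

theorem leftMul_fst {T : H →L[ℂ] H} (h : IsMultiplier B T) (b : B) :
    ((leftMul h).fst b : H →L[ℂ] H) = T * b := rfl

theorem leftMul_snd {T : H →L[ℂ] H} (h : IsMultiplier B T) (b : B) :
    ((leftMul h).snd b : H →L[ℂ] H) = b * T := rfl

theorem adjointable_ext {S T : Adjointable B} (h₁ : ∀ b : B, (S.fst b : H →L[ℂ] H) = T.fst b)
    (h₂ : ∀ b : B, (S.snd b : H →L[ℂ] H) = T.snd b) : S = T :=
  DoubleCentralizer.ext ℂ B _ _ (Prod.ext
    (ContinuousLinearMap.ext fun b => Subtype.ext (h₁ b))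
    (ContinuousLinearMap.ext fun b => Subtype.ext (h₂ b)))

theorem toCalkin_eq_of_sub_eq {S T : Adjointable B} (b : B) (h : S - T = leftReg B b) :
    toCalkin B S = toCalkin B T :=
  (Ideal.Quotient.mk_eq_mk_iff_sub_mem _ _).2 ⟨b, h.symm⟩

theorem leftMul_sq {F : H →L[ℂ] H} (h : IsMultiplier B F) (hF : F ^ 2 - 1 ∈ B) :
    toCalkin B (leftMul h) * toCalkin B (leftMul h) = 1 := by
  rw [← RingHom.map_mul, ← RingHom.map_one (toCalkin B)]
  refine toCalkin_eq_of_sub_eq ⟨F ^ 2 - 1, hF⟩ (adjointable_ext (fun b => ?_) (fun b => ?_))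
  · change F * (F * (b : H →L[ℂ] H)) - b = (F ^ 2 - 1) * b
    rw [sub_mul, one_mul, sq, mul_assoc]
  · change (b : H →L[ℂ] H) * F * F - b = b * (F ^ 2 - 1)
    rw [mul_sub, mul_one, sq, mul_assoc]

theorem leftMul_comm {F a : H →L[ℂ] H} (h : IsMultiplier B F) (ha : IsMultiplier B a)
    (hF : F * a - a * F ∈ B) :
    toCalkin B (leftMul h) * toCalkin B (leftMul ha) =
      toCalkin B (leftMul ha) * toCalkin B (leftMul h) := by
  rw [← RingHom.map_mul, ← RingHom.map_mul]
  refine toCalkin_eq_of_sub_eq ⟨F * a - a * F, hF⟩ (adjointable_ext (fun b => ?_) (fun b => ?_))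
  · change F * (a * (b : H →L[ℂ] H)) - a * (F * b) = (F * a - a * F) * b
    rw [sub_mul, mul_assoc, mul_assoc]
  · change (b : H →L[ℂ] H) * F * a - b * a * F = b * (F * a - a * F)
    rw [mul_sub, mul_assoc, mul_assoc]

theorem leftMul_mul_eq_one {a c : H →L[ℂ] H} (ha : IsMultiplier B a) (hc : IsMultiplier B c)
    (h : a * c = 1) : leftMul ha * leftMul hc = 1 := by
  refine adjointable_ext (fun b => ?_) (fun b => ?_)
  · change a * (c * (b : H →L[ℂ] H)) = b
    rw [← mul_assoc, h, one_mul]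
  · change (b : H →L[ℂ] H) * a * c = b
    rw [mul_assoc, h, mul_one]

theorem compression_mul {Q : Type*} [Ring Q] {p u v : Q} (hp : p * p = p) (hu : p * u = u * p)
    (huv : u * v = 1) : (p * u * p + 1 - p) * (p * v * p + 1 - p) = 1 := by
  have h1 : p * u * p = u * p := by rw [hu, mul_assoc, hp]
  have h2 : u * p * (p * v * p) = p := by
    rw [← hu, mul_assoc p u]
    calc p * (u * (p * v * p)) = p * ((u * p) * v * p) := by simp only [mul_assoc]
      _ = p * (p * (u * v) * p) := by rw [← hu]; simp only [mul_assoc]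
      _ = p := by rw [huv, mul_one, hp, hp]
  have h3 : u * p * (1 - p) = 0 := by rw [mul_sub, mul_one, mul_assoc, hp, sub_self]
  have h4 : (1 - p) * (p * v * p) = 0 := by
    rw [sub_mul, one_mul, ← mul_assoc, ← mul_assoc, hp, sub_self]
  have h5 : (1 - p) * (1 - p) = 1 - p := by rw [mul_sub, mul_one, sub_mul, one_mul, hp]; abel
  rw [add_sub_assoc, add_sub_assoc, h1, add_mul, mul_add, mul_add, h2, h3, h4, h5]
  abel

/-- The element `p_F = (F + 1) / 2` of `ℒ(B)`. -/
def pF {F : H →L[ℂ] H} (h : IsMultiplier B F) : Adjointable B :=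
  (1 / 2 : ℂ) • (leftMul h + 1)

theorem toCalkin_smul (c : ℂ) (T : Adjointable B) :
    toCalkin B (c • T) = scalarCalkin B c * toCalkin B T := by
  rw [Algebra.smul_def, map_mul]
  rfl

theorem pF_sq {F : H →L[ℂ] H} (h : IsMultiplier B F) (hF : F ^ 2 - 1 ∈ B) :
    toCalkin B (pF h) * toCalkin B (pF h) = toCalkin B (pF h) := by
  have e : pF h * pF h - pF h = (1 / 4 : ℂ) • (leftMul h * leftMul h - 1) := by
    unfold pF
    rw [smul_mul_smul_comm, mul_add, add_mul, mul_one, one_mul]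
    module
  rw [← RingHom.map_mul, ← sub_eq_zero, ← RingHom.map_sub, e, toCalkin_smul, RingHom.map_sub,
    RingHom.map_mul, leftMul_sq h hF, RingHom.map_one, sub_self, mul_zero]

theorem pF_comm {F a : H →L[ℂ] H} (h : IsMultiplier B F) (ha : IsMultiplier B a)
    (hF : F * a - a * F ∈ B) :
    toCalkin B (pF h) * toCalkin B (leftMul ha) = toCalkin B (leftMul ha) * toCalkin B (pF h) := by
  have e : pF h * leftMul ha - leftMul ha * pF h =
      (1 / 2 : ℂ) • (leftMul h * leftMul ha - leftMul ha * leftMul h) := by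
    unfold pF
    rw [smul_mul_assoc, mul_smul_comm, mul_add, add_mul, mul_one, one_mul]
    module
  rw [← RingHom.map_mul, ← RingHom.map_mul, ← sub_eq_zero, ← RingHom.map_sub, e, toCalkin_smul, RingHom.map_sub,
    RingHom.map_mul, RingHom.map_mul,
    leftMul_comm h ha hF, sub_self, mul_zero]

variable {A : StarSubalgebra ℂ (H →L[ℂ] H)} {F : H →L[ℂ] H}

/-- The invertible element `π_B(p_F u p_F + 1 - p_F)` of the Calkin algebra `𝒞(B)`, for a unitary
`u ∈ A`. Its inverse is `π_B(p_F u* p_F + 1 - p_F)`. -/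
def IsKasparovModule.toeplitz (hK : IsKasparovModule A F B) {u : H →L[ℂ] H} (hu : u ∈ A)
    (huu : u ∈ unitary (H →L[ℂ] H)) : (Calkin B)ˣ where
  val := toCalkin B (pF hK.multiplier_op * leftMul (hK.multiplier u hu) * pF hK.multiplier_op
    + 1 - pF hK.multiplier_op)
  inv := toCalkin B (pF hK.multiplier_op * leftMul (hK.multiplier (star u) (star_mem hu)) *
    pF hK.multiplier_op + 1 - pF hK.multiplier_op)
  val_inv := by
    have h1 : F ^ 2 - 1 ∈ B := by simpa using hK.sq_sub_one 1 (one_mem A)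
    simp only [RingHom.map_sub, RingHom.map_add, RingHom.map_mul, RingHom.map_one]
    refine compression_mul (pF_sq _ h1) (pF_comm _ _ (hK.commutator _ hu)) ?_
    rw [← RingHom.map_mul, leftMul_mul_eq_one _ _ (Unitary.mem_iff.1 huu).2, RingHom.map_one]
  inv_val := by
    have h1 : F ^ 2 - 1 ∈ B := by simpa using hK.sq_sub_one 1 (one_mem A)
    simp only [RingHom.map_sub, RingHom.map_add, RingHom.map_mul, RingHom.map_one]
    refine compression_mul (pF_sq _ h1) (pF_comm _ _ (hK.commutator _ (star_mem hu))) ?_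
    rw [← RingHom.map_mul, leftMul_mul_eq_one _ _ (Unitary.mem_iff.1 huu).1, RingHom.map_one]

/-- The C*-spectral flow `sf_B(D, u* D u) = ∂_B[π_B(p_F u p_F + 1 - p_F)] ∈ K₀(B)`, where `F = F_D`
and `p_F = (F + 1) / 2`. -/
def IsKasparovModule.cstarSpectralFlow (hK : IsKasparovModule A F B) {u : H →L[ℂ] H} (hu : u ∈ A)
    (huu : u ∈ unitary (H →L[ℂ] H)) : KZero B :=
  boundaryMap B (KOne.ofUnit (hK.toeplitz hu huu))

end FlowCStar

end SpectralFlow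

end

noncomputable section

namespace SpectralFlow

open Matrix

/-! ### Classes of orthogonal idempotents. -/

section Orthogonal

/-! Both spectral flows equal the index in `K₀(J)` of the pair of projections `(p, u* p u)`, where
`p = χ(F_D)`.

Von Neumann side. The operator `D_t = D + t u*[D, u]` is a bounded perturbation of `D`, and the
analytic heart is that `F_{D_t} - F_D` lies in `J`. Put `a = (1 + D_t²)^{-1/2}`, `b = (1 +
D²)^{-1/2}` and `C = D_t - D`; then `a, b ∈ J`. The difference `Z = F_{D_t} - F_D` satisfies `a Z +
Z b = a K b` with `K` bounded, formally `a⁻¹ Z + Z b⁻¹ = K` (`sylvester_identity`). Where `b ≤ r`,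
such a solution has norm at most `r ‖K‖` (`norm_le_of_sylvester`), so `Z` is a norm limit of
operators `Z ψ(b)` with `ψ(0) = 0`, which are in `J` (`mem_of_sylvester`,
`boundedTransform_sub_mem`). Since `F² - 1 ∈ J` forces `χ(F) = (F + 1)/2` modulo `J`
(`nonnegProj_sub_mem`), all projections `χ(F_{D_t})` agree modulo `J`. If projections `q`, `r` agree
with `p` modulo `J`, the polar part of `r q` is a partial isometry from `q - (1 - r) ∩ q` to `r - (1
- q) ∩ r` that equals `p` modulo `J` (`exists_partialIsometry`). Hence the index of `(q, r)` is a
difference of classes of `q` and `r` relative to `p` (`projPairIndex_val`), and the sum defining the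
spectral flow telescopes for every admissible partition.

C*-side. With `P = (F + 1)/2`, `a = P u P + 1 - P` and `b = P u* P + 1 - P`, the boundary class is
computed from the Whitehead lift of `diag(a, b)`, whose entries are polynomials in `a` and `b`. Its
image in `K₀(J)` is therefore given by the same polynomials in `N`, relative to the ideal `J`
(`map_boundaryInv`), and depends only on `a` and `b` modulo `J` (`IsExtension.cls_indexIdem_congr`).
Modulo `J` one has `P = p`, and `p` commutes with `u`. So `a` and `b` may be replaced by `v = u x +
1 - p` and `v*`, where `x` is the partial isometry belonging to `(p, u* p u)`. This `v` is a partial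
isometry, and for it the index class is `[1 - v* v] - [1 - v v*] = [k] - [u l u*] = [k] - [l]`, with
`k = (1 - u* p u) ∩ p` and `l = (1 - p) ∩ u* p u` (`cls_indexIdem_compression`). This is the index
of the pair. -/

theorem isIdempotentElem_add_of_orthogonal {S : Type*} [NonUnitalRing S] {e f : S} (he : IsIdempotentElem e)
    (hf : IsIdempotentElem f) (hef : e * f = 0) (hfe : f * e = 0) : IsIdempotentElem (e + f) := by
  unfold IsIdempotentElem at *
  rw [add_mul, mul_add, mul_add, he, hf, hef, hfe, add_zero, zero_add]

variable {S : Type*} [Ring S]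

theorem KZeroUnital.cls_congr {ι : Type*} [Fintype ι] {e f : Matrix ι ι S} (h : e = f)
    (he : IsIdempotentElem e) (hf : IsIdempotentElem f) :
    KZeroUnital.cls e he = KZeroUnital.cls f hf := by
  subst h
  rfl

/-- By orthogonality the row `(e, f)` and the column with entries `e`, `f` implement an equivalence
between `e + f` and `diag(e, f)`. -/
theorem KZeroUnital.cls_add {ι : Type*} [Fintype ι] {e f : Matrix ι ι S}
    (he : IsIdempotentElem e) (hf : IsIdempotentElem f) (hef : e * f = 0) (hfe : f * e = 0)
    (hs : IsIdempotentElem (e + f)) :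
    KZeroUnital.cls (e + f) hs = KZeroUnital.cls e he + KZeroUnital.cls f hf := by
  rw [← KZeroUnital.cls_fromBlocks he hf]
  refine KZeroUnital.cls_eq _ _ (fromCols e f) (fromRows e f) ?_ ?_
  · rw [fromCols_mul_fromRows, he, hf]
  · rw [fromRows_mul_fromCols, he, hf, hef, hfe]

theorem KZeroUnital.cls_zero {ι : Type*} [Fintype ι]
    (h : IsIdempotentElem (0 : Matrix ι ι S)) : KZeroUnital.cls 0 h = 0 := by
  have h0 : IsIdempotentElem (0 + 0 : Matrix ι ι S) := by rwa [add_zero]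
  have h1 := KZeroUnital.cls_add h h (mul_zero _) (mul_zero _) h0
  rw [KZeroUnital.cls_congr (add_zero 0) h0 h] at h1
  exact left_eq_add.1 h1

end Orthogonal

/-! ### Calculus of 2 × 2 matrices, rows and columns. -/

section TwoByTwo

variable {S T : Type*} [Ring S] [Ring T]

/-- The `1 × 1` matrix with entry `a`. -/
def single (a : S) : Matrix (Fin 1) (Fin 1) S := Matrix.of fun _ _ => a

/-- The `2 × 2` matrix with rows `(a, b)` and `(c, d)`. -/
def block (a b c d : S) : Matrix (Fin 1 ⊕ Fin 1) (Fin 1 ⊕ Fin 1) S :=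
  fromBlocks (single a) (single b) (single c) (single d)

/-- The row `(a, b)`. -/
def row (a b : S) : Matrix (Fin 1) (Fin 1 ⊕ Fin 1) S := fromCols (single a) (single b)

/-- The column with entries `a` and `b`. -/
def column (a b : S) : Matrix (Fin 1 ⊕ Fin 1) (Fin 1) S := fromRows (single a) (single b)

theorem single_mul (a b : S) : single a * single b = single (a * b) := by
  ext i j
  simp [single, Matrix.mul_apply]

theorem single_add (a b : S) : single a + single b = single (a + b) := rfl

theorem single_zero : single (0 : S) = 0 := rfl

theorem single_one : single (1 : S) = 1 := by
  ext i j
  rw [Subsingleton.elim i j]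
  simp [single]

theorem single_map (φ : S →+* T) (a : S) : (single a).map φ = single (φ a) := rfl

theorem block_mul (a b c d a' b' c' d' : S) :
    block a b c d * block a' b' c' d' =
      block (a * a' + b * c') (a * b' + b * d') (c * a' + d * c') (c * b' + d * d') := by
  simp only [block, fromBlocks_multiply, single_mul, single_add]

theorem block_add (a b c d a' b' c' d' : S) :
    block a b c d + block a' b' c' d' = block (a + a') (b + b') (c + c') (d + d') := by
  simp only [block, fromBlocks_add, single_add]

theorem block_map (φ : S →+* T) (a b c d : S) :
    (block a b c d).map φ = block (φ a) (φ b) (φ c) (φ d) := by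
  simp only [block, fromBlocks_map, single_map]

theorem block_one : block (1 : S) 0 0 1 = 1 := by
  rw [block, single_zero, single_one, fromBlocks_one]

theorem block_zero : block (0 : S) 0 0 0 = 0 := by
  rw [block, single_zero, fromBlocks_zero]

theorem cornerProj_eq_block : cornerProj (Fin 1) S = block 1 0 0 0 := by
  rw [block, single_zero, single_one, cornerProj]

theorem row_map (φ : S →+* T) (a b : S) : (row a b).map φ = row (φ a) (φ b) := by
  ext i j
  rcases j with j | j <;> rfl

theorem column_map (φ : S →+* T) (a b : S) : (column a b).map φ = column (φ a) (φ b) := by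
  ext i j
  rcases i with i | i <;> rfl

theorem row_mul_column (a b c d : S) : row a b * column c d = single (a * c + b * d) := by
  rw [row, column, fromCols_mul_fromRows, single_mul, single_mul, single_add]

theorem column_mul_row (a b c d : S) :
    column a b * row c d = block (a * c) (a * d) (b * c) (b * d) := by
  rw [row, column, fromRows_mul_fromCols]
  simp only [single_mul, block]

theorem row_zero : row (0 : S) 0 = 0 := by
  ext i j
  rcases j with j | j <;> rfl

theorem column_zero : column (0 : S) 0 = 0 := by
  ext i j
  rcases i with i | i <;> rfl

end TwoByTwo

/-! ### K-theory classes of idempotents over `E` that are scalar modulo an ideal `R`. -/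

section Extension

set_option linter.unusedSectionVars false

variable {R E Q : Type*} [NonUnitalCStarAlgebra R] [Ring E] [Algebra ℂ E] [Ring Q]

/-- The sequence `0 → R → E → Q` is exact. -/
structure IsExtension (j : R →ₙₐ[ℂ] E) (π : E →+* Q) : Prop where
  injective : Function.Injective j
  ker : ∀ x, π x = 0 ↔ ∃ r, j r = x

/-- The homomorphism `R⁺ → E` extending `j`. -/
abbrev unitizationLift (j : R →ₙₐ[ℂ] E) : Unitization ℂ R →+* E :=
  (Unitization.lift j : Unitization ℂ R →ₐ[ℂ] E)

theorem unitizationLift_apply (j : R →ₙₐ[ℂ] E) (x : Unitization ℂ R) :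
    unitizationLift j x = algebraMap ℂ E x.fst + j x.snd := rfl

/-- The matrix `X` over `E` agrees modulo the ideal with the scalar matrix `s`. -/
def Liftable (π : E →+* Q) {ι κ : Type*} (s : Matrix ι κ ℂ) (X : Matrix ι κ E) : Prop :=
  X.map π = (s.map (algebraMap ℂ E)).map π

theorem Liftable.mul {π : E →+* Q} {ι κ μ : Type*} [Fintype κ] {s : Matrix ι κ ℂ}
    {t : Matrix κ μ ℂ} {X : Matrix ι κ E} {Y : Matrix κ μ E} (hX : Liftable π s X)
    (hY : Liftable π t Y) : Liftable π (s * t) (X * Y) := by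
  unfold Liftable at *
  rw [Matrix.map_mul, hX, hY, Matrix.map_mul, Matrix.map_mul]

theorem Liftable.add {π : E →+* Q} {ι κ : Type*} {s t : Matrix ι κ ℂ} {X Y : Matrix ι κ E}
    (hX : Liftable π s X) (hY : Liftable π t Y) : Liftable π (s + t) (X + Y) := by
  unfold Liftable at *
  rw [Matrix.map_add _ (map_add π), hX, hY, Matrix.map_add _ (map_add (algebraMap ℂ E)),
    Matrix.map_add _ (map_add π)]

theorem Liftable.of_map_eq {π : E →+* Q} {ι κ : Type*} {s : Matrix ι κ ℂ} {X Y : Matrix ι κ E}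
    (hX : Liftable π s X) (h : X.map π = Y.map π) : Liftable π s Y := h.symm.trans hX

theorem liftable_zero {π : E →+* Q} {ι κ : Type*} {X : Matrix ι κ E} (h : X.map π = 0) :
    Liftable π 0 X := by
  unfold Liftable
  rw [h, Matrix.map_zero _ (map_zero _), Matrix.map_zero _ (map_zero _)]

theorem liftable_cornerProj {π : E →+* Q} {X : Matrix (Fin 1 ⊕ Fin 1) (Fin 1 ⊕ Fin 1) E}
    (h : X.map π = block 1 0 0 0) : Liftable π (cornerProj (Fin 1) ℂ) X := by
  unfold Liftable
  rw [h, cornerProj_map, cornerProj_map, cornerProj_eq_block]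

/-- For a matrix `X` over `E` that agrees modulo `R` with the scalar matrix `s`, the matrix over
`R⁺` with scalar part `s` and `R`-part `X - s`. -/
def liftMatrix (j : R →ₙₐ[ℂ] E) {ι κ : Type*} (s : Matrix ι κ ℂ) (X : Matrix ι κ E) :
    Matrix ι κ (Unitization ℂ R) :=
  Matrix.of fun i k => Unitization.inl (s i k) +
    Unitization.inr (Function.invFun j (X i k - algebraMap ℂ E (s i k)))

variable {j : R →ₙₐ[ℂ] E} {π : E →+* Q}

/-- The map `R⁺ → E` alone need not be injective (for instance when `R = E`), but together with the
scalar part it is. Identities over `R⁺` are therefore checked over `ℂ` and over `E`. -/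
theorem IsExtension.matrix_ext (h : IsExtension j π) {ι κ : Type*}
    {M M' : Matrix ι κ (Unitization ℂ R)} (h₁ : M.map (scalarPart R) = M'.map (scalarPart R))
    (h₂ : M.map (unitizationLift j) = M'.map (unitizationLift j)) : M = M' := by
  ext1 i k
  have e₁ : (M i k).fst = (M' i k).fst := congrFun (congrFun h₁ i) k
  have e₂ : unitizationLift j (M i k) = unitizationLift j (M' i k) :=
    congrFun (congrFun h₂ i) k
  rw [unitizationLift_apply, unitizationLift_apply, e₁, add_right_inj] at e₂
  exact Unitization.ext e₁ (h.injective e₂)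

theorem liftMatrix_scalarPart {ι κ : Type*} (s : Matrix ι κ ℂ) (X : Matrix ι κ E) :
    (liftMatrix j s X).map (scalarPart R) = s := by
  ext i k
  simp [liftMatrix, scalarPart]

theorem IsExtension.liftMatrix_map (h : IsExtension j π) {ι κ : Type*} {s : Matrix ι κ ℂ}
    {X : Matrix ι κ E} (hX : Liftable π s X) :
    (liftMatrix j s X).map (unitizationLift j) = X := by
  ext1 i k
  have hik : π (X i k) = π (algebraMap ℂ E (s i k)) := congrFun (congrFun hX i) k
  rw [← sub_eq_zero, ← map_sub, h.ker] at hik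
  change algebraMap ℂ E (liftMatrix j s X i k).fst + j (liftMatrix j s X i k).snd = _
  simp only [liftMatrix, of_apply, Unitization.fst_add, Unitization.snd_add, Unitization.fst_inl,
    Unitization.fst_inr, Unitization.snd_inl, Unitization.snd_inr, add_zero, zero_add]
  rw [Function.invFun_eq hik]
  abel

theorem IsExtension.liftMatrix_eq (h : IsExtension j π) {ι κ : Type*}
    (M : Matrix ι κ (Unitization ℂ R)) :
    liftMatrix j (M.map (scalarPart R)) (M.map (unitizationLift j)) = M := by
  refine h.matrix_ext (liftMatrix_scalarPart _ _) (h.liftMatrix_map ?_)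
  ext1 i k
  change π (algebraMap ℂ E (M i k).fst + j (M i k).snd) = π (algebraMap ℂ E (M i k).fst)
  rw [map_add, (h.ker _).2 ⟨_, rfl⟩, add_zero]

theorem IsExtension.liftMatrix_mul (h : IsExtension j π) {ι κ μ : Type*} [Fintype κ]
    {s : Matrix ι κ ℂ} {t : Matrix κ μ ℂ} {X : Matrix ι κ E} {Y : Matrix κ μ E}
    (hX : Liftable π s X) (hY : Liftable π t Y) :
    liftMatrix j s X * liftMatrix j t Y = liftMatrix j (s * t) (X * Y) := by
  apply h.matrix_ext
  · rw [Matrix.map_mul, liftMatrix_scalarPart, liftMatrix_scalarPart, liftMatrix_scalarPart]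
  · rw [Matrix.map_mul, h.liftMatrix_map hX, h.liftMatrix_map hY, h.liftMatrix_map (hX.mul hY)]

theorem IsExtension.liftMatrix_add (h : IsExtension j π) {ι κ : Type*}
    {s t : Matrix ι κ ℂ} {X Y : Matrix ι κ E} (hX : Liftable π s X) (hY : Liftable π t Y) :
    liftMatrix j s X + liftMatrix j t Y = liftMatrix j (s + t) (X + Y) := by
  apply h.matrix_ext
  · rw [Matrix.map_add _ (map_add _), liftMatrix_scalarPart, liftMatrix_scalarPart,
      liftMatrix_scalarPart]
  · rw [Matrix.map_add _ (map_add _), h.liftMatrix_map hX, h.liftMatrix_map hY,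
      h.liftMatrix_map (hX.add hY)]

theorem IsExtension.liftMatrix_zero (h : IsExtension j π) {ι κ : Type*} :
    liftMatrix j (0 : Matrix ι κ ℂ) 0 = 0 := by
  have := h.liftMatrix_eq (0 : Matrix ι κ (Unitization ℂ R))
  rwa [Matrix.map_zero _ (map_zero _), Matrix.map_zero _ (map_zero _)] at this

/-- The idempotent `X` over `E` agrees modulo the ideal with the idempotent scalar matrix `s`. -/
structure LiftableIdem (π : E →+* Q) {ι : Type*} [Fintype ι] (s : Matrix ι ι ℂ)
    (X : Matrix ι ι E) : Prop where
  idem : IsIdempotentElem X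
  scalar_idem : IsIdempotentElem s
  liftable : Liftable π s X

theorem IsExtension.liftMatrix_idem (h : IsExtension j π) {ι : Type*} [Fintype ι]
    {s : Matrix ι ι ℂ} {X : Matrix ι ι E} (hX : LiftableIdem π s X) :
    IsIdempotentElem (liftMatrix j s X) := by
  unfold IsIdempotentElem
  rw [h.liftMatrix_mul hX.liftable hX.liftable, hX.idem, hX.scalar_idem]

/-- The class in `K₀(R⁺)` of an idempotent over `E` that is scalar modulo `R`. -/
def IsExtension.cls (h : IsExtension j π) {ι : Type*} [Fintype ι] {s : Matrix ι ι ℂ}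
    {X : Matrix ι ι E} (hX : LiftableIdem π s X) : KZeroUnital (Unitization ℂ R) :=
  KZeroUnital.cls (liftMatrix j s X) (h.liftMatrix_idem hX)

theorem IsExtension.cls_congr (h : IsExtension j π) {ι : Type*} [Fintype ι] {s t : Matrix ι ι ℂ}
    {X Y : Matrix ι ι E} (hX : LiftableIdem π s X) (hY : LiftableIdem π t Y) (hst : s = t)
    (hXY : X = Y) : h.cls hX = h.cls hY := by
  subst hst hXY
  rfl

/-- An equivalence over `E` is not enough: the intertwiners `x`, `y` must themselves be scalar
modulo `R`, with scalar parts that implement an equivalence of `s` and `t`. Then they lift to `R⁺`.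
-/
theorem IsExtension.cls_eq (h : IsExtension j π) {ι κ : Type*} [Fintype ι] [Fintype κ]
    {s : Matrix ι ι ℂ} {X : Matrix ι ι E} {t : Matrix κ κ ℂ} {Y : Matrix κ κ E}
    (hX : LiftableIdem π s X) (hY : LiftableIdem π t Y)
    {a : Matrix ι κ ℂ} {x : Matrix ι κ E} {b : Matrix κ ι ℂ} {y : Matrix κ ι E}
    (hx : Liftable π a x) (hy : Liftable π b y) (hab : a * b = s) (hba : b * a = t)
    (hxy : x * y = X) (hyx : y * x = Y) : h.cls hX = h.cls hY := by
  refine KZeroUnital.cls_eq _ _ (liftMatrix j a x) (liftMatrix j b y) ?_ ?_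
  · rw [h.liftMatrix_mul hx hy, hab, hxy]
  · rw [h.liftMatrix_mul hy hx, hba, hyx]

theorem LiftableIdem.add {ι : Type*} [Fintype ι] {s t : Matrix ι ι ℂ}
    {X Y : Matrix ι ι E} (hX : LiftableIdem π s X) (hY : LiftableIdem π t Y)
    (hst : s * t = 0) (hts : t * s = 0) (hXY : X * Y = 0) (hYX : Y * X = 0) :
    LiftableIdem π (s + t) (X + Y) :=
  ⟨isIdempotentElem_add_of_orthogonal hX.idem hY.idem hXY hYX,
    isIdempotentElem_add_of_orthogonal hX.scalar_idem hY.scalar_idem hst hts,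
    hX.liftable.add hY.liftable⟩

theorem IsExtension.cls_add (h : IsExtension j π) {ι : Type*} [Fintype ι] {s t : Matrix ι ι ℂ}
    {X Y : Matrix ι ι E} (hX : LiftableIdem π s X) (hY : LiftableIdem π t Y)
    (hst : s * t = 0) (hts : t * s = 0) (hXY : X * Y = 0) (hYX : Y * X = 0) :
    h.cls (hX.add hY hst hts hXY hYX) = h.cls hX + h.cls hY := by
  have z : ∀ {a b : Matrix ι ι ℂ} {A B : Matrix ι ι E}, Liftable π a A → Liftable π b B →
      a * b = 0 → A * B = 0 → liftMatrix j a A * liftMatrix j b B = 0 := by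
    intro a b A B hA hB hab hAB
    rw [h.liftMatrix_mul hA hB, hab, hAB, h.liftMatrix_zero]
  have i₁ := h.liftMatrix_idem hX
  have i₂ := h.liftMatrix_idem hY
  have o₁ := z hX.liftable hY.liftable hst hXY
  have o₂ := z hY.liftable hX.liftable hts hYX
  unfold IsExtension.cls
  rw [← KZeroUnital.cls_add i₁ i₂ o₁ o₂ (isIdempotentElem_add_of_orthogonal i₁ i₂ o₁ o₂)]
  exact KZeroUnital.cls_congr (h.liftMatrix_add hX.liftable hY.liftable).symm _ _

/-- An idempotent in the ideal, as an idempotent `1 × 1` matrix. -/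
theorem liftableIdem_single {e : E} (he : IsIdempotentElem e) (hπ : π e = 0) :
    LiftableIdem π (0 : Matrix (Fin 1) (Fin 1) ℂ) (single e) where
  idem := by rw [IsIdempotentElem, single_mul, he]
  scalar_idem := mul_zero _
  liftable := liftable_zero (by rw [single_map, hπ, single_zero])

/-! ### Classes of idempotents relative to a base idempotent `p`. -/

section Base

variable {p : E}

/-- The symmetry that conjugates `diag(p, 1 - p)` to `diag(1, 0)`. -/
def symmetry (p : E) : Matrix (Fin 1 ⊕ Fin 1) (Fin 1 ⊕ Fin 1) E := block p (1 - p) (1 - p) p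

theorem symmetry_mul_self (hp : IsIdempotentElem p) : symmetry p * symmetry p = 1 := by
  have h1 := hp.mul_one_sub_self
  have h2 := hp.one_sub_mul_self
  have h3 := hp.one_sub
  unfold IsIdempotentElem at hp h3
  rw [symmetry, block_mul, hp, h1, h2, h3, ← block_one]
  congr 1 <;> abel

theorem symmetry_conj_mul (hp : IsIdempotentElem p)
    (X Y : Matrix (Fin 1 ⊕ Fin 1) (Fin 1 ⊕ Fin 1) E) :
    symmetry p * X * symmetry p * (symmetry p * Y * symmetry p) =
      symmetry p * (X * Y) * symmetry p := by
  calc _ = symmetry p * X * (symmetry p * symmetry p) * Y * symmetry p := by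
        simp only [Matrix.mul_assoc]
    _ = _ := by rw [symmetry_mul_self hp]; simp only [Matrix.mul_assoc, Matrix.one_mul]

/-- An element equal to `p` modulo `R` is in general not scalar modulo `R`, so it does not lift to
`R⁺`. Adding `1 - p` in the second corner and conjugating by `symmetry p` repairs this. Idempotence
of `x` is not needed, so intertwiners lift in the same way. -/
theorem liftable_symmetry_conj (hp : IsIdempotentElem p) {x : E} (hx : π x = π p) :
    Liftable π (cornerProj (Fin 1) ℂ) (symmetry p * block x 0 0 (1 - p) * symmetry p) := by
  refine liftable_cornerProj ?_
  have h1 := hp.mul_one_sub_self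
  have h2 := hp.one_sub_mul_self
  have h3 := hp.one_sub
  unfold IsIdempotentElem at hp h3
  have e : (symmetry p * block x 0 0 (1 - p) * symmetry p).map π =
      (symmetry p * block p 0 0 (1 - p) * symmetry p).map π := by
    rw [Matrix.map_mul, Matrix.map_mul, Matrix.map_mul, Matrix.map_mul, block_map, block_map, hx]
  rw [e, symmetry, block_mul, block_mul]
  simp only [mul_zero, zero_mul, add_zero, zero_add, hp, h1, h2, h3, block_map, map_add, map_zero]
  rw [← map_add, add_sub_cancel, map_one]

theorem liftableIdem_symmetry_conj (hp : IsIdempotentElem p) {q : E} (hq : IsIdempotentElem q)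
    (hπ : π q = π p) : LiftableIdem π (cornerProj (Fin 1) ℂ)
      (symmetry p * block q 0 0 (1 - p) * symmetry p) where
  idem := by
    rw [IsIdempotentElem, symmetry_conj_mul hp, block_mul, hq, hp.one_sub]
    simp
  scalar_idem := cornerProj_idem ℂ
  liftable := liftable_symmetry_conj hp hπ

/-- For a fixed idempotent `p ∈ E`, the class of an idempotent `q ∈ E` with `q = p` modulo `R`: it
differs from the relative class of the pair `(q, p)` by `[1]`. -/
def IsExtension.relCls (h : IsExtension j π) (hp : IsIdempotentElem p) {q : E}
    (hq : IsIdempotentElem q) (hπ : π q = π p) : KZeroUnital (Unitization ℂ R) :=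
  h.cls (liftableIdem_symmetry_conj hp hq hπ)

theorem IsExtension.relCls_eq (h : IsExtension j π) (hp : IsIdempotentElem p) {q q' : E}
    (hq : IsIdempotentElem q) (hπ : π q = π p) (hq' : IsIdempotentElem q') (hπ' : π q' = π p)
    {x y : E} (hx : π x = π p) (hy : π y = π p) (hxy : x * y = q) (hyx : y * x = q') :
    h.relCls hp hq hπ = h.relCls hp hq' hπ' := by
  have hc : cornerProj (Fin 1) ℂ * cornerProj (Fin 1) ℂ = cornerProj (Fin 1) ℂ := cornerProj_idem ℂ
  refine h.cls_eq _ _ (liftable_symmetry_conj hp hx) (liftable_symmetry_conj hp hy) hc hc ?_ ?_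
  · rw [symmetry_conj_mul hp, block_mul, hxy, hp.one_sub]
    simp
  · rw [symmetry_conj_mul hp, block_mul, hyx, hp.one_sub]
    simp

/-- The summand `e` contributes the conjugate of `diag(e, 0)` by `symmetry p`. The column `(e, 0)`
multiplied by `symmetry p` on the left, and the row `(e, 0)` multiplied by it on the right, are zero
modulo `R` and identify this class with `[e]`. -/
theorem IsExtension.relCls_add (h : IsExtension j π) (hp : IsIdempotentElem p) {q e : E}
    (hq : IsIdempotentElem q) (hπ : π q = π p) (he : IsIdempotentElem e) (hπe : π e = 0)
    (hqe : q * e = 0) (heq : e * q = 0) (hs : IsIdempotentElem (q + e))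
    (hπs : π (q + e) = π p) :
    h.relCls hp hs hπs = h.relCls hp hq hπ + h.cls (liftableIdem_single he hπe) := by
  have hZ := symmetry_mul_self hp
  have hL : LiftableIdem π 0 (symmetry p * block e 0 0 0 * symmetry p) := by
    refine ⟨?_, mul_zero _, liftable_zero ?_⟩
    · rw [IsIdempotentElem, symmetry_conj_mul hp, block_mul, he]
      simp
    · rw [Matrix.map_mul, Matrix.map_mul, block_map, hπe, map_zero, block_zero, Matrix.mul_zero,
        Matrix.zero_mul]
  have hE : h.cls hL = h.cls (liftableIdem_single he hπe) := by
    have e1 : (symmetry p * column e 0).map π = 0 := by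
      rw [Matrix.map_mul, column_map, hπe, map_zero, column_zero, Matrix.mul_zero]
    have e2 : (row e 0 * symmetry p).map π = 0 := by
      rw [Matrix.map_mul, row_map, hπe, map_zero, row_zero, Matrix.zero_mul]
    refine h.cls_eq _ _ (liftable_zero e1) (liftable_zero e2) (Matrix.mul_zero _)
      (Matrix.mul_zero _) ?_ ?_
    · rw [Matrix.mul_assoc, ← Matrix.mul_assoc (column e 0), column_mul_row, he,
        ← Matrix.mul_assoc]
      simp
    · rw [Matrix.mul_assoc, ← Matrix.mul_assoc (symmetry p), hZ, Matrix.one_mul, row_mul_column,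
        he]
      simp
  have o : ∀ {a b : E}, a * b = 0 → ∀ c d : E, c * d = 0 →
      symmetry p * block a 0 0 c * symmetry p * (symmetry p * block b 0 0 d * symmetry p) = 0 := by
    intro a b hab c d hcd
    rw [symmetry_conj_mul hp, block_mul, hab, hcd]
    simp [block_zero]
  rw [← hE]
  unfold IsExtension.relCls
  rw [← h.cls_add _ hL (Matrix.mul_zero _) (Matrix.zero_mul _) (o hqe _ _ (mul_zero _))
    (o heq _ _ (zero_mul _))]
  refine h.cls_congr _ _ (add_zero _).symm ?_
  rw [← Matrix.add_mul, ← Matrix.mul_add, block_add]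
  simp

/-- If `p₁ - k` and `p₂ - l` are equivalent by elements equal to `p` modulo `R`, then `[k] - [l]` is
the difference of the relative classes of `p₁` and `p₂`. -/
theorem IsExtension.cls_sub_cls (h : IsExtension j π) (hp : IsIdempotentElem p) {p₁ p₂ k l x y : E}
    (h₁ : IsIdempotentElem p₁) (hπ₁ : π p₁ = π p) (h₂ : IsIdempotentElem p₂) (hπ₂ : π p₂ = π p)
    (hk : IsIdempotentElem k) (hπk : π k = 0) (hl : IsIdempotentElem l) (hπl : π l = 0)
    (hk₁ : k * p₁ = k) (hk₂ : p₁ * k = k) (hl₁ : l * p₂ = l) (hl₂ : p₂ * l = l)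
    (hx : π x = π p) (hy : π y = π p) (hxy : x * y = p₁ - k) (hyx : y * x = p₂ - l) :
    h.cls (liftableIdem_single hk hπk) - h.cls (liftableIdem_single hl hπl) =
      h.relCls hp h₁ hπ₁ - h.relCls hp h₂ hπ₂ := by
  -- The orthogonal splitting `a = (a - e) + e` is used for `(p₁, k)` and for `(p₂, l)`; the
  -- relative classes of `p₁ - k` and `p₂ - l` then cancel.
  have key : ∀ {a e : E} (ha : IsIdempotentElem a) (hπa : π a = π p) (he : IsIdempotentElem e)
      (hπe : π e = 0) (_ : e * a = e) (_ : a * e = e),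
      ∃ (hs : IsIdempotentElem (a - e)) (hπs : π (a - e) = π p), h.relCls hp ha hπa =
        h.relCls hp hs hπs + h.cls (liftableIdem_single he hπe) := by
    intro a e ha hπa he hπe hea hae
    have hs : IsIdempotentElem (a - e) := by
      unfold IsIdempotentElem at *
      rw [sub_mul, mul_sub, mul_sub, ha, he, hea, hae, sub_self, sub_zero]
    have hπs : π (a - e) = π p := by rw [map_sub, hπa, hπe, sub_zero]
    refine ⟨hs, hπs, ?_⟩
    have o₁ : (a - e) * e = 0 := by rw [sub_mul, hae, he, sub_self]
    have o₂ : e * (a - e) = 0 := by rw [mul_sub, hea, he, sub_self]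
    have e1 : a - e + e = a := sub_add_cancel a e
    rw [← h.relCls_add hp hs hπs he hπe o₁ o₂ (by rwa [e1]) (by rwa [e1])]
    exact h.cls_congr _ _ rfl (by rw [e1])
  obtain ⟨hs₁, hσ₁, e₁⟩ := key h₁ hπ₁ hk hπk hk₁ hk₂
  obtain ⟨hs₂, hσ₂, e₂⟩ := key h₂ hπ₂ hl hπl hl₁ hl₂
  rw [e₁, e₂, h.relCls_eq hp hs₁ hσ₁ hs₂ hσ₂ hx hy hxy hyx]
  abel

end Base

/-! ### The index idempotent of an element invertible modulo `R`. -/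

section Index

/-- The invertible matrix over `E` lifting `diag(a, b)` when `a b = b a = 1` modulo `R`. -/
def diagLift (a b : E) : (Matrix (Fin 1 ⊕ Fin 1) (Fin 1 ⊕ Fin 1) E)ˣ where
  -- Whitehead's product `(1 a; 0 1) (1 0; -b 1) (1 a; 0 1) (0 -1; 1 0)`, invertible for arbitrary
  -- `a` and `b`.
  val := block (2 * a - a * b * a) (a * b - 1) (1 - b * a) b
  inv := block b (1 - b * a) (a * b - 1) (2 * a - a * b * a)
  val_inv := by
    rw [block_mul, ← block_one]
    congr 1 <;> noncomm_ring
  inv_val := by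
    rw [block_mul, ← block_one]
    congr 1 <;> noncomm_ring

/-- The idempotent `w diag(1, 0) w⁻¹` for `w = diagLift a b`. -/
def indexIdem (a b : E) : Matrix (Fin 1 ⊕ Fin 1) (Fin 1 ⊕ Fin 1) E :=
  block (1 - (1 - a * b) * (1 - a * b)) ((2 * a - a * b * a) * (1 - b * a)) ((1 - b * a) * b)
    ((1 - b * a) * (1 - b * a))

theorem indexIdem_eq (a b : E) :
    indexIdem a b = (diagLift a b).val * block 1 0 0 0 * (diagLift a b)⁻¹.val := by
  change _ = block _ _ _ _ * block 1 0 0 0 * block _ _ _ _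
  rw [block_mul, block_mul, indexIdem]
  congr 1 <;> noncomm_ring

theorem indexIdem_map {S : Type*} [Ring S] (φ : E →+* S) (a b : E) :
    (indexIdem a b).map φ = block (1 - (1 - φ a * φ b) * (1 - φ a * φ b))
      ((2 * φ a - φ a * φ b * φ a) * (1 - φ b * φ a)) ((1 - φ b * φ a) * φ b)
      ((1 - φ b * φ a) * (1 - φ b * φ a)) := by
  rw [indexIdem, block_map]
  simp only [map_sub, map_mul, map_one, map_ofNat]

theorem liftableIdem_indexIdem {a b : E} (hab : π a * π b = 1) (hba : π b * π a = 1) :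
    LiftableIdem π (cornerProj (Fin 1) ℂ) (indexIdem a b) where
  idem := by
    rw [indexIdem_eq]
    unfold IsIdempotentElem
    calc _ = (diagLift a b).val * block 1 0 0 0 * ((diagLift a b)⁻¹.val * (diagLift a b).val) *
          block 1 0 0 0 * (diagLift a b)⁻¹.val := by simp only [Matrix.mul_assoc]
      _ = (diagLift a b).val * (block 1 0 0 0 * block 1 0 0 0) * (diagLift a b)⁻¹.val := by
          rw [Units.inv_mul, Matrix.mul_one, Matrix.mul_assoc (diagLift a b).val]
      _ = _ := by rw [block_mul]; simp
  scalar_idem := cornerProj_idem ℂ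
  liftable := by
    refine liftable_cornerProj ?_
    rw [indexIdem_map, hab, hba]
    simp

/-- The two lifts `w`, `w'` agree modulo `R`, as do their inverses. So `w diag(1, 0) w'⁻¹` and `w'
diag(1, 0) w⁻¹` equal `diag(1, 0)` modulo `R`, and they intertwine the two idempotents. -/
theorem IsExtension.cls_indexIdem_congr (h : IsExtension j π) {a b a' b' : E}
    (hab : π a * π b = 1) (hba : π b * π a = 1) (hab' : π a' * π b' = 1) (hba' : π b' * π a' = 1)
    (ha : π a = π a') (hb : π b = π b') :
    h.cls (liftableIdem_indexIdem hab hba) = h.cls (liftableIdem_indexIdem hab' hba') := by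
  set w := diagLift a b
  set w' := diagLift a' b'
  have hw : w.val.map π = w'.val.map π := by
    change (block _ _ _ _).map π = (block _ _ _ _).map π
    rw [block_map, block_map]
    simp only [map_sub, map_mul, map_one, map_ofNat, ha, hb]
  have hw1 : w⁻¹.val.map π = w'⁻¹.val.map π := by
    change (block _ _ _ _).map π = (block _ _ _ _).map π
    rw [block_map, block_map]
    simp only [map_sub, map_mul, map_one, map_ofNat, ha, hb]
  have hc : cornerProj (Fin 1) ℂ * cornerProj (Fin 1) ℂ = cornerProj (Fin 1) ℂ := cornerProj_idem ℂ
  have hl := (liftableIdem_indexIdem hab hba).liftable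
  rw [indexIdem_eq] at hl
  have hx : Liftable π (cornerProj (Fin 1) ℂ) (w.val * block 1 0 0 0 * w'⁻¹.val) :=
    hl.of_map_eq (by simp only [Matrix.map_mul]; rw [hw1])
  have hy : Liftable π (cornerProj (Fin 1) ℂ) (w'.val * block 1 0 0 0 * w⁻¹.val) :=
    hl.of_map_eq (by simp only [Matrix.map_mul]; rw [hw])
  have key : ∀ v v' : (Matrix (Fin 1 ⊕ Fin 1) (Fin 1 ⊕ Fin 1) E)ˣ,
      v.val * block 1 0 0 0 * v'⁻¹.val * (v'.val * block 1 0 0 0 * v⁻¹.val) =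
        v.val * block 1 0 0 0 * v⁻¹.val := by
    intro v v'
    calc _ = v.val * block 1 0 0 0 * (v'⁻¹.val * v'.val) * block 1 0 0 0 * v⁻¹.val := by
          simp only [Matrix.mul_assoc]
      _ = v.val * (block 1 0 0 0 * block 1 0 0 0) * v⁻¹.val := by
          rw [Units.inv_mul, Matrix.mul_one, Matrix.mul_assoc v.val]
      _ = _ := by rw [block_mul]; simp
  refine h.cls_eq _ _ hx hy hc hc ?_ ?_
  · rw [key, indexIdem_eq]
  · rw [key, indexIdem_eq]

theorem liftableIdem_cornerProj :
    LiftableIdem π (cornerProj (Fin 1) ℂ) (cornerProj (Fin 1) E) where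
  idem := cornerProj_idem E
  scalar_idem := cornerProj_idem ℂ
  liftable := by unfold Liftable; rw [cornerProj_map (algebraMap ℂ E)]

/-- If `v w v = v` and `w v w = w`, then the index class of `v` is `[1 - w v] - [1 - v w]`. -/
theorem IsExtension.cls_indexIdem_sub (h : IsExtension j π) {v w : E}
    (hvw : π v * π w = 1) (hwv : π w * π v = 1) (h₁ : v * w * v = v) (h₂ : w * v * w = w)
    (i₁ : IsIdempotentElem (1 - w * v)) (i₂ : IsIdempotentElem (1 - v * w))
    (z₁ : π (1 - w * v) = 0) (z₂ : π (1 - v * w) = 0) :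
    h.cls (liftableIdem_indexIdem hvw hwv) - h.cls (liftableIdem_cornerProj) =
      h.cls (liftableIdem_single i₁ z₁) - h.cls (liftableIdem_single i₂ z₂) := by
  have i₃ : IsIdempotentElem (v * w) := by simpa using i₂.one_sub
  have hv : LiftableIdem π (cornerProj (Fin 1) ℂ) (block (v * w) 0 0 0) := by
    refine ⟨?_, cornerProj_idem ℂ, liftable_cornerProj ?_⟩
    · rw [IsIdempotentElem, block_mul, i₃]
      simp
    · rw [block_map, map_mul, hvw, map_zero]
  have hd₁ : LiftableIdem π 0 (block 0 0 0 (1 - w * v)) := by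
    refine ⟨?_, mul_zero _, liftable_zero ?_⟩
    · rw [IsIdempotentElem, block_mul, i₁]
      simp
    · rw [block_map, z₁, map_zero, block_zero]
  have hd₂ : LiftableIdem π 0 (block (1 - v * w) 0 0 0) := by
    refine ⟨?_, mul_zero _, liftable_zero ?_⟩
    · rw [IsIdempotentElem, block_mul, i₂]
      simp
    · rw [block_map, z₂, map_zero, block_zero]
  have c₁ : h.cls hd₁ = h.cls (liftableIdem_single i₁ z₁) := by
    refine h.cls_eq _ _ (x := column 0 (1 - w * v)) (y := row 0 (1 - w * v)) (liftable_zero ?_)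
      (liftable_zero ?_) (Matrix.mul_zero _) (Matrix.mul_zero _) ?_ ?_
    · rw [column_map, z₁, map_zero, column_zero]
    · rw [row_map, z₁, map_zero, row_zero]
    · rw [column_mul_row, i₁]
      simp
    · rw [row_mul_column, i₁]
      simp
  have c₂ : h.cls hd₂ = h.cls (liftableIdem_single i₂ z₂) := by
    refine h.cls_eq _ _ (x := column (1 - v * w) 0) (y := row (1 - v * w) 0) (liftable_zero ?_)
      (liftable_zero ?_) (Matrix.mul_zero _) (Matrix.mul_zero _) ?_ ?_
    · rw [column_map, z₂, map_zero, column_zero]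
    · rw [row_map, z₂, map_zero, row_zero]
    · rw [column_mul_row, i₂]
      simp
    · rw [row_mul_column, i₂]
      simp
  have o₁ : v * w * (1 - v * w) = 0 := i₃.mul_one_sub_self
  have o₂ : (1 - v * w) * (v * w) = 0 := i₃.one_sub_mul_self
  have s₁ := h.cls_add hv hd₁ (Matrix.mul_zero _) (Matrix.zero_mul _)
    (by rw [block_mul]; simp [block_zero]) (by rw [block_mul]; simp [block_zero])
  have s₂ := h.cls_add hv hd₂ (Matrix.mul_zero _) (Matrix.zero_mul _)
    (by rw [block_mul, o₁]; simp [block_zero]) (by rw [block_mul, o₂]; simp [block_zero])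
  -- The relations `v w v = v` and `w v w = w` kill the off-diagonal entries and leave `diag(v w, 1
  -- - w v)`. On the other hand `diag(1, 0) = diag(v w, 0) + diag(1 - v w, 0)`, so `diag(v w, 0)`
  -- cancels in the difference.
  have e₁ : h.cls (liftableIdem_indexIdem hvw hwv) = h.cls hv + h.cls hd₁ := by
    rw [← s₁]
    refine h.cls_congr _ _ (add_zero _).symm ?_
    rw [block_add, indexIdem, i₁, i₂, h₁]
    congr 1
    · abel
    · rw [two_mul, add_sub_cancel_right, mul_sub, ← mul_assoc, h₁]
      simp
    · rw [sub_mul, h₂]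
      simp
    · simp
  have e₂ : h.cls (liftableIdem_cornerProj (π := π)) = h.cls hv + h.cls hd₂ := by
    rw [← s₂]
    refine h.cls_congr _ _ (add_zero _).symm ?_
    rw [block_add, cornerProj_eq_block]
    simp
  rw [e₁, e₂, c₁, c₂]
  abel

end Index

end Extension

end SpectralFlow

end

noncomputable section

namespace SpectralFlow

/-! ### Polar decomposition and pairs of projections in a von Neumann algebra. -/

section VonNeumann

set_option linter.unusedSectionVars false

variable {H : Type*} [NormedAddCommGroup H] [InnerProductSpace ℂ H] [CompleteSpace H]
  {N : VonNeumannAlgebra H} {J : NonUnitalStarSubalgebra ℂ (H →L[ℂ] H)}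

open ContinuousLinearMap

local notation "⟪" x ", " y "⟫" => inner ℂ x y

theorem op_mul_apply (S T : H →L[ℂ] H) (x : H) : (S * T) x = S (T x) := rfl

theorem mem_iff_commute {T : H →L[ℂ] H} : T ∈ N ↔ ∀ S ∈ N.commutant, S * T = T * S := by
  conv_lhs => rw [← N.commutant_commutant]
  exact VonNeumannAlgebra.mem_commutant_iff

theorem smul_mem_vonNeumann (c : ℂ) {T : H →L[ℂ] H} (hT : T ∈ N) : c • T ∈ N :=
  N.toStarSubalgebra.smul_mem hT c

theorem mem_of_inverse {T S : H →L[ℂ] H} (hT : T ∈ N) (hTS : T * S = 1) (hST : S * T = 1) :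
    S ∈ N := by
  rw [mem_iff_commute] at hT ⊢
  intro U hU
  calc U * S = S * T * U * S := by rw [hST, one_mul]
    _ = S * (U * T) * S := by rw [hT U hU]; simp only [mul_assoc]
    _ = S * U := by rw [mul_assoc S, mul_assoc U, hTS, mul_one]

theorem abs_mem_vonNeumann {T : H →L[ℂ] H} (hT : T ∈ N) : CFC.abs T ∈ N := by
  rw [mem_iff_commute] at hT ⊢
  intro S hS
  exact Commute.cfcAbs_right (hT S hS).symm (hT (star S) (star_mem hS)).symm

theorem starProjection_mem_vonNeumann {K : Submodule ℂ H} [K.HasOrthogonalProjection]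
    (h : ∀ S ∈ N.commutant, ∀ x ∈ K, S x ∈ K) : K.starProjection ∈ N := by
  rw [VonNeumannAlgebra.IsStarProjection.mem_iff isStarProjection_starProjection]
  intro S hS
  rw [Submodule.range_starProjection]
  exact fun x hx => h S hS x hx

theorem IsIdealIn.mul_mem_left (hJ : IsIdealIn N J) {a x : H →L[ℂ] H} (ha : a ∈ N) (hx : x ∈ J) :
    a * x ∈ J := hJ.mul_left a ha x hx

theorem IsIdealIn.mul_mem_right (hJ : IsIdealIn N J) {a x : H →L[ℂ] H} (ha : a ∈ N) (hx : x ∈ J) :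
    x * a ∈ J := hJ.mul_right a ha x hx

theorem norm_abs_apply (a : H →L[ℂ] H) (x : H) : ‖CFC.abs a x‖ = ‖a x‖ := by
  have h : ⟪CFC.abs a x, CFC.abs a x⟫ = ⟪a x, a x⟫ := by
    have hs : star (CFC.abs a) = CFC.abs a := (IsSelfAdjoint.of_nonneg (CFC.abs_nonneg a)).star_eq
    calc _ = ⟪star (CFC.abs a) x, CFC.abs a x⟫ := by rw [hs]
      _ = ⟪x, (CFC.abs a * CFC.abs a) x⟫ := by
        rw [star_eq_adjoint, adjoint_inner_left]; rfl
      _ = _ := by rw [CFC.abs_mul_abs, star_eq_adjoint, op_mul_apply, adjoint_inner_right]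
  rw [inner_self_eq_norm_sq_to_K, inner_self_eq_norm_sq_to_K] at h
  have h' : ‖CFC.abs a x‖ ^ 2 = ‖a x‖ ^ 2 := by exact_mod_cast h
  exact (sq_eq_sq₀ (norm_nonneg _) (norm_nonneg _)).1 h'

theorem abs_apply_eq_zero_iff (a : H →L[ℂ] H) (x : H) : CFC.abs a x = 0 ↔ a x = 0 := by
  rw [← norm_eq_zero, norm_abs_apply, norm_eq_zero]

/-- Since `A T* = 0`, the range of `T*` lies in the kernel of `A`, where `T` vanishes; hence `T T* =
0`. This is the uniqueness principle behind polar decomposition. -/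
theorem eq_zero_of_mul_eq_zero {A T : H →L[ℂ] H} (hA : IsSelfAdjoint A) (h : T * A = 0)
    (hk : ∀ x, A x = 0 → T x = 0) : T = 0 := by
  have h1 : A * star T = 0 := by
    have := congrArg star h
    rwa [star_mul, hA.star_eq, star_zero] at this
  have h2 : T * star T = 0 := by
    ext x
    exact hk _ (DFunLike.congr_fun h1 x)
  rwa [CStarRing.mul_star_self_eq_zero_iff] at h2

/-- Polar decomposition of a bounded operator. -/
theorem exists_polar (a : H →L[ℂ] H) : ∃ V : H →L[ℂ] H, V * CFC.abs a = a ∧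
    star V * a = CFC.abs a ∧ ∀ x, a x = 0 → V x = 0 := by
  set B := CFC.abs a with hB
  have hBs : IsSelfAdjoint B := IsSelfAdjoint.of_nonneg (CFC.abs_nonneg a)
  set K := (LinearMap.range B.toLinearMap).topologicalClosure with hK
  have hmem : ∀ x, B x ∈ K := fun x => Submodule.le_topologicalClosure _ ⟨x, rfl⟩
  let e : H →ₗ[ℂ] K := B.toLinearMap.codRestrict K hmem
  have hd : DenseRange e := by
    intro y
    rw [Metric.mem_closure_iff]
    intro ε hε
    obtain ⟨z, ⟨w, hw⟩, hz⟩ := Metric.mem_closure_iff.1 y.2 ε hε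
    refine ⟨e w, ⟨w, rfl⟩, ?_⟩
    rw [Subtype.dist_eq]
    change dist (y : H) (B w) < ε
    rwa [show B w = z from hw]
  have hn : ∀ x, ‖a.toLinearMap x‖ ≤ 1 * ‖e x‖ := fun x => by
    rw [one_mul]
    exact (norm_abs_apply a x).symm.le
  -- As `‖a x‖ = ‖|a| x‖`, the assignment `|a| x ↦ a x` is well defined and isometric on the range
  -- of `|a|`, hence extends to its closure. Composition with the projection `P` extends it by zero
  -- to `H`.
  let W : K →L[ℂ] H := a.toLinearMap.extendOfNorm e
  have hW : ∀ x, W (e x) = a x := fun x => LinearMap.extendOfNorm_eq hd ⟨1, hn⟩ x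
  have hW1 : ∀ y, ‖W y‖ ≤ 1 * ‖y‖ := LinearMap.norm_extendOfNorm_apply_le hd 1 hn
  let P : H →L[ℂ] K := K.orthogonalProjectionOnto
  have hPB : ∀ x, P (B x) = e x := fun x =>
    Submodule.orthogonalProjectionOnto_mem_subspace_eq_self (K := K) ⟨B x, hmem x⟩
  refine ⟨W ∘L P, ?_, ?_, ?_⟩
  · ext x
    change W (P (B x)) = a x
    rw [hPB, hW]
  · set V := W ∘L P with hV
    have hVB : ∀ x, V (B x) = a x := fun x => by
      change W (P (B x)) = a x
      rw [hPB, hW]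
    have hV1 : ‖V‖ ≤ 1 := by
      refine opNorm_le_bound _ zero_le_one fun x => (hW1 _).trans ?_
      rw [one_mul, one_mul]
      exact Submodule.norm_orthogonalProjectionOnto_apply_le K x
    ext x
    rw [op_mul_apply, ← sub_eq_zero, ← norm_eq_zero]
    have h1 : ‖star V (a x)‖ ≤ ‖a x‖ := by
      refine (le_opNorm _ _).trans ?_
      rw [norm_star]
      exact mul_le_of_le_one_left (norm_nonneg _) hV1
    -- In the expanded square the inner product is `⟪a x, V |a| x⟫ = ‖a x‖²`, and both squared norms
    -- are at most `‖a x‖²`. Thus contractivity of `V` suffices.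
    have h2 : ‖star V (a x) - B x‖ ^ 2 ≤ 0 := by
      rw [@norm_sub_sq ℂ, star_eq_adjoint, adjoint_inner_left, hVB, ← star_eq_adjoint,
        norm_abs_apply]
      have h3 : RCLike.re ⟪a x, a x⟫ = ‖a x‖ ^ 2 := inner_self_eq_norm_sq (𝕜 := ℂ) _
      rw [h3]
      nlinarith [norm_nonneg (star V (a x)), norm_nonneg (a x)]
    exact pow_eq_zero_iff two_ne_zero |>.1 (le_antisymm h2 (sq_nonneg _))
  · intro x hx
    change W (P x) = 0
    have hPx : P x = 0 := by
      rw [Submodule.orthogonalProjectionOnto_eq_zero_iff, hK, Submodule.orthogonal_closure,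
        Submodule.mem_orthogonal]
      rintro _ ⟨y, rfl⟩
      change ⟪B y, x⟫ = 0
      rw [← hBs.star_eq, star_eq_adjoint, adjoint_inner_left, (abs_apply_eq_zero_iff a x).2 hx,
        inner_zero_right]
    rw [hPx, map_zero]

/-- For `S` in the commutant, `S V - V S` vanishes on the range of `|a|` and on the kernel of `a`,
because `S` commutes with `a` and `|a|`. It is therefore zero. -/
theorem polar_mem_vonNeumann {a V : H →L[ℂ] H} (ha : a ∈ N) (hV : V * CFC.abs a = a)
    (hk : ∀ x, a x = 0 → V x = 0) : V ∈ N := by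
  have hab := abs_mem_vonNeumann ha
  rw [mem_iff_commute] at ha hab ⊢
  intro S hS
  rw [← sub_eq_zero]
  refine eq_zero_of_mul_eq_zero (A := CFC.abs a) (IsSelfAdjoint.of_nonneg (CFC.abs_nonneg a)) ?_ ?_
  · rw [sub_mul, mul_assoc, hV, mul_assoc, hab S hS, ← mul_assoc, hV, ha S hS, sub_self]
  · intro x hx
    rw [abs_apply_eq_zero_iff] at hx
    have h1 : a (S x) = 0 := by
      have := DFunLike.congr_fun (ha S hS) x
      rw [op_mul_apply, op_mul_apply, hx, map_zero] at this
      exact this.symm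
    rw [sub_apply, op_mul_apply, op_mul_apply, hk x hx, hk _ h1, map_zero, sub_zero]

/-- The initial projection of the polar part of `a` is the projection along the kernel of `a`. -/
theorem star_mul_self_polar {a V e : H →L[ℂ] H} (hVs : star V * a = CFC.abs a)
    (hV : V * CFC.abs a = a) (hk : ∀ x, a x = 0 → V x = 0) (he : IsStarProjection e)
    (hae : a * e = a) (hke : ∀ x, a x = 0 → e x = 0) : star V * V = e := by
  have hVe : V * e = V := by
    ext x
    have : V (x - e x) = 0 := hk _ (by
      rw [map_sub, sub_eq_zero]
      exact (DFunLike.congr_fun hae x).symm)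
    rw [map_sub, sub_eq_zero] at this
    exact this.symm
  have hB : star (CFC.abs a) = CFC.abs a := (IsSelfAdjoint.of_nonneg (CFC.abs_nonneg a)).star_eq
  have h1 : CFC.abs a * (star V * V - 1) = 0 := by
    have : (star V * V - 1) * CFC.abs a = 0 := by rw [sub_mul, mul_assoc, hV, hVs, one_mul, sub_self]
    have := congrArg star this
    rwa [star_mul, hB, star_zero, star_sub, star_mul, star_star, star_one] at this
  have h2 : e * (star V * V - 1) = 0 := by
    ext x
    exact hke _ ((abs_apply_eq_zero_iff a _).1 (DFunLike.congr_fun h1 x))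
  have h3 : e * star V = star V := by
    have := congrArg star hVe
    rwa [star_mul, he.isSelfAdjoint.star_eq] at this
  rwa [mul_sub, ← mul_assoc, h3, mul_one, sub_eq_zero] at h2

theorem projMeet_eq {p q : H →L[ℂ] H} (hp : IsStarProjection p) (hq : IsStarProjection q) :
    (LinearMap.range p.toLinearMap ⊓ LinearMap.range q.toLinearMap).topologicalClosure =
      LinearMap.range p.toLinearMap ⊓ LinearMap.range q.toLinearMap :=
  IsClosed.submodule_topologicalClosure_eq
    ((IsIdempotentElem.isClosed_range hp.isIdempotentElem).inter
      (IsIdempotentElem.isClosed_range hq.isIdempotentElem))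

theorem mem_range_iff_of_idem {p : H →L[ℂ] H} (hp : IsIdempotentElem p) (x : H) :
    x ∈ LinearMap.range p.toLinearMap ↔ p x = x := by
  constructor
  · rintro ⟨y, rfl⟩
    exact DFunLike.congr_fun hp y
  · exact fun h => ⟨x, h⟩

theorem isStarProjection_projMeet (p q : H →L[ℂ] H) : IsStarProjection (projMeet p q) :=
  isStarProjection_starProjection

theorem mul_projMeet_left {p q : H →L[ℂ] H} (hp : IsStarProjection p) (hq : IsStarProjection q) :
    p * projMeet p q = projMeet p q := by
  ext x
  have h : projMeet p q x ∈ _ := Submodule.starProjection_apply_mem _ x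
  rw [projMeet_eq hp hq] at h
  exact (mem_range_iff_of_idem hp.isIdempotentElem _).1 h.1

theorem mul_projMeet_right {p q : H →L[ℂ] H} (hp : IsStarProjection p) (hq : IsStarProjection q) :
    q * projMeet p q = projMeet p q := by
  ext x
  have h : projMeet p q x ∈ _ := Submodule.starProjection_apply_mem _ x
  rw [projMeet_eq hp hq] at h
  exact (mem_range_iff_of_idem hq.isIdempotentElem _).1 h.2

theorem projMeet_apply_eq_self {p q : H →L[ℂ] H} {x : H} (hpx : p x = x) (hqx : q x = x) :
    projMeet p q x = x :=
  Submodule.starProjection_eq_self_iff.2 (Submodule.le_topologicalClosure _ ⟨⟨x, hpx⟩, ⟨x, hqx⟩⟩)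

theorem projMeet_mem_vonNeumann {p q : H →L[ℂ] H} (hp : IsStarProjection p)
    (hq : IsStarProjection q) (hpN : p ∈ N) (hqN : q ∈ N) : projMeet p q ∈ N := by
  refine starProjection_mem_vonNeumann fun S hS x hx => ?_
  rw [projMeet_eq hp hq] at hx ⊢
  rw [mem_iff_commute] at hpN hqN
  rw [Submodule.mem_inf] at hx ⊢
  obtain ⟨h1, h2⟩ := hx
  rw [mem_range_iff_of_idem hp.isIdempotentElem] at h1
  rw [mem_range_iff_of_idem hq.isIdempotentElem] at h2
  constructor
  · rw [mem_range_iff_of_idem hp.isIdempotentElem]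
    have := DFunLike.congr_fun (hpN S hS) x
    rw [op_mul_apply, op_mul_apply, h1] at this
    exact this.symm
  · rw [mem_range_iff_of_idem hq.isIdempotentElem]
    have := DFunLike.congr_fun (hqN S hS) x
    rw [op_mul_apply, op_mul_apply, h2] at this
    exact this.symm

theorem star_eq_of_mul {e p : H →L[ℂ] H} (he : IsStarProjection e) (hp : IsStarProjection p)
    (h : p * e = e) : e * p = e := by
  have := congrArg star h
  rwa [star_mul, he.isSelfAdjoint.star_eq, hp.isSelfAdjoint.star_eq] at this

/-- The projection `(1 - q) ∩ p` lies in `J` if `p - q` does. -/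
theorem projMeet_mem_ideal (hJ : IsIdealIn N J) {p q : H →L[ℂ] H} (hp : IsStarProjection p)
    (hq : IsStarProjection q) (hpN : p ∈ N) (hqN : q ∈ N) (hpq : p - q ∈ J) :
    projMeet (1 - q) p ∈ J := by
  have h1 := star_eq_of_mul (isStarProjection_projMeet _ _) hq.one_sub
    (mul_projMeet_left hq.one_sub hp)
  have h2 := star_eq_of_mul (isStarProjection_projMeet _ _) hp (mul_projMeet_right hq.one_sub hp)
  -- The meet lies under `p` and is orthogonal to `q`, so multiplication by `p - q` fixes it.
  have h3 : projMeet (1 - q) p = projMeet (1 - q) p * (p - q) := by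
    rw [mul_sub, mul_one, sub_eq_self] at h1
    rw [mul_sub, h2, h1, sub_zero]
  rw [h3]
  exact hJ.mul_mem_left (projMeet_mem_vonNeumann hq.one_sub hp (sub_mem (one_mem N) hqN) hpN) hpq

/-- If `q p x = 0`, then `p x` lies in the range of `(1 - q) ∩ p`. So `p - (1 - q) ∩ p` is the
support projection of `q p`. -/
theorem ker_mul_of_projMeet {p q : H →L[ℂ] H} (hp : IsStarProjection p) (hq : IsStarProjection q) :
    IsStarProjection (p - projMeet (1 - q) p) ∧
      q * p * (p - projMeet (1 - q) p) = q * p ∧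
      ∀ x, (q * p) x = 0 → (p - projMeet (1 - q) p) x = 0 := by
  set k := projMeet (1 - q) p with hk
  have hks : IsStarProjection k := isStarProjection_projMeet _ _
  have hqk : q * k = 0 := by
    have := mul_projMeet_left hq.one_sub hp
    rwa [sub_mul, one_mul, sub_eq_self] at this
  have hpk : p * k = k := mul_projMeet_right hq.one_sub hp
  have hkp : k * p = k := star_eq_of_mul hks hp hpk
  refine ⟨hks.sub_of_mul_eq_left hp hkp, ?_, ?_⟩
  · rw [mul_sub, mul_assoc, hp.isIdempotentElem, mul_assoc, hpk, hqk, sub_zero]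
  · intro x hx
    have h1 : (1 - q) (p x) = p x := by
      rw [sub_apply, one_apply_eq_self, sub_eq_self]
      exact hx
    have h2 : p (p x) = p x := DFunLike.congr_fun hp.isIdempotentElem x
    have h3 : k (p x) = p x := projMeet_apply_eq_self h1 h2
    rw [sub_apply, sub_eq_zero, ← h3]
    exact DFunLike.congr_fun hkp x

/-- If `p` and `q` are projections in `N` with `p - q ∈ J`, then `p - (1 - q) ∩ p` and
`q - (1 - p) ∩ q` are equivalent by a partial isometry that equals `p` modulo `J`. -/
theorem exists_partialIsometry (hJ : IsIdealIn N J) {p q : H →L[ℂ] H} (hp : IsStarProjection p)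
    (hq : IsStarProjection q) (hpN : p ∈ N) (hqN : q ∈ N) (hpq : p - q ∈ J) :
    ∃ x ∈ N, star x * x = p - projMeet (1 - q) p ∧ x * star x = q - projMeet (1 - p) q ∧
      x - p ∈ J := by
  set a := q * p with ha
  have haN : a ∈ N := mul_mem hqN hpN
  have has : star a = p * q := by
    rw [ha, star_mul, hp.isSelfAdjoint.star_eq, hq.isSelfAdjoint.star_eq]
  -- The partial isometry sought is the polar part of `q p`: by `ker_mul_of_projMeet` its initial
  -- and final projections are the supports of `q p` and of `p q`.
  obtain ⟨V, hV, hVs, hk⟩ := exists_polar a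
  have hVN : V ∈ N := polar_mem_vonNeumann haN hV hk
  obtain ⟨e1, e2, e3⟩ := ker_mul_of_projMeet hp hq
  obtain ⟨f1, f2, f3⟩ := ker_mul_of_projMeet hq hp
  set e := p - projMeet (1 - q) p with he
  set f := q - projMeet (1 - p) q with hf
  have hVV : star V * V = e := star_mul_self_polar hVs hV hk e1 e2 e3
  have hVe : V * e = V := by
    ext x
    have : V (x - e x) = 0 := hk _ (by
      rw [map_sub, sub_eq_zero]
      exact (DFunLike.congr_fun e2 x).symm)
    rw [map_sub, sub_eq_zero] at this
    exact this.symm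
  have hep : e * p = e := by
    rw [he, sub_mul, hp.isIdempotentElem, star_eq_of_mul (isStarProjection_projMeet _ _) hp
      (mul_projMeet_right hq.one_sub hp)]
  have hB : star (CFC.abs a) = CFC.abs a := (IsSelfAdjoint.of_nonneg (CFC.abs_nonneg a)).star_eq
  have hfV : star V * f = star V := by
    ext x
    rw [← sub_eq_zero, op_mul_apply, ← map_sub]
    have h1 : (p * q) (f x - x) = 0 := by
      rw [map_sub, sub_eq_zero]
      exact DFunLike.congr_fun f2 x
    have h2 : CFC.abs a (star V (f x - x)) = 0 := by
      rw [← has] at h1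
      have := congrArg star hV
      rw [star_mul, hB] at this
      rw [← this] at h1
      exact h1
    have h3 := e3 _ ((abs_apply_eq_zero_iff a _).1 h2)
    have h4 : e * star V = star V := by
      have := congrArg star hVe
      rwa [star_mul, e1.isSelfAdjoint.star_eq] at this
    rw [← h4]
    exact h3
  have hVf : f * V = V := by
    have := congrArg star hfV
    rwa [star_mul, f1.isSelfAdjoint.star_eq, star_star] at this
  refine ⟨V, hVN, hVV, ?_, ?_⟩
  · have h1 : star a * (V * star V - 1) = 0 := by
      have h0 : star a = CFC.abs a * star V := by
        have := congrArg star hV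
        rw [star_mul, hB] at this
        exact this.symm
      rw [h0, mul_sub, mul_one, mul_assoc, ← mul_assoc (star V), hVV]
      have h4 : e * star V = star V := by
        have := congrArg star hVe
        rwa [star_mul, e1.isSelfAdjoint.star_eq] at this
      rw [h4, sub_self]
    have h2 : f * (V * star V - 1) = 0 := by
      ext x
      refine f3 _ ?_
      rw [has] at h1
      exact DFunLike.congr_fun h1 x
    rwa [mul_sub, ← mul_assoc, hVf, mul_one, sub_eq_zero] at h2
  · have hpB : p * CFC.abs a = CFC.abs a := by
      rw [← hVs, ← mul_assoc]
      congr 1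
      have := congrArg star (show V * p = V by rw [← hVe, mul_assoc, hep])
      rwa [star_mul, hp.isSelfAdjoint.star_eq] at this
    have hpos : 0 ≤ CFC.abs a := CFC.abs_nonneg a
    have hu : IsUnit (CFC.abs a + 1) :=
      CStarAlgebra.isUnit_of_le (1 : H →L[ℂ] H) (le_add_of_nonneg_left hpos)
        ⟨zero_le_one, isUnit_one⟩
    obtain ⟨g, hg⟩ := hu
    have hgN : g⁻¹.val ∈ N := mem_of_inverse (T := g.val)
      (by rw [hg]; exact add_mem (abs_mem_vonNeumann haN) (one_mem N)) g.mul_inv g.inv_mul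
    -- Because `p |a| = |a|`, one has `(|a| - p)(|a| + 1) = |a|² - p`. This trades the square root
    -- for `a* a - p = p q p - p`, which is visibly in `J`.
    have h1 : CFC.abs a - p = (star a * a - p) * g⁻¹.val := by
      have : (CFC.abs a - p) * g.val = star a * a - p := by
        rw [hg, ← CFC.abs_mul_abs, sub_mul, mul_add, mul_add, hpB, mul_one, mul_one]
        abel
      rw [← this, mul_assoc, Units.mul_inv, mul_one]
    have h2 : star a * a - p = -(p * (p - q) * p) := by
      rw [has, ha, mul_sub, sub_mul, hp.isIdempotentElem, hp.isIdempotentElem, mul_assoc p q,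
        ← mul_assoc q q, hq.isIdempotentElem]
      simp only [mul_assoc, neg_sub]
    have h3 : CFC.abs a - p ∈ J := by
      rw [h1, h2]
      exact hJ.mul_mem_right hgN (neg_mem (hJ.mul_mem_right hpN (hJ.mul_mem_left hpN hpq)))
    have h4 : V - p = -(V * (CFC.abs a - p)) - (p - q) * p := by
      rw [mul_sub, hV, show V * p = V by rw [← hVe, mul_assoc, hep], sub_mul, hp.isIdempotentElem,
        ha]
      abel
    rw [h4]
    exact sub_mem (neg_mem (hJ.mul_mem_left hVN h3)) (hJ.mul_mem_right hpN hpq)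

end VonNeumann

end SpectralFlow

end

noncomputable section

namespace SpectralFlow

/-! ### The spectral projection `χ(T)`. -/

section NonnegProj

set_option linter.unusedSectionVars false

variable {H : Type*} [NormedAddCommGroup H] [InnerProductSpace ℂ H] [CompleteSpace H]
  {N : VonNeumannAlgebra H} {J : NonUnitalStarSubalgebra ℂ (H →L[ℂ] H)}

open ContinuousLinearMap

theorem nonnegProj_closure (T : H →L[ℂ] H) :
    (LinearMap.ker (T⁻).toLinearMap).topologicalClosure = LinearMap.ker (T⁻).toLinearMap :=
  IsClosed.submodule_topologicalClosure_eq (isClosed_ker (T⁻))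

theorem isStarProjection_nonnegProj (T : H →L[ℂ] H) : IsStarProjection (nonnegProj T) :=
  isStarProjection_starProjection

theorem nonnegProj_apply_eq_self_iff (T : H →L[ℂ] H) (x : H) :
    nonnegProj T x = x ↔ T⁻ x = 0 := by
  unfold nonnegProj
  rw [Submodule.starProjection_eq_self_iff, nonnegProj_closure]
  rfl

theorem negPart_mul_nonnegProj (T : H →L[ℂ] H) : T⁻ * nonnegProj T = 0 := by
  ext x
  exact (nonnegProj_apply_eq_self_iff T _).1
    (DFunLike.congr_fun (isStarProjection_nonnegProj T).isIdempotentElem x)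

theorem nonnegProj_mul {T : H →L[ℂ] H} (hT : IsSelfAdjoint T) : nonnegProj T * T = T⁺ := by
  have h1 : nonnegProj T * T⁻ = 0 := by
    have := congrArg star (negPart_mul_nonnegProj T)
    rwa [star_mul, (isStarProjection_nonnegProj T).isSelfAdjoint.star_eq,
      (IsSelfAdjoint.of_nonneg (CFC.negPart_nonneg T)).star_eq, star_zero] at this
  have h2 : nonnegProj T * T⁺ = T⁺ := by
    ext x
    exact (nonnegProj_apply_eq_self_iff T _).2
      (DFunLike.congr_fun (CFC.negPart_mul_posPart T) x)
  calc nonnegProj T * T = nonnegProj T * (T⁺ - T⁻) := by rw [CFC.posPart_sub_negPart T hT]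
    _ = T⁺ := by rw [mul_sub, h1, h2, sub_zero]

theorem nonnegProj_mem_vonNeumann {T : H →L[ℂ] H} (hT : IsSelfAdjoint T) (hTN : T ∈ N) :
    nonnegProj T ∈ N := by
  -- Since `2 T⁻ = |T| - T`, membership in `N` follows from that of `|T|`; the factor does not
  -- change the kernel.
  have hneg : (2 : ℕ) • T⁻ ∈ N := by
    rw [← CFC.abs_sub_self T hT]
    exact sub_mem (abs_mem_vonNeumann hTN) hTN
  rw [mem_iff_commute] at hneg
  refine starProjection_mem_vonNeumann fun S hS x hx => ?_
  rw [nonnegProj_closure] at hx ⊢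
  have hx' : T⁻ x = 0 := hx
  change T⁻ (S x) = 0
  have h := DFunLike.congr_fun (hneg S hS) x
  rw [op_mul_apply, op_mul_apply, smul_apply, smul_apply, hx', smul_zero, map_zero] at h
  rw [← Nat.cast_smul_eq_nsmul ℂ] at h
  exact (smul_eq_zero.1 h.symm).resolve_left (by norm_num)

/-- If `F` is a symmetry modulo `J`, then `χ(F) = (F + 1) / 2` modulo `J`. -/
theorem nonnegProj_sub_mem (hJ : IsIdealIn N J) {F : H →L[ℂ] H} (hF : IsSelfAdjoint F)
    (hFN : F ∈ N) (hFJ : 1 - F * F ∈ J) : nonnegProj F - (1 / 2 : ℂ) • (F + 1) ∈ J := by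
  set p := nonnegProj F with hp
  have hps : IsStarProjection p := isStarProjection_nonnegProj F
  have hpN : p ∈ N := nonnegProj_mem_vonNeumann hF hFN
  -- `S` is the sign of `F`, with value `1` on the kernel: `S² = 1` and `S F = |F|`. Hence `p - (F +
  -- 1)/2 = S (1 - |F|)/2`, where `1 - |F| = (1 - F²)(1 + |F|)⁻¹` lies in `J`.
  set S := 2 * p - 1 with hS
  have hSN : S ∈ N := sub_mem (mul_mem (ofNat_mem N 2) hpN) (one_mem N)
  have hSS : S * S = 1 := by
    have := hps.isIdempotentElem
    unfold IsIdempotentElem at this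
    rw [hS]
    calc (2 * p - 1) * (2 * p - 1) = 4 * (p * p) - 4 * p + 1 := by noncomm_ring
      _ = 1 := by rw [this]; abel
  have hSF : S * F = CFC.abs F := by
    rw [hS, sub_mul, mul_assoc, nonnegProj_mul hF, one_mul, sub_eq_iff_eq_add,
      CFC.abs_add_self F hF, two_mul, two_nsmul]
  have hSG : S * CFC.abs F = F := by rw [← hSF, ← mul_assoc, hSS, one_mul]
  have hGG : CFC.abs F * CFC.abs F = F * F := by rw [CFC.abs_mul_abs, hF.star_eq]
  have hu : IsUnit (CFC.abs F + 1) :=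
    CStarAlgebra.isUnit_of_le (1 : H →L[ℂ] H) (le_add_of_nonneg_left (CFC.abs_nonneg F))
      ⟨zero_le_one, isUnit_one⟩
  obtain ⟨g, hg⟩ := hu
  have hgN : g⁻¹.val ∈ N := mem_of_inverse (T := g.val)
    (by rw [hg]; exact add_mem (abs_mem_vonNeumann hFN) (one_mem N)) g.mul_inv g.inv_mul
  have h1 : 1 - CFC.abs F = (1 - F * F) * g⁻¹.val := by
    have : (1 - CFC.abs F) * g.val = 1 - F * F := by
      rw [hg, ← hGG]
      noncomm_ring
    rw [← this, mul_assoc, Units.mul_inv, mul_one]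
  have h2 : p - (1 / 2 : ℂ) • (F + 1) = (1 / 2 : ℂ) • (S * (1 - CFC.abs F)) := by
    rw [mul_sub, hSG, mul_one, hS, two_mul]
    module
  rw [h2, h1]
  exact SMulMemClass.smul_mem _ (hJ.mul_mem_left hSN (hJ.mul_mem_right hgN hFJ))

/-- The conjugates of `T⁺` and `T⁻` are positive, have product zero and differ by the conjugate of
`T`. By uniqueness of the Jordan decomposition they are its positive and negative parts. -/
theorem nonnegProj_conj {T u : H →L[ℂ] H} (hT : IsSelfAdjoint T) (hu : u ∈ unitary (H →L[ℂ] H)) :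
    nonnegProj (star u * T * u) = star u * nonnegProj T * u := by
  obtain ⟨hu1, hu2⟩ := Unitary.mem_iff.1 hu
  have hneg : (star u * T * u)⁻ = star u * T⁻ * u := by
    refine (CFC.posPart_negPart_unique (b := star u * T⁺ * u) (c := star u * T⁻ * u) ?_ ?_
      (star_left_conjugate_nonneg (CFC.posPart_nonneg T) u)
      (star_left_conjugate_nonneg (CFC.negPart_nonneg T) u)).2
    · rw [← sub_mul, ← mul_sub, CFC.posPart_sub_negPart T hT]
    · calc star u * T⁺ * u * (star u * T⁻ * u) = star u * T⁺ * (u * star u) * T⁻ * u := by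
            simp only [mul_assoc]
        _ = star u * (T⁺ * T⁻) * u := by rw [hu2, mul_one]; simp only [mul_assoc]
        _ = 0 := by rw [CFC.posPart_mul_negPart, mul_zero, zero_mul]
  have hps := isStarProjection_nonnegProj T
  have hs : IsStarProjection (star u * nonnegProj T * u) := by
    constructor
    · unfold IsIdempotentElem
      calc star u * nonnegProj T * u * (star u * nonnegProj T * u) =
            star u * nonnegProj T * (u * star u) * nonnegProj T * u := by simp only [mul_assoc]
        _ = star u * (nonnegProj T * nonnegProj T) * u := by
          rw [hu2, mul_one]; simp only [mul_assoc]
        _ = _ := by rw [hps.isIdempotentElem]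
    · unfold IsSelfAdjoint
      rw [star_mul, star_mul, star_star, hps.isSelfAdjoint.star_eq, mul_assoc]
  refine ContinuousLinearMap.IsStarProjection.ext (isStarProjection_nonnegProj _) hs ?_
  have inj : ∀ y, star u y = 0 → y = 0 := fun y hy => by
    have := DFunLike.congr_fun hu2 y
    rw [op_mul_apply, hy, map_zero] at this
    exact this.symm
  ext x
  rw [mem_range_iff_of_idem (isStarProjection_nonnegProj _).isIdempotentElem,
    mem_range_iff_of_idem hs.isIdempotentElem, nonnegProj_apply_eq_self_iff, hneg]
  change star u (T⁻ (u x)) = 0 ↔ star u (nonnegProj T (u x)) = x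
  constructor
  · intro h
    rw [(nonnegProj_apply_eq_self_iff T _).2 (inj _ h)]
    exact DFunLike.congr_fun hu1 x
  · intro h
    have h2 : nonnegProj T (u x) = u x := by
      conv_rhs => rw [← h]
      exact (DFunLike.congr_fun hu2 _).symm
    rw [(nonnegProj_apply_eq_self_iff T _).1 h2, map_zero]

end NonnegProj

/-! ### The Sylvester equation `a⁻¹ Z + Z b⁻¹ = K`. -/

section Sylvester

variable {H : Type*} [NormedAddCommGroup H] [InnerProductSpace ℂ H] [CompleteSpace H]
  {J : NonUnitalStarSubalgebra ℂ (H →L[ℂ] H)}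

theorem cfc_mul_cfc_of_nonneg {b : H →L[ℂ] H} (hb : 0 ≤ b) {f g k : ℝ → ℝ}
    (hf : Continuous f) (hg : Continuous g) (h : ∀ x, 0 ≤ x → f x * g x = k x) :
    cfc f b * cfc g b = cfc k b := by
  rw [← cfc_mul f g b hf.continuousOn hg.continuousOn]
  exact cfc_congr fun x hx => h x (spectrum_nonneg_of_nonneg hb hx)

theorem norm_cfc_le_of_nonneg {b : H →L[ℂ] H} (hb : 0 ≤ b) {f : ℝ → ℝ} {c : ℝ} (hc : 0 ≤ c)
    (h : ∀ x, 0 ≤ x → |f x| ≤ c) : ‖cfc f b‖ ≤ c :=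
  norm_cfc_le hc fun x hx => h x (spectrum_nonneg_of_nonneg hb hx)

/-- A bound for solutions of the Sylvester equation `a⁻¹ Z + Z b⁻¹ = K` with `a ≥ 0` and
`0 ≤ b ≤ r`, where `b` is only assumed to have dense range. -/
theorem norm_le_of_sylvester {a b Z K : H →L[ℂ] H} {r : ℝ} (hr : 0 < r) (ha : 0 ≤ a) (hb : 0 ≤ b)
    (hbd : DenseRange b) (h : a * Z + Z * cfc (fun x : ℝ => min x r) b =
      a * K * cfc (fun x : ℝ => min x r) b) : ‖Z‖ ≤ r * ‖K‖ := by
  have hbs : IsSelfAdjoint b := IsSelfAdjoint.of_nonneg hb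
  have has : IsSelfAdjoint a := IsSelfAdjoint.of_nonneg ha
  -- With `b' = min(b, r)`, formally `Z = ∫₀^∞ exp(-s a⁻¹) K exp(-s b'⁻¹) ds`, of norm at most `r
  -- ‖K‖` because `b'⁻¹ ≥ 1/r`. Since `a` and `b` may fail to be invertible, the bound is proved for
  -- `Z g`, where `g` cuts off the spectrum of `b` near `0`, and it is uniform in `η`.
  have key : ∀ η, 0 < η → η ≤ r → ∃ g : H →L[ℂ] H, ‖g * b - b‖ ≤ 2 * η ∧ ‖g‖ ≤ 1 ∧
      ‖Z * g‖ ≤ r * ‖K‖ := by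
    intro η hη hηr
    -- `f` takes values in `[1/r, 1/η]` and inverts `min x r` wherever `γ ≠ 0`. On `x ≥ 0`, the
    -- function `γ` vanishes up to `η` and equals `1` from `2η` on, which gives the bound `2η` for
    -- `g b - b`.
    set f : ℝ → ℝ := fun x => 1 / max (min x r) η with hf
    set γ : ℝ → ℝ := fun x => min 1 (max 0 ((x - η) / η)) with hγ
    have hm : ∀ x : ℝ, 0 < max (min x r) η := fun x => lt_max_of_lt_right hη
    have hfc : Continuous f := continuous_const.div (by fun_prop) fun x => (hm x).ne'
    have hγc : Continuous γ := by fun_prop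
    have hγ0 : ∀ x, 0 ≤ γ x := fun x => le_min zero_le_one (le_max_left _ _)
    have hγ1 : ∀ x, γ x ≤ 1 := fun x => min_le_left _ _
    set g := cfc γ b with hg
    have hg1 : ‖g‖ ≤ 1 := norm_cfc_le_of_nonneg hb zero_le_one fun x _ => by
      rw [abs_of_nonneg (hγ0 x)]; exact hγ1 x
    have hgb : ‖g * b - b‖ ≤ 2 * η := by
      have : g * b - b = cfc (fun x => γ x * x - x) b := by
        rw [cfc_sub _ _ b (by fun_prop) (by fun_prop), cfc_mul _ _ b (by fun_prop) (by fun_prop),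
          cfc_id' ℝ b]
      rw [this]
      refine norm_cfc_le_of_nonneg hb (by positivity) fun x hx => ?_
      rcases le_total x (2 * η) with hx2 | hx2
      · rw [abs_le]
        constructor <;> nlinarith [hγ0 x, hγ1 x]
      · have : γ x = 1 := by
          refine min_eq_left (le_max_of_le_right ?_)
          rw [le_div_iff₀ hη]
          linarith
        rw [this, one_mul, sub_self, abs_zero]
        positivity
    refine ⟨g, hgb, hg1, ?_⟩
    set b' := cfc (fun x : ℝ => min x r) b with hb'
    set k := cfc f b with hk
    have hkg : b' * (k * g) = g := by
      rw [cfc_mul_cfc_of_nonneg hb hfc hγc (k := fun x => f x * γ x) (fun x _ => rfl), hb']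
      refine cfc_mul_cfc_of_nonneg hb (by fun_prop) (by fun_prop) ?_
      intro x hx
      rcases le_total x η with h1 | h1
      · have : γ x = 0 := by
          refine le_antisymm ((min_le_right _ _).trans ?_) (hγ0 x)
          exact max_le le_rfl (div_nonpos_of_nonpos_of_nonneg (by linarith) hη.le)
        rw [this, mul_zero, mul_zero]
      · have h2 : max (min x r) η = min x r := max_eq_left (le_min h1 hηr)
        have h3 : min x r ≠ 0 := (lt_min (hη.trans_le h1) hr).ne'
        change min x r * (1 / max (min x r) η * γ x) = γ x
        rw [h2, ← mul_assoc, mul_one_div_cancel h3, one_mul]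
    have hkgc : k * g = g * k := (cfc_commute_cfc _ _ _)
    set c : ℝ := 1 / η with hc
    have hc0 : 0 < c := by positivity
    have e1 : a * (Z * g) * k + Z * g = a * (K * g) := by
      have := congrArg (· * (k * g)) h
      simp only [add_mul] at this
      rw [mul_assoc Z, hkg, mul_assoc (a * K), hkg, hkgc] at this
      simpa only [mul_assoc] using this
    -- Formally `(a⁻¹ + c) Z g = K g + Z g (c - k)`, where `c = 1/η` is an upper bound for `k`. Here
    -- `(a⁻¹ + c)⁻¹ = a (1 + c a)⁻¹` has norm at most `η`, and `‖c - k‖ ≤ c - 1/r`. As `η c = 1`,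
    -- the resulting inequality for `‖Z g‖` leaves `‖Z g‖ η/r ≤ η ‖K‖`.
    have e2 : (1 + c • a) * (Z * g) = a * (K * g + Z * g * (algebraMap ℝ _ c - k)) := by
      rw [mul_add, ← e1, add_mul, one_mul, mul_sub, mul_sub, ← mul_assoc, ← mul_assoc,
        ← mul_assoc, ← mul_assoc, Algebra.algebraMap_eq_smul_one, mul_smul_comm, mul_one,
        smul_mul_assoc]
      simp only [mul_assoc]
      abel
    have hac : Continuous fun x : ℝ => 1 + c * x := by fun_prop
    set m : ℝ → ℝ := fun x => 1 / max 1 (1 + c * x) with hmd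
    have hmc : Continuous m :=
      continuous_const.div (by fun_prop) fun x => (lt_max_of_lt_left one_pos).ne'
    have hm1 : cfc m a * (1 + c • a) = 1 := by
      have : (1 + c • a) = cfc (fun x : ℝ => 1 + c * x) a := by
        rw [cfc_const_add _ _ _ (by fun_prop), cfc_const_mul _ _ _ (by fun_prop), cfc_id' ℝ a,
          map_one]
      rw [this, cfc_mul_cfc_of_nonneg ha (k := fun _ => 1)
        hmc hac,
        cfc_const_one ℝ a]
      intro x hx
      have hx1 : 1 ≤ 1 + c * x := by nlinarith
      simp only [hmd]
      rw [max_eq_right hx1]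
      exact one_div_mul_cancel (by linarith)
    have hma : ‖cfc m a * a‖ ≤ η := by
      have : cfc m a * a =
          cfc (fun x : ℝ => m x * x) a := by
        rw [cfc_mul _ _ a hmc.continuousOn (by fun_prop), cfc_id' ℝ a]
      rw [this]
      refine norm_cfc_le_of_nonneg ha hη.le fun x hx => ?_
      have hx1 : 1 ≤ 1 + c * x := by nlinarith
      simp only [hmd]
      rw [max_eq_right hx1, one_div_mul_eq_div, abs_of_nonneg (by positivity),
        div_le_iff₀ (by linarith), hc]
      field_simp
      linarith
    have hck : ‖algebraMap ℝ (H →L[ℂ] H) c - k‖ ≤ c - 1 / r := by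
      have : algebraMap ℝ (H →L[ℂ] H) c - k = cfc (fun x => c - f x) b := by
        rw [cfc_sub _ _ b (by fun_prop) hfc.continuousOn, cfc_const c b]
      have hcr : 1 / r ≤ c := one_div_le_one_div_of_le hη hηr
      rw [this]
      refine norm_cfc_le_of_nonneg hb (by linarith) fun x hx => ?_
      have h1 : f x ≤ c := one_div_le_one_div_of_le hη (le_max_right _ _)
      have h2 : 1 / r ≤ f x :=
        one_div_le_one_div_of_le (hm x) (max_le (min_le_right _ _) hηr)
      rw [abs_of_nonneg (by linarith)]
      linarith
    have e3 : ‖Z * g‖ ≤ η * (‖K‖ + ‖Z * g‖ * (c - 1 / r)) := by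
      have : Z * g = cfc m a * a *
          (K * g + Z * g * (algebraMap ℝ _ c - k)) := by
        rw [mul_assoc, ← e2, ← mul_assoc, hm1, one_mul]
      calc ‖Z * g‖ = _ := congrArg _ this
        _ ≤ _ := norm_mul_le _ _
        _ ≤ η * (‖K * g‖ + ‖Z * g * (algebraMap ℝ _ c - k)‖) :=
          mul_le_mul hma (norm_add_le _ _) (norm_nonneg _) hη.le
        _ ≤ _ := by
          refine mul_le_mul_of_nonneg_left (add_le_add ?_ ?_) hη.le
          · exact (norm_mul_le _ _).trans (mul_le_of_le_one_right (norm_nonneg _) hg1)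
          · exact (norm_mul_le _ _).trans (mul_le_mul_of_nonneg_left hck (norm_nonneg _))
    have hηc : η * c = 1 := mul_one_div_cancel hη.ne'
    have e4 : ‖Z * g‖ * (η / r) ≤ η * ‖K‖ := by
      have : η * (‖K‖ + ‖Z * g‖ * (c - 1 / r)) = η * ‖K‖ + ‖Z * g‖ * (η * c) - ‖Z * g‖ * (η / r) := by
        ring
      rw [this, hηc] at e3
      linarith
    rw [mul_div_assoc', div_le_iff₀ hr] at e4
    nlinarith [norm_nonneg (Z * g)]
  -- It suffices to bound `Z` on the dense range of `b`, where `Z (b x) - Z g (b x)` tends to `0`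
  -- with `η`.
  refine ContinuousLinearMap.opNorm_le_bound _ (by positivity) fun y => ?_
  refine hbd.induction_on (p := fun y => ‖Z y‖ ≤ r * ‖K‖ * ‖y‖) y
    (isClosed_le (by fun_prop) (by fun_prop)) fun x => ?_
  refine le_of_forall_pos_le_add fun ε hε => ?_
  obtain ⟨η, hη, hηr, hηε⟩ : ∃ η, 0 < η ∧ η ≤ r ∧ ‖Z‖ * (2 * η * ‖x‖) ≤ ε := by
    refine ⟨min r (ε / (2 * (‖Z‖ + 1) * (‖x‖ + 1))), by positivity, min_le_left _ _, ?_⟩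
    have h0 : min r (ε / (2 * (‖Z‖ + 1) * (‖x‖ + 1))) ≤ ε / (2 * (‖Z‖ + 1) * (‖x‖ + 1)) :=
      min_le_right _ _
    have h1 : 0 ≤ min r (ε / (2 * (‖Z‖ + 1) * (‖x‖ + 1))) := by positivity
    calc ‖Z‖ * (2 * min r (ε / (2 * (‖Z‖ + 1) * (‖x‖ + 1))) * ‖x‖)
        ≤ (‖Z‖ + 1) * (2 * (ε / (2 * (‖Z‖ + 1) * (‖x‖ + 1))) * (‖x‖ + 1)) := by
          gcongr <;> linarith
      _ = ε := by field_simp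
  obtain ⟨g, h1, h2, h3⟩ := key η hη hηr
  have e : Z (b x) = (Z * g) (b x) - Z ((g * b - b) x) := by
    change Z (b x) = Z (g (b x)) - Z (g (b x) - b x)
    rw [map_sub, sub_sub_cancel]
  rw [e]
  refine (norm_sub_le _ _).trans (add_le_add ?_ ?_)
  · exact (ContinuousLinearMap.le_opNorm _ _).trans
      (mul_le_mul_of_nonneg_right h3 (norm_nonneg _))
  · refine ((ContinuousLinearMap.le_opNorm _ _).trans ?_).trans hηε
    refine mul_le_mul_of_nonneg_left ?_ (norm_nonneg _)
    exact (ContinuousLinearMap.le_opNorm _ _).trans (mul_le_mul_of_nonneg_right h1 (norm_nonneg _))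

/-- A solution of the Sylvester equation `a⁻¹ Z + Z b⁻¹ = K` with `a ≥ 0` and `b ≥ 0` in `J` lies
in `J`. -/
theorem mem_of_sylvester {N : VonNeumannAlgebra H} (hJ : IsIdealIn N J)
    (hJc : IsClosed (J : Set (H →L[ℂ] H))) {a b Z K : H →L[ℂ] H} (ha : 0 ≤ a) (hb : 0 ≤ b)
    (hbd : DenseRange b) (hbJ : b ∈ J) (hZ : Z ∈ N)
    (h : a * Z + Z * b = a * K * b) : Z ∈ J := by
  have hbs : IsSelfAdjoint b := IsSelfAdjoint.of_nonneg hb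
  have : Z ∈ closure (J : Set (H →L[ℂ] H)) := by
    rw [Metric.mem_closure_iff]
    intro ε hε
    obtain ⟨r, hr, hrε⟩ : ∃ r, 0 < r ∧ r * ‖K‖ < ε := by
      refine ⟨ε / (‖K‖ + 1), by positivity, ?_⟩
      rw [div_mul_eq_mul_div, div_lt_iff₀ (by positivity)]
      nlinarith [norm_nonneg K]
    -- `ψ(0) = 0` puts `ψ(b)` in the closed ideal, by the non-unital functional calculus; `ψ = 1` on
    -- `[r, ∞)` confines the remainder `φ = 1 - ψ(b)` to the part of the spectrum below `r`.
    set ψ : ℝ → ℝ := fun x => min (max x 0 / r) 1 with hψ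
    have hψc : Continuous ψ := by fun_prop
    have hψ0 : ψ 0 = 0 := by simp [hψ]
    have hψJ : cfc ψ b ∈ J := by
      rw [← cfcₙ_eq_cfc (f := ψ) (a := b) hψc.continuousOn hψ0]
      have := hJc
      exact cfcₙ_mem (𝕜 := ℝ) ψ hbJ
    set φ := 1 - cfc ψ b with hφ
    have hφe : φ = cfc (fun x => 1 - ψ x) b := by
      rw [cfc_sub _ _ b (by fun_prop) (by fun_prop), cfc_const_one ℝ b]
    refine ⟨Z * cfc ψ b, hJ.mul_mem_left hZ hψJ, ?_⟩
    have hdist : Z - Z * cfc ψ b = Z * φ := by rw [hφ, mul_sub, mul_one]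
    rw [dist_eq_norm, hdist]
    have hφ1 : ‖φ‖ ≤ 1 := by
      rw [hφe]
      refine norm_cfc_le_of_nonneg hb zero_le_one fun x hx => ?_
      have h1 : ψ x ≤ 1 := min_le_right _ _
      have h2 : 0 ≤ ψ x := le_min (div_nonneg (le_max_right _ _) hr.le) zero_le_one
      rw [abs_of_nonneg (by linarith)]
      linarith
    -- Next to `φ` the operator `b` may be truncated at `r`. So `Z φ` solves the truncated equation
    -- with right-hand side `K φ`, and its norm is at most `r ‖K‖ < ε`.
    have hbφ : b * φ = φ * cfc (fun x : ℝ => min x r) b := by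
      rw [hφe]
      nth_rewrite 1 [← cfc_id' ℝ b]
      rw [cfc_mul_cfc_of_nonneg hb (k := fun x => x * (1 - ψ x)) (by fun_prop) (by fun_prop)
        fun _ _ => rfl, cfc_mul_cfc_of_nonneg hb (by fun_prop) (by fun_prop)]
      intro x hx
      rcases le_total x r with h1 | h1
      · rw [min_eq_left h1, mul_comm]
      · have : ψ x = 1 := by
          refine min_eq_right ?_
          rw [le_div_iff₀ hr, max_eq_left hx]
          linarith
        rw [this, sub_self, zero_mul, mul_zero]
    have hS := norm_le_of_sylvester (Z := Z * φ) (K := K * φ) hr ha hb hbd (by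
      have := congrArg (· * φ) h
      simp only [add_mul] at this
      rw [mul_assoc Z, mul_assoc (a * K), hbφ] at this
      simpa only [mul_assoc] using this)
    refine hS.trans_lt (lt_of_le_of_lt ?_ hrε)
    exact mul_le_mul_of_nonneg_left
      ((norm_mul_le _ _).trans (mul_le_of_le_one_right (norm_nonneg _) hφ1)) hr.le
  rwa [hJc.closure_eq] at this

/-- The difference of two symmetries that are solutions of a commutation relation solves a Sylvester
equation: this is the operator form of
`(x (1 + x²)^{-1/2} - y (1 + y²)^{-1/2}) ((1 + x²)^{1/2} + (1 + y²)^{1/2}) = …`. -/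
theorem sylvester_identity {A : Type*} [Ring A] {a b F G C : A} (hF : F * F = 1 - a * a)
    (hG : G * G = 1 - b * b) (hFa : F * a = a * F) (hGb : G * b = b * G)
    (h : F * b - a * G = a * C * b) :
    a * (F - G) + (F - G) * b = a * (C + a * C * b - F * C * G) * b := by
  -- `C` can be made to occur only in the combination `a C b`, which `h` replaces by `F b - a G`.
  -- What remains is an identity in `F`, `G`, `a`, `b`.
  have h1 : a * (F * C * G) * b = F * (a * C * b) * G := by
    calc a * (F * C * G) * b = a * F * C * (G * b) := by simp only [mul_assoc]
      _ = _ := by rw [← hFa, hGb]; simp only [mul_assoc]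
  have h2 : a * (a * C * b) * b = a * (F * b - a * G) * b := by rw [h]
  have h3 : F * (F * b - a * G) * G = (1 - a * a) * b * G - F * a * (1 - b * b) := by
    rw [← hF, ← hG]
    noncomm_ring
  have h4 : a * (a * G) * b = a * a * b * G := by
    rw [mul_assoc a, mul_assoc a G, hGb]; simp only [mul_assoc]
  have h5 : a * (F * b) * b = F * a * (b * b) := by
    rw [← mul_assoc a, ← hFa]; simp only [mul_assoc]
  rw [mul_sub a F, sub_mul F, mul_sub a, sub_mul _ _ b, mul_add, add_mul _ _ b, h1, h2, ← h, h3,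
    mul_sub a, sub_mul _ _ b, h4, h5, sub_mul 1, sub_mul _ _ G, mul_sub (F * a), hFa, one_mul,
    mul_one, hGb]
  abel

end Sylvester

end SpectralFlow

end

noncomputable section

namespace SpectralFlow

/-! ### The bounded transform in terms of resolvents. -/

section BoundedTransform

set_option linter.unusedSectionVars false

variable {H : Type*} [NormedAddCommGroup H] [InnerProductSpace ℂ H] [CompleteSpace H]
  {N : VonNeumannAlgebra H} {J : NonUnitalStarSubalgebra ℂ (H →L[ℂ] H)}

open ContinuousLinearMap Complex

local notation "⟪" x ", " y "⟫" => inner ℂ x y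

/-- The operator `T` is symmetric, and `R = (i - T)⁻¹`, `S = (-i - T)⁻¹`. -/
structure IsCayleyPair (T : H →ₗ.[ℂ] H) (R S : H →L[ℂ] H) : Prop where
  symm : T.IsFormalAdjoint T
  res : IsResolventAt T I R
  res_neg : IsResolventAt T (-I) S

theorem pmap_congr {T : H →ₗ.[ℂ] H} {x y : H} (h : x = y) (hx : x ∈ T.domain)
    (hy : y ∈ T.domain) : T ⟨x, hx⟩ = T ⟨y, hy⟩ := by
  subst h
  rfl

theorem pmap_eq_of_resolvent {T : H →ₗ.[ℂ] H} {c : ℂ} {R : H →L[ℂ] H} (hR : IsResolventAt T c R)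
    (y : H) (h : R y ∈ T.domain) : T ⟨R y, h⟩ = c • R y - y := by
  obtain ⟨_, e⟩ := hR.1 y
  rw [eq_sub_iff_add_eq, add_comm, ← eq_sub_iff_add_eq]
  exact e.symm

variable {T : H →ₗ.[ℂ] H} {R S : H →L[ℂ] H}

theorem IsCayleyPair.star_eq (h : IsCayleyPair T R S) : star R = S := by
  rw [star_eq_adjoint, eq_comm, eq_adjoint_iff]
  intro x y
  obtain ⟨hx, ex⟩ := h.res_neg.1 x
  obtain ⟨hy, ey⟩ := h.res.1 y
  have hs := h.symm ⟨S x, hx⟩ ⟨R y, hy⟩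
  conv_rhs => rw [← ex]
  conv_lhs => rw [← ey]
  rw [inner_sub_left, inner_sub_right, hs, inner_smul_left, inner_smul_right]
  simp

theorem IsCayleyPair.star_eq' (h : IsCayleyPair T R S) : star S = R := by
  rw [← h.star_eq, star_star]

/-- Apply `R` to `(i - T)(R y - S y) = -2i S y`. Comparison with the mirror image `sub_eq'` shows
that `R` and `S` commute. -/
theorem IsCayleyPair.sub_eq (h : IsCayleyPair T R S) : R - S = -(2 * I) • (R * S) := by
  ext y
  obtain ⟨hR, eR⟩ := h.res.1 y
  obtain ⟨hS, eS⟩ := h.res_neg.1 y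
  have e := h.res.2 (⟨R y, hR⟩ - ⟨S y, hS⟩)
  rw [LinearPMap.map_sub, pmap_eq_of_resolvent h.res, pmap_eq_of_resolvent h.res_neg] at e
  change R (I • (R y - S y) - (I • R y - y - (-I • S y - y))) = R y - S y at e
  have e2 : I • (R y - S y) - (I • R y - y - (-I • S y - y)) = (-(2 * I)) • S y := by module
  rw [e2, map_smul] at e
  exact e.symm

theorem IsCayleyPair.sub_eq' (h : IsCayleyPair T R S) : R - S = -(2 * I) • (S * R) := by
  ext y
  obtain ⟨hR, eR⟩ := h.res.1 y
  obtain ⟨hS, eS⟩ := h.res_neg.1 y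
  have e := h.res_neg.2 (⟨R y, hR⟩ - ⟨S y, hS⟩)
  rw [LinearPMap.map_sub, pmap_eq_of_resolvent h.res, pmap_eq_of_resolvent h.res_neg] at e
  change S (-I • (R y - S y) - (I • R y - y - (-I • S y - y))) = R y - S y at e
  have e2 : -I • (R y - S y) - (I • R y - y - (-I • S y - y)) = (-(2 * I)) • R y := by module
  rw [e2, map_smul] at e
  exact e.symm

theorem IsCayleyPair.comm (h : IsCayleyPair T R S) : R * S = S * R :=
  smul_right_injective _ (by simp : -(2 * I) ≠ 0) (h.sub_eq.symm.trans h.sub_eq')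

theorem IsCayleyPair.isInvOneAddSq (h : IsCayleyPair T R S) : IsInvOneAddSq T (R * S) := by
  intro y
  obtain ⟨h1, e1⟩ := h.res.1 (S y)
  obtain ⟨h2, e2⟩ := h.res_neg.1 y
  have e3 : T ⟨(R * S) y, h1⟩ = I • R (S y) - S y := pmap_eq_of_resolvent h.res _ _
  have h3 : I • R (S y) - S y ∈ T.domain := sub_mem (T.domain.smul_mem _ h1) h2
  refine ⟨h1, by rw [e3]; exact h3, ?_⟩
  rw [pmap_congr e3 _ h3]
  have e4 : T ⟨I • R (S y) - S y, h3⟩ = I • T ⟨R (S y), h1⟩ - T ⟨S y, h2⟩ := by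
    rw [← LinearPMap.map_smul, ← LinearPMap.map_sub]
    rfl
  rw [e4, pmap_eq_of_resolvent h.res, pmap_eq_of_resolvent h.res_neg, op_mul_apply, smul_sub,
    smul_smul, I_mul_I]
  module

/-- On the domain of `T²`, `1 + T² = (i - T)(-i - T)`, and both factors are injective. Any inverse,
in particular the one chosen in the definition, is therefore `S R`. -/
theorem IsCayleyPair.invOneAddSq_eq (h : IsCayleyPair T R S) : invOneAddSq T = S * R := by
  have hex : ∃ G, IsInvOneAddSq T G := ⟨_, h.isInvOneAddSq⟩
  unfold invOneAddSq
  rw [dif_pos hex]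
  ext y
  obtain ⟨h1, h2, e⟩ := hex.choose_spec y
  set x := hex.choose y
  have hz : -I • x - T ⟨x, h1⟩ ∈ T.domain := sub_mem (T.domain.smul_mem _ h1) h2
  have e1 : T ⟨-I • x - T ⟨x, h1⟩, hz⟩ = -I • T ⟨x, h1⟩ - T ⟨T ⟨x, h1⟩, h2⟩ := by
    rw [← LinearPMap.map_smul, ← LinearPMap.map_sub]
    rfl
  have e2 := h.res.2 ⟨-I • x - T ⟨x, h1⟩, hz⟩
  rw [e1] at e2
  have e3 : I • (-I • x - T ⟨x, h1⟩) - (-I • T ⟨x, h1⟩ - T ⟨T ⟨x, h1⟩, h2⟩) = y := by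
    rw [smul_sub, smul_smul, mul_neg, I_mul_I, neg_neg, one_smul]
    conv_rhs => rw [← e]
    module
  change R (I • (-I • x - T ⟨x, h1⟩) - (-I • T ⟨x, h1⟩ - T ⟨T ⟨x, h1⟩, h2⟩)) = -I • x - T ⟨x, h1⟩
    at e2
  rw [e3] at e2
  rw [op_mul_apply, e2]
  exact (h.res_neg.2 ⟨x, h1⟩).symm

theorem IsCayleyPair.sqrt_eq (h : IsCayleyPair T R S) :
    CFC.sqrt (invOneAddSq T) = CFC.abs S := by
  rw [h.invOneAddSq_eq, ← h.comm, CFC.abs, h.star_eq']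

theorem IsCayleyPair.abs_mul_abs (h : IsCayleyPair T R S) : CFC.abs S * CFC.abs S = R * S := by
  rw [CFC.abs_mul_abs, h.star_eq']

theorem isSelfAdjoint_abs (S : H →L[ℂ] H) : IsSelfAdjoint (CFC.abs S) :=
  IsSelfAdjoint.of_nonneg (CFC.abs_nonneg S)

/-- Taking adjoints in `V* S = |S|` gives `|S| = R V`. So `|S|` maps into the domain of `T`, and `T
|S| = T R V = (i R - 1) V` is bounded. -/
theorem IsCayleyPair.exists_boundedTransform (h : IsCayleyPair T R S) {V : H →L[ℂ] H}
    (hV : star V * S = CFC.abs S) (x : H) :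
    ∃ hx : CFC.abs S x ∈ T.domain, ((I • R - 1) * V) x = T ⟨CFC.abs S x, hx⟩ := by
  have hV' : R * V = CFC.abs S := by
    have := congrArg star hV
    rwa [star_mul, star_star, h.star_eq', (isSelfAdjoint_abs S).star_eq] at this
  have e : CFC.abs S x = R (V x) := by rw [← hV']; rfl
  obtain ⟨h1, -⟩ := h.res.1 (V x)
  refine ⟨by rw [e]; exact h1, ?_⟩
  rw [pmap_congr e _ h1, pmap_eq_of_resolvent h.res]
  rfl

theorem IsCayleyPair.boundedTransform_apply (h : IsCayleyPair T R S) (x : H) :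
    ∃ hx : CFC.abs S x ∈ T.domain, boundedTransform T x = T ⟨CFC.abs S x, hx⟩ := by
  obtain ⟨V, -, hV, -⟩ := exists_polar S
  have hex : ∃ F : H →L[ℂ] H, ∀ x, ∃ hx : CFC.sqrt (invOneAddSq T) x ∈ T.domain,
      F x = T ⟨CFC.sqrt (invOneAddSq T) x, hx⟩ := by
    rw [h.sqrt_eq]
    exact ⟨_, h.exists_boundedTransform hV⟩
  unfold boundedTransform
  rw [dif_pos hex]
  have := hex.choose_spec x
  obtain ⟨hx, e⟩ := this
  have e1 : CFC.sqrt (invOneAddSq T) x = CFC.abs S x := by rw [h.sqrt_eq]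
  exact ⟨by rw [← e1]; exact hx, e.trans (pmap_congr e1 _ _)⟩

theorem IsCayleyPair.boundedTransform_eq (h : IsCayleyPair T R S) {V : H →L[ℂ] H}
    (hV : star V * S = CFC.abs S) : boundedTransform T = (I • R - 1) * V := by
  ext x
  obtain ⟨h1, e1⟩ := h.boundedTransform_apply x
  obtain ⟨h2, e2⟩ := h.exists_boundedTransform hV x
  rw [e1, e2]

/-- The orthogonal complement of the range is the kernel of `|S|`, that is, of the injective
operator `S`. Density allows `Q = (1 + T²)^{-1/2}` to be cancelled from the right. -/
theorem IsCayleyPair.denseRange_abs (h : IsCayleyPair T R S) : DenseRange ⇑(CFC.abs S) := by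
  have hbot : (LinearMap.range (CFC.abs S).toLinearMap)ᗮ = ⊥ := by
    rw [Submodule.eq_bot_iff]
    intro y hy
    have h1 : CFC.abs S y = 0 := by
      rw [← inner_self_eq_zero (𝕜 := ℂ)]
      conv_lhs => rw [← (isSelfAdjoint_abs S).star_eq, star_eq_adjoint, adjoint_inner_right]
      rw [← star_eq_adjoint, (isSelfAdjoint_abs S).star_eq]
      exact (Submodule.mem_orthogonal _ _).1 hy _ ⟨_, rfl⟩
    rw [abs_apply_eq_zero_iff] at h1
    obtain ⟨h2, e⟩ := h.res_neg.1 y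
    have e2 : T ⟨S y, h2⟩ = 0 := by
      rw [pmap_congr h1 h2 (zero_mem _)]
      exact T.map_zero
    rw [e2, h1, smul_zero, sub_zero] at e
    exact e.symm
  have := Submodule.topologicalClosure_eq_top_iff.2 hbot
  rw [← Submodule.dense_iff_topologicalClosure_eq_top] at this
  exact this

theorem eq_of_mul_right_of_denseRange {A B Q : H →L[ℂ] H} (hQ : DenseRange Q)
    (h : A * Q = B * Q) : A = B :=
  ContinuousLinearMap.coeFn_injective (hQ.equalizer A.continuous B.continuous
    (funext fun x => DFunLike.congr_fun h x))

/-- The algebraic relations between the bounded transform `F` of `T` and `Q = (1 + T²)^{-1/2}`. -/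
theorem IsCayleyPair.relations (h : IsCayleyPair T R S) :
    IsSelfAdjoint (boundedTransform T) ∧
      boundedTransform T * CFC.abs S = CFC.abs S * boundedTransform T ∧
      boundedTransform T * boundedTransform T = 1 - CFC.abs S * CFC.abs S := by
  obtain ⟨V, hV1, hV, -⟩ := exists_polar S
  have hF := h.boundedTransform_eq hV
  have hFa := h.boundedTransform_apply
  set F := boundedTransform T
  set Q := CFC.abs S with hQ
  have hQs : IsSelfAdjoint Q := isSelfAdjoint_abs S
  have hQd : DenseRange Q := h.denseRange_abs
  -- This is `T (1 + T²)⁻¹`, a polynomial in the resolvents. It commutes with `S`, and it is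
  -- self-adjoint by the resolvent identity.
  have hFQ : F * Q = I • (R * S) - S := by
    rw [hF, mul_assoc, hV1, sub_mul, one_mul, smul_mul_assoc]
  have hRS : R = S - (2 * I) • (R * S) :=
    (eq_add_of_sub_eq h.sub_eq).trans (by module)
  have hXs : star (F * Q) = F * Q := by
    rw [hFQ, star_sub, star_smul, star_mul, h.star_eq, h.star_eq']
    rw [show star I = -I from conj_I]
    generalize R * S = X at hRS ⊢
    rw [hRS]
    module
  -- This is the symmetry of `T` on the range of `Q`: `⟪T Q x, Q y⟫ = ⟪Q x, T Q y⟫`.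
  have hsym : Q * F = star F * Q := by
    rw [star_eq_adjoint, ← ContinuousLinearMap.coe_inj]
    refine LinearMap.ext fun x => ext_inner_right ℂ fun y => ?_
    change ⟪Q (F x), y⟫ = ⟪(adjoint F) (Q x), y⟫
    rw [adjoint_inner_left]
    conv_lhs => rw [← hQs.star_eq, star_eq_adjoint, adjoint_inner_left]
    obtain ⟨hx, ex⟩ := hFa x
    obtain ⟨hy, ey⟩ := hFa y
    rw [ex, ey]
    exact h.symm ⟨Q x, hx⟩ ⟨Q y, hy⟩
  have hcS : Commute S (F * Q) := by
    rw [hFQ]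
    refine Commute.sub_right (Commute.smul_right ?_ _) (Commute.refl S)
    exact Commute.mul_right h.comm.symm (Commute.refl S)
  have hQX : Commute (F * Q) Q := Commute.cfcAbs_right hcS (by rw [hXs]; exact hcS)
  -- `F Q` commutes with `Q = |S|`; cancelling one factor `Q` gives the claim, and then `F* Q = Q F
  -- = F Q` gives `F* = F`.
  have hcomm : F * Q = Q * F := by
    refine eq_of_mul_right_of_denseRange hQd ?_
    rw [hQX.eq, mul_assoc]
  have hFs : star F = F := by
    refine eq_of_mul_right_of_denseRange hQd ?_
    rw [← hsym, hcomm]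
  refine ⟨hFs, hcomm, ?_⟩
  -- After multiplication by `Q²` both sides are polynomials in `R` and `S`, to be compared by the
  -- resolvent identity.
  have hX2 : F * F * Q * Q = (1 - Q * Q) * Q * Q := by
    have e1 : F * F * Q * Q = F * Q * (F * Q) := by
      rw [mul_assoc F F Q, hcomm, ← mul_assoc]
      conv_rhs => rw [← mul_assoc]
      rw [mul_assoc (F * Q), hcomm]
      simp only [← mul_assoc]
    have e2 : Q * Q = R * S := h.abs_mul_abs
    rw [e1, hFQ, mul_assoc _ Q Q, e2]
    have e3 : (1 - R * S) * (R * S) = R * S - R * S * (R * S) := by rw [sub_mul, one_mul]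
    have e4 : R * S = S * S - (2 * I) • (R * S * S) := by
      conv_lhs => rw [hRS]
      rw [sub_mul, smul_mul_assoc]
    have e5 : S * (R * S) = R * S * S := by rw [← mul_assoc, h.comm]
    rw [e3, sub_mul, mul_sub, mul_sub, smul_mul_smul_comm, I_mul_I, mul_smul_comm, smul_mul_assoc,
      e5]
    have e6 : S * S = R * S + (2 * I) • (R * S * S) := by
      rw [← sub_eq_iff_eq_add]
      exact e4.symm
    rw [e6]
    module
  exact eq_of_mul_right_of_denseRange hQd (eq_of_mul_right_of_denseRange hQd hX2)

/-- The polar part `V` of `S = R* ∈ J` lies in `N`, and `|S| = V* S`, `F = (i R - 1) V`. -/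
theorem IsCayleyPair.mem_ideal (h : IsCayleyPair T R S) (hJ : IsIdealIn N J) (hR : R ∈ J) :
    CFC.abs S ∈ J ∧ boundedTransform T ∈ N := by
  obtain ⟨V, hV1, hV, hk⟩ := exists_polar S
  have hS : S ∈ J := by
    rw [← h.star_eq]
    exact star_mem hR
  have hVN : V ∈ N := polar_mem_vonNeumann (hJ.le _ hS) hV1 hk
  refine ⟨by rw [← hV]; exact hJ.mul_mem_left (star_mem hVN) hS, ?_⟩
  rw [h.boundedTransform_eq hV]
  exact mul_mem (sub_mem (smul_mem_vonNeumann _ (hJ.le _ hR)) (one_mem N)) hVN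

theorem IsCayleyPair.sub_sq_mem (h : IsCayleyPair T R S) (hJ : IsIdealIn N J) (hR : R ∈ J) :
    1 - boundedTransform T * boundedTransform T ∈ J := by
  have hQ := (h.mem_ideal hJ hR).1
  rw [h.relations.2.2, sub_sub_cancel]
  exact mul_mem hQ hQ

/-- The bounded transforms of two operators in `N` whose difference is bounded agree modulo `J`. -/
theorem boundedTransform_sub_mem (hJ : IsIdealIn N J) (hJc : IsClosed (J : Set (H →L[ℂ] H)))
    {T₁ : H →ₗ.[ℂ] H} {R₁ S₁ C : H →L[ℂ] H} (h : IsCayleyPair T R S) (h₁ : IsCayleyPair T₁ R₁ S₁)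
    (hR : R ∈ J) (hR₁ : R₁ ∈ J) (hdom : ∀ x ∈ T.domain, x ∈ T₁.domain)
    (hC : ∀ x (hx : x ∈ T.domain) (hx' : x ∈ T₁.domain), T₁ ⟨x, hx'⟩ = T ⟨x, hx⟩ + C x) :
    boundedTransform T₁ - boundedTransform T ∈ J := by
  obtain ⟨hF, hc, hs⟩ := h.relations
  obtain ⟨hF₁, hc₁, hs₁⟩ := h₁.relations
  -- Formally `F₁ = Q₁ T₁` and `F = T Q`, so the left side is `Q₁ (T₁ - T) Q`. The inner products
  -- give this a meaning, with the symmetry of `T₁` used on `Q x` and `Q₁ y`.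
  have hstar : boundedTransform T₁ * CFC.abs S - CFC.abs S₁ * boundedTransform T =
      CFC.abs S₁ * C * CFC.abs S := by
    rw [← ContinuousLinearMap.coe_inj]
    refine LinearMap.ext fun x => ext_inner_right ℂ fun y => ?_
    change ⟪boundedTransform T₁ (CFC.abs S x) - CFC.abs S₁ (boundedTransform T x), y⟫ =
      ⟪CFC.abs S₁ (C (CFC.abs S x)), y⟫
    have hsa : ∀ {A : H →L[ℂ] H}, IsSelfAdjoint A → ∀ x y, ⟪A x, y⟫ = ⟪x, A y⟫ := by
      intro A hA x y
      conv_lhs => rw [← hA.star_eq, star_eq_adjoint, adjoint_inner_left]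
    obtain ⟨hx, ex⟩ := h.boundedTransform_apply x
    obtain ⟨hy, ey⟩ := h₁.boundedTransform_apply y
    rw [inner_sub_left, hsa hF₁, hsa (isSelfAdjoint_abs S₁), hsa (isSelfAdjoint_abs S₁), ey, ex,
      ← h₁.symm ⟨CFC.abs S x, hdom _ hx⟩ ⟨CFC.abs S₁ y, hy⟩, hC _ hx, inner_add_left]
    abel
  exact mem_of_sylvester hJ hJc (CFC.abs_nonneg S₁) (CFC.abs_nonneg S) h.denseRange_abs
    (h.mem_ideal hJ hR).1 (sub_mem (h₁.mem_ideal hJ hR₁).2 (h.mem_ideal hJ hR).2)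
    (sylvester_identity hs₁ hs hc₁ hc hstar)

end BoundedTransform

end SpectralFlow

end

noncomputable section

namespace SpectralFlow

/-! ### Resolvents of bounded perturbations. -/

section Path

set_option linter.unusedSectionVars false

variable {H : Type*} [NormedAddCommGroup H] [InnerProductSpace ℂ H] [CompleteSpace H]
  {N : VonNeumannAlgebra H} {J : NonUnitalStarSubalgebra ℂ (H →L[ℂ] H)}

open ContinuousLinearMap Complex

local notation "⟪" x ", " y "⟫" => inner ℂ x y

variable {T T' : H →ₗ.[ℂ] H}

theorem isFormalAdjoint_of_isSelfAdjoint (hT : IsSelfAdjoint T) : T.IsFormalAdjoint T := by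
  have h := LinearPMap.adjoint_isFormalAdjoint hT.dense_domain
  rwa [LinearPMap.isSelfAdjoint_def.1 hT] at h

/-- Since `⟪R y, T R y⟫` is real, `Im ⟪R y, y⟫ = m (Im c) ‖R y‖²`; compare with the Cauchy–Schwarz
inequality. -/
theorem norm_resolvent_le (hT : T.IsFormalAdjoint T) {c : ℂ} (hc : |c.im| = 1) {m : ℝ} (hm : 0 < m)
    {R : H →L[ℂ] H} (hR : IsResolventAt T (m * c) R) : ‖R‖ ≤ 1 / m := by
  refine opNorm_le_bound _ (by positivity) fun y => ?_
  obtain ⟨h, e⟩ := hR.1 y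
  have hreal : (⟪R y, T ⟨R y, h⟩⟫).im = 0 := by
    have h1 := hT ⟨R y, h⟩ ⟨R y, h⟩
    have h2 := inner_conj_symm (𝕜 := ℂ) (R y) (T ⟨R y, h⟩)
    rw [h1] at h2
    exact Complex.conj_eq_iff_im.1 h2
  have h1 : (⟪R y, y⟫).im = m * c.im * ‖R y‖ ^ 2 := by
    have e' : ⟪R y, y⟫ = ⟪R y, (m * c : ℂ) • R y - T ⟨R y, h⟩⟫ := congrArg _ e.symm
    rw [e', inner_sub_right, inner_smul_right, sub_im, hreal, sub_zero,
      inner_self_eq_norm_sq_to_K]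
    have : ((‖R y‖ : ℂ) ^ 2) = ((‖R y‖ ^ 2 : ℝ) : ℂ) := by push_cast; rfl
    change ((m : ℂ) * c * (‖R y‖ : ℂ) ^ 2).im = _
    rw [this, im_mul_ofReal, im_ofReal_mul]
  have h2 : |(⟪R y, y⟫).im| ≤ ‖R y‖ * ‖y‖ :=
    (Complex.abs_im_le_norm _).trans (norm_inner_le_norm _ _)
  rw [h1, abs_mul, abs_mul, hc, mul_one, abs_of_pos hm, abs_of_nonneg (sq_nonneg _)] at h2
  rcases (norm_nonneg (R y)).eq_or_lt' with h3 | h3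
  · rw [h3]
    positivity
  · rw [one_div, inv_mul_eq_div, le_div_iff₀ hm]
    nlinarith

/-- Neumann series for the resolvent of a bounded perturbation. -/
theorem exists_resolvent_of_perturbation (hJ : IsIdealIn N J) {E R : H →L[ℂ] H} {c c' : ℂ}
    (hdom : T'.domain = T.domain)
    (hE : ∀ x (hx : x ∈ T.domain) (hx' : x ∈ T'.domain), T' ⟨x, hx'⟩ = T ⟨x, hx⟩ + E x)
    (hEN : E ∈ N) (hR : IsResolventAt T c R) (hRJ : R ∈ J)
    (hlt : ‖(E + (c - c') • 1) * R‖ < 1) : ∃ R', IsResolventAt T' c' R' ∧ R' ∈ J := by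
  -- With this `K` one has `c' - T' = (1 - K)(c - T)`. So the new resolvent is `R (1 - K)⁻¹`, which
  -- stays in `J`.
  set K := (E + (c - c') • 1) * R with hK
  have hKN : K ∈ N :=
    mul_mem (add_mem hEN (smul_mem_vonNeumann _ (one_mem N))) (hJ.le _ hRJ)
  let g : (H →L[ℂ] H)ˣ := Units.oneSub K hlt
  have hg : g.val = 1 - K := rfl
  have hgN : g⁻¹.val ∈ N := mem_of_inverse (T := g.val)
    (by rw [hg]; exact sub_mem (one_mem N) hKN) g.mul_inv g.inv_mul
  have hKx : ∀ z, K z = E (R z) + (c - c') • R z := fun z => rfl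
  refine ⟨R * g⁻¹.val, ⟨fun y => ?_, fun x => ?_⟩, hJ.mul_mem_right hgN hRJ⟩
  · set z := g⁻¹.val y with hz
    obtain ⟨h1, e1⟩ := hR.1 z
    have h1' : R z ∈ T'.domain := by rw [hdom]; exact h1
    refine ⟨h1', ?_⟩
    have e2 : z - K z = y := DFunLike.congr_fun g.mul_inv y
    change c' • R z - T' ⟨R z, h1'⟩ = y
    rw [hE _ h1, ← e2, hKx]
    have e3 : ∀ w, c' • R z - (w + E (R z)) = c • R z - w - (E (R z) + (c - c') • R z) := by
      intro w
      module
    rw [e3, e1]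
  · have hx : (x : H) ∈ T.domain := by rw [← hdom]; exact x.2
    set w := c • (x : H) - T ⟨x, hx⟩ with hw
    have e1 : R w = x := hR.2 ⟨x, hx⟩
    have e2 : c' • (x : H) - T' x = g.val w := by
      rw [hg]
      change _ = w - K w
      rw [hKx, e1, hE x hx x.2]
      module
    rw [e2]
    change R (g⁻¹.val (g.val w)) = x
    rw [show g⁻¹.val (g.val w) = w from DFunLike.congr_fun g.inv_mul w, e1]

/-- The Neumann series is used twice. At the distant point `m c`, `m = ‖E‖ + 1`, the resolvent of
`T` has norm at most `1/m`, so `E` can be added. Then the resolvent of `T'` is moved from `m c` back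
to `c`, a shift by `‖E‖ < m`, with the same bound `1/m` because `T'` is symmetric. -/
theorem exists_resolvent_unit (hJ : IsIdealIn N J) {E : H →L[ℂ] H} {c : ℂ} (hc : |c.im| = 1)
    (hc1 : ‖c‖ = 1) (hsT : T.IsFormalAdjoint T) (hsT' : T'.IsFormalAdjoint T')
    (hdom : T'.domain = T.domain)
    (hE : ∀ x (hx : x ∈ T.domain) (hx' : x ∈ T'.domain), T' ⟨x, hx'⟩ = T ⟨x, hx⟩ + E x)
    (hEN : E ∈ N) (hres : ∀ c : ℂ, c.im ≠ 0 → ∃ R, IsResolventAt T c R ∧ R ∈ J) :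
    ∃ R, IsResolventAt T' c R ∧ R ∈ J := by
  set m : ℝ := ‖E‖ + 1 with hm
  have hm0 : 0 < m := by positivity
  have hci : c.im ≠ 0 := fun h => by rw [h, abs_zero] at hc; exact zero_ne_one hc
  obtain ⟨R, hR, hRJ⟩ := hres (m * c) (by rw [im_ofReal_mul]; exact mul_ne_zero hm0.ne' hci)
  obtain ⟨R', hR', hRJ'⟩ := exists_resolvent_of_perturbation (c' := m * c) hJ hdom hE hEN hR hRJ (by
    rw [sub_self, zero_smul, add_zero]
    refine (norm_mul_le _ _).trans_lt ?_
    refine (mul_le_mul_of_nonneg_left (norm_resolvent_le hsT hc hm0 hR) (norm_nonneg _)).trans_lt ?_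
    rw [mul_one_div, div_lt_one hm0]
    linarith)
  refine exists_resolvent_of_perturbation (E := 0) (T := T') hJ rfl (fun x hx hx' => ?_)
    (zero_mem N) hR' hRJ' ?_
  · rw [zero_apply, add_zero]
  · rw [zero_add]
    refine (norm_mul_le _ _).trans_lt ?_
    refine (mul_le_mul_of_nonneg_left (norm_resolvent_le hsT' hc hm0 hR') (norm_nonneg _)).trans_lt ?_
    have h1 : ‖((m : ℂ) * c - c) • (1 : H →L[ℂ] H)‖ ≤ ‖E‖ := by
      have h2 : (m : ℂ) * c - c = (‖E‖ : ℂ) * c := by rw [hm]; push_cast; ring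
      rw [h2, norm_smul, norm_mul, hc1, mul_one, norm_real, norm_norm]
      exact mul_le_of_le_one_right (norm_nonneg _) norm_id_le
    rw [mul_one_div, div_lt_one hm0]
    linarith

end Path

/-! ### The path `D_t` of a spectral triple. -/

section Triple

set_option linter.unusedSectionVars false

variable {H : Type*} [NormedAddCommGroup H] [InnerProductSpace ℂ H] [CompleteSpace H]
  {N : VonNeumannAlgebra H} {J : NonUnitalStarSubalgebra ℂ (H →L[ℂ] H)}

open ContinuousLinearMap Complex

local notation "⟪" x ", " y "⟫" => inner ℂ x y

/-- The properties of a spectral triple, for a single unitary `u` and `A = [D, u]`. -/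
structure IsUnitaryTriple (N : VonNeumannAlgebra H) (J : NonUnitalStarSubalgebra ℂ (H →L[ℂ] H))
    (D : H →ₗ.[ℂ] H) (u A : H →L[ℂ] H) : Prop where
  ideal : IsIdealIn N J
  mem : u ∈ N
  unitary : u ∈ unitary (H →L[ℂ] H)
  symm : D.IsFormalAdjoint D
  dense : Dense (D.domain : Set H)
  affiliated : IsAffiliated N D
  domain : ∀ x ∈ D.domain, u x ∈ D.domain
  domain_star : ∀ x ∈ D.domain, star u x ∈ D.domain
  commutator : ∀ x (hx : x ∈ D.domain) (hux : u x ∈ D.domain),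
    D ⟨u x, hux⟩ = u (D ⟨x, hx⟩) + A x
  resolvent : ∀ c : ℂ, c.im ≠ 0 → ∃ R, IsResolventAt D c R ∧ R ∈ J

theorem IsVonNeumannSpectralTriple.isUnitaryTriple {𝒜 : Type*} [Ring 𝒜] [StarRing 𝒜] [Algebra ℂ 𝒜]
    {ρ : 𝒜 →⋆ₐ[ℂ] (H →L[ℂ] H)} {D : H →ₗ.[ℂ] H} (h : IsVonNeumannSpectralTriple N J ρ D)
    {u : 𝒜} (hu : u ∈ _root_.unitary 𝒜) : ∃ A, IsUnitaryTriple N J D (ρ u) A := by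
  obtain ⟨A, hA⟩ := h.commutator u
  obtain ⟨A', hA'⟩ := h.commutator (star u)
  refine ⟨A, h.ideal, h.rep_mem u, Unitary.map_mem ρ hu,
    isFormalAdjoint_of_isSelfAdjoint h.selfAdjoint, h.selfAdjoint.dense_domain, h.affiliated,
    fun x hx => (hA ⟨x, hx⟩).1, fun x hx => ?_, fun x hx hux => ?_, fun c hc => ?_⟩
  · rw [← map_star]
    exact (hA' ⟨x, hx⟩).1
  · obtain ⟨_, e⟩ := hA ⟨x, hx⟩
    exact eq_add_of_sub_eq' e
  -- The triple is unital: taking `a = 1` puts the resolvent itself in `J`.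
  · obtain ⟨R, hR, hRJ⟩ := h.resolvent 1 c hc
    rw [map_one, one_mul] at hRJ
    exact ⟨R, hR, hRJ⟩

variable {D : H →ₗ.[ℂ] H} {u A : H →L[ℂ] H}

theorem IsUnitaryTriple.star_apply (h : IsUnitaryTriple N J D u A) (x : H) :
    star u (u x) = x := DFunLike.congr_fun (Unitary.mem_iff.1 h.unitary).1 x

theorem IsUnitaryTriple.apply_star (h : IsUnitaryTriple N J D u A) (x : H) :
    u (star u x) = x := DFunLike.congr_fun (Unitary.mem_iff.1 h.unitary).2 x

/-- On the dense domain of `D` the operator is `D u - u D`, and every element of the commutant of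
`N` commutes there with both `D` and `u`. -/
theorem IsUnitaryTriple.commutator_mem (h : IsUnitaryTriple N J D u A) : A ∈ N := by
  have hu := h.mem
  rw [mem_iff_commute] at hu ⊢
  intro S hS
  refine ContinuousLinearMap.coeFn_injective
    (Continuous.ext_on h.dense (S * A).continuous (A * S).continuous fun x hx => ?_)
  have hux := h.domain x hx
  obtain ⟨h1, e1⟩ := h.affiliated S hS ⟨x, hx⟩
  obtain ⟨h2, e2⟩ := h.affiliated S hS ⟨u x, hux⟩
  have hSu : ∀ y, S (u y) = u (S y) := fun y => DFunLike.congr_fun (hu S hS) y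
  have h3 := h.domain _ h1
  have e3 := h.commutator _ h1 h3
  have e4 := h.commutator x hx hux
  have e5 : D ⟨u (S x), h3⟩ = D ⟨S (u x), h2⟩ := pmap_congr (hSu x).symm _ _
  change S (A x) = A (S x)
  have e6 : S (A x) = S (D ⟨u x, hux⟩) - S (u (D ⟨x, hx⟩)) := by
    rw [e4, map_add, add_sub_cancel_left]
  have e7 : A (S x) = D ⟨u (S x), h3⟩ - u (D ⟨S x, h1⟩) := by
    rw [e3, add_sub_cancel_left]
  rw [e6, e7, e5, e2, hSu]
  congr 2
  exact e1.symm

theorem IsUnitaryTriple.path_domain (h : IsUnitaryTriple N J D u A) (t : ℝ) :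
    (pathUnbounded D u t).domain = D.domain := by
  change D.domain ⊓ D.domain.comap u.toLinearMap = D.domain
  exact inf_eq_left.2 fun x hx => h.domain x hx

theorem pathUnbounded_apply (t : ℝ) (x : H) (hx : x ∈ D.domain) (hux : u x ∈ D.domain)
    (hx' : x ∈ (pathUnbounded D u t).domain) : pathUnbounded D u t ⟨x, hx'⟩ =
      ((1 - t : ℝ) : ℂ) • D ⟨x, hx⟩ + (t : ℂ) • star u (D ⟨u x, hux⟩) := rfl

/-- On the domain of `D`, `u* D u = D + u* [D, u]`; the whole path consists of bounded perturbations
of `D`. -/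
theorem IsUnitaryTriple.path_apply (h : IsUnitaryTriple N J D u A) (t : ℝ) (x : H)
    (hx : x ∈ D.domain) (hx' : x ∈ (pathUnbounded D u t).domain) :
    pathUnbounded D u t ⟨x, hx'⟩ = D ⟨x, hx⟩ + ((t : ℂ) • (star u * A)) x := by
  have hux := h.domain x hx
  rw [pathUnbounded_apply t x hx hux, h.commutator x hx hux, map_add, h.star_apply]
  change _ = D ⟨x, hx⟩ + (t : ℂ) • star u (A x)
  push_cast
  module

theorem IsUnitaryTriple.path_symm (h : IsUnitaryTriple N J D u A) (t : ℝ) :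
    (pathUnbounded D u t).IsFormalAdjoint (pathUnbounded D u t) := by
  rintro ⟨x, hx'⟩ ⟨y, hy'⟩
  have hx : x ∈ D.domain := by rw [← h.path_domain t]; exact hx'
  have hy : y ∈ D.domain := by rw [← h.path_domain t]; exact hy'
  have hux := h.domain x hx
  have huy := h.domain y hy
  rw [pathUnbounded_apply t x hx hux, pathUnbounded_apply t y hy huy, inner_add_left,
    inner_add_right, inner_smul_left, inner_smul_left, inner_smul_right, inner_smul_right,
    conj_ofReal, conj_ofReal]
  have e1 : ⟪D ⟨x, hx⟩, y⟫ = ⟪x, D ⟨y, hy⟩⟫ := h.symm ⟨x, hx⟩ ⟨y, hy⟩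
  have e2 : ⟪D ⟨u x, hux⟩, u y⟫ = ⟪u x, D ⟨u y, huy⟩⟫ := h.symm ⟨u x, hux⟩ ⟨u y, huy⟩
  rw [star_eq_adjoint, adjoint_inner_left, adjoint_inner_right]
  change _ * ⟪D ⟨x, hx⟩, y⟫ + _ * ⟪D ⟨u x, hux⟩, u y⟫ = _
  rw [e1, e2]

theorem IsUnitaryTriple.path_cayley (h : IsUnitaryTriple N J D u A) (t : ℝ) :
    ∃ R S, IsCayleyPair (pathUnbounded D u t) R S ∧ R ∈ J := by
  have hE : (t : ℂ) • (star u * A) ∈ N :=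
    smul_mem_vonNeumann _ (mul_mem (star_mem h.mem) h.commutator_mem)
  have key : ∀ c : ℂ, |c.im| = 1 → ‖c‖ = 1 →
      ∃ R, IsResolventAt (pathUnbounded D u t) c R ∧ R ∈ J := fun c hc hc1 =>
    exists_resolvent_unit h.ideal hc hc1 h.symm (h.path_symm t) (h.path_domain t)
      (fun x hx hx' => h.path_apply t x hx hx') hE h.resolvent
  obtain ⟨R, hR, hRJ⟩ := key I (by simp) (by simp)
  obtain ⟨S, hS, -⟩ := key (-I) (by simp) (by simp)
  exact ⟨R, S, ⟨h.path_symm t, hR, hS⟩, hRJ⟩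

theorem IsUnitaryTriple.path_zero (h : IsUnitaryTriple N J D u A) : pathUnbounded D u 0 = D := by
  refine LinearPMap.ext (h.path_domain 0) fun x hx hx' => ?_
  rw [h.path_apply 0 x hx' hx, ofReal_zero, zero_smul, zero_apply, add_zero]

/-- At `t = 1` the term `0 • D` still imposes `x ∈ Dom(D)`. Invariance of the domain under `u*`
makes this follow from `u x ∈ Dom(D)`. -/
theorem IsUnitaryTriple.path_one_apply (h : IsUnitaryTriple N J D u A) (x : H)
    (hux : u x ∈ D.domain) : ∃ hx' : x ∈ (pathUnbounded D u 1).domain,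
      pathUnbounded D u 1 ⟨x, hx'⟩ = star u (D ⟨u x, hux⟩) := by
  have hx : x ∈ D.domain := by
    have := h.domain_star _ hux
    rwa [h.star_apply] at this
  refine ⟨by rw [h.path_domain]; exact hx, ?_⟩
  rw [pathUnbounded_apply 1 x hx hux]
  simp

/-- The resolvents of `u* D u` are the conjugates of those of `D`, and `|·|` is compatible with
conjugation by a unitary. Hence so is `T |S|`. -/
theorem IsUnitaryTriple.boundedTransform_one (h : IsUnitaryTriple N J D u A) :
    boundedTransform (pathUnbounded D u 1) = star u * boundedTransform D * u := by
  obtain ⟨R, S, hC, -⟩ := h.path_cayley 0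
  rw [h.path_zero] at hC
  obtain ⟨hu1, hu2⟩ := Unitary.mem_iff.1 h.unitary
  have hres : ∀ {c : ℂ} {R : H →L[ℂ] H}, IsResolventAt D c R →
      IsResolventAt (pathUnbounded D u 1) c (star u * R * u) := by
    intro c R hR
    constructor
    · intro y
      obtain ⟨h1, e1⟩ := hR.1 (u y)
      have e2 : u (star u (R (u y))) = R (u y) := h.apply_star _
      have h2 : u (star u (R (u y))) ∈ D.domain := by rw [e2]; exact h1
      obtain ⟨h3, e3⟩ := h.path_one_apply (star u (R (u y))) h2
      refine ⟨h3, ?_⟩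
      change c • star u (R (u y)) - pathUnbounded D u 1 ⟨star u (R (u y)), h3⟩ = y
      rw [e3, ← map_smul, ← map_sub, pmap_congr e2 h2 h1, e1, h.star_apply]
    · rintro ⟨x, hx'⟩
      have hx : x ∈ D.domain := by rw [← h.path_domain 1]; exact hx'
      have hux := h.domain x hx
      obtain ⟨_, e3⟩ := h.path_one_apply x hux
      have e4 := hR.2 ⟨u x, hux⟩
      change star u (R (u (c • x - pathUnbounded D u 1 ⟨x, hx'⟩))) = x
      rw [e3, map_sub, h.apply_star, map_smul]
      change R (c • u x - D ⟨u x, hux⟩) = u x at e4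
      rw [e4, h.star_apply]
  have hC1 : IsCayleyPair (pathUnbounded D u 1) (star u * R * u) (star u * S * u) :=
    ⟨h.path_symm 1, hres hC.res, hres hC.res_neg⟩
  have habs : CFC.abs (star u * S * u) = star u * CFC.abs S * u := by
    unfold CFC.abs
    refine CFC.sqrt_unique ?_ (star_left_conjugate_nonneg (CFC.sqrt_nonneg _) u)
    calc star u * CFC.sqrt (star S * S) * u * (star u * CFC.sqrt (star S * S) * u)
        = star u * CFC.sqrt (star S * S) * (u * star u) * CFC.sqrt (star S * S) * u := by
          simp only [mul_assoc]
      _ = star u * (CFC.sqrt (star S * S) * CFC.sqrt (star S * S)) * u := by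
          rw [hu2, mul_one]; simp only [mul_assoc]
      _ = star u * (star S * S) * u := by rw [CFC.sqrt_mul_sqrt_self _ (star_mul_self_nonneg S)]
      _ = star u * star S * (u * star u) * S * u := by
          rw [hu2, mul_one]; simp only [mul_assoc]
      _ = star (star u * S * u) * (star u * S * u) := by
          rw [star_mul, star_mul, star_star]; simp only [mul_assoc]
  ext x
  obtain ⟨h1, e1⟩ := hC1.boundedTransform_apply x
  obtain ⟨h2, e2⟩ := hC.boundedTransform_apply (u x)
  have e3 : u (CFC.abs (star u * S * u) x) = CFC.abs S (u x) := by
    rw [habs]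
    exact h.apply_star _
  have h4 : u (CFC.abs (star u * S * u) x) ∈ D.domain := by rw [e3]; exact h2
  obtain ⟨_, e5⟩ := h.path_one_apply _ h4
  rw [e1, e5, pmap_congr e3 h4 h2]
  change _ = star u (boundedTransform D (u x))
  rw [e2]

/-- The projections `χ(F_{D_t})`. -/
theorem IsUnitaryTriple.nonnegProj_path (h : IsUnitaryTriple N J D u A)
    (hJc : IsClosed (J : Set (H →L[ℂ] H))) (t : ℝ) :
    nonnegProj (boundedTransform (pathUnbounded D u t)) ∈ N ∧
      nonnegProj (boundedTransform (pathUnbounded D u t)) - nonnegProj (boundedTransform D) ∈ J := by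
  obtain ⟨R, S, hC, hR⟩ := h.path_cayley 0
  rw [h.path_zero] at hC
  obtain ⟨R₁, S₁, hC₁, hR₁⟩ := h.path_cayley t
  have hF := hC.relations.1
  have hF₁ := hC₁.relations.1
  have hFN := (hC.mem_ideal h.ideal hR).2
  have hFN₁ := (hC₁.mem_ideal h.ideal hR₁).2
  refine ⟨nonnegProj_mem_vonNeumann hF₁ hFN₁, ?_⟩
  have h1 := nonnegProj_sub_mem h.ideal hF hFN (hC.sub_sq_mem h.ideal hR)
  have h2 := nonnegProj_sub_mem h.ideal hF₁ hFN₁ (hC₁.sub_sq_mem h.ideal hR₁)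
  have h3 := boundedTransform_sub_mem h.ideal hJc hC hC₁ hR hR₁
    (fun x hx => by rw [h.path_domain]; exact hx) (fun x hx hx' => h.path_apply t x hx hx')
  -- Modulo `J` each projection is `(F + 1)/2`, so their difference is half the difference of the
  -- bounded transforms.
  have h4 := add_mem (sub_mem h2 h1) (SMulMemClass.smul_mem (1 / 2 : ℂ) h3)
  convert h4 using 1
  module

theorem IsUnitaryTriple.nonnegProj_one (h : IsUnitaryTriple N J D u A) :
    nonnegProj (boundedTransform (pathUnbounded D u 1)) =
      star u * nonnegProj (boundedTransform D) * u := by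
  obtain ⟨R, S, hC, -⟩ := h.path_cayley 0
  rw [h.path_zero] at hC
  rw [h.boundedTransform_one, nonnegProj_conj hC.relations.1 h.unitary]

theorem IsUnitaryTriple.nonnegProj_sub_mem (h : IsUnitaryTriple N J D u A) :
    boundedTransform D ∈ N ∧ IsSelfAdjoint (boundedTransform D) ∧
    nonnegProj (boundedTransform D) - (1 / 2 : ℂ) • (boundedTransform D + 1) ∈ J := by
  obtain ⟨R, S, hC, hR⟩ := h.path_cayley 0
  rw [h.path_zero] at hC
  have hFN := (hC.mem_ideal h.ideal hR).2
  exact ⟨hFN, hC.relations.1,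
    SpectralFlow.nonnegProj_sub_mem h.ideal hC.relations.1 hFN (hC.sub_sq_mem h.ideal hR)⟩

end Triple

end SpectralFlow

end

noncomputable section

namespace SpectralFlow

open Matrix

/-! ### The von Neumann spectral flow as the index of a pair of projections. -/

section Flow

set_option linter.unusedSectionVars false

variable {H : Type*} [NormedAddCommGroup H] [InnerProductSpace ℂ H] [CompleteSpace H]
  {N : VonNeumannAlgebra H} {J : NonUnitalStarSubalgebra ℂ (H →L[ℂ] H)}

/-- `J` as an ideal of the ring `N`. -/
def IsIdealIn.toIdeal (hJ : IsIdealIn N J) : Ideal N.toStarSubalgebra where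
  carrier := {x | (x : H →L[ℂ] H) ∈ J}
  add_mem' := fun hx hy => add_mem (S := NonUnitalStarSubalgebra ℂ (H →L[ℂ] H)) hx hy
  zero_mem' := zero_mem J
  smul_mem' := fun a x hx => hJ.mul_left a a.2 x hx

instance (hJ : IsIdealIn N J) : hJ.toIdeal.IsTwoSided where
  mul_mem_of_left := fun {x} a hx => hJ.mul_right a a.2 x hx

/-- The quotient map `π : N → N / J`. -/
abbrev IsIdealIn.quot (hJ : IsIdealIn N J) : N.toStarSubalgebra →+* N.toStarSubalgebra ⧸ hJ.toIdeal :=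
  Ideal.Quotient.mk hJ.toIdeal

theorem IsIdealIn.quot_eq (hJ : IsIdealIn N J) {x y : N.toStarSubalgebra} :
    hJ.quot x = hJ.quot y ↔ (x : H →L[ℂ] H) - y ∈ J :=
  Ideal.Quotient.mk_eq_mk_iff_sub_mem _ _

theorem IsIdealIn.quot_eq_zero (hJ : IsIdealIn N J) {x : N.toStarSubalgebra} :
    hJ.quot x = 0 ↔ (x : H →L[ℂ] H) ∈ J :=
  Ideal.Quotient.eq_zero_iff_mem

/-- The inclusion of `J` in `N`. -/
def IsIdealIn.incl (hJ : IsIdealIn N J) : J →ₙₐ[ℂ] N.toStarSubalgebra where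
  toFun := fun x => ⟨x, hJ.le x x.2⟩
  map_smul' := fun _ _ => rfl
  map_zero' := rfl
  map_add' := fun _ _ => rfl
  map_mul' := fun _ _ => rfl

variable [IsClosed (J : Set (H →L[ℂ] H))]

theorem IsIdealIn.isExtension (hJ : IsIdealIn N J) : IsExtension hJ.incl hJ.quot where
  injective := fun _ _ h => Subtype.ext
    (congrArg (fun y : N.toStarSubalgebra => (y : H →L[ℂ] H)) h)
  ker := fun x => hJ.quot_eq_zero.trans
    ⟨fun h => ⟨⟨x, h⟩, rfl⟩, by rintro ⟨r, rfl⟩; exact r.2⟩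

theorem projClass_val (hJ : IsIdealIn N J) {e : N.toStarSubalgebra} (he : IsIdempotentElem e)
    (hπ : hJ.quot e = 0) :
    (projClass J (e : H →L[ℂ] H)).val = hJ.isExtension.cls (liftableIdem_single he hπ) := by
  have h : (e : H →L[ℂ] H) ∈ J ∧ IsIdempotentElem (e : H →L[ℂ] H) :=
    ⟨hJ.quot_eq_zero.1 hπ, congrArg Subtype.val he⟩
  rw [projClass, dif_pos h]
  refine Eq.trans (sub_eq_self.2 (KZeroUnital.cls_zero _)) ?_
  apply KZeroUnital.cls_congr
  refine hJ.isExtension.matrix_ext ?_ ?_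
  · rw [liftMatrix_scalarPart]
    ext i k
    simp [scalarPart]
  · rw [hJ.isExtension.liftMatrix_map (liftableIdem_single he hπ).liftable]
    ext1 i k
    change algebraMap ℂ _ (0 : ℂ) + hJ.incl ⟨e, h.1⟩ = e
    rw [map_zero, zero_add]
    rfl

/-- A projection in `N` that agrees with `p` modulo `J`. -/
structure IsRelProj (N : VonNeumannAlgebra H) (J : NonUnitalStarSubalgebra ℂ (H →L[ℂ] H))
    (p q : H →L[ℂ] H) : Prop where
  proj : IsStarProjection q
  mem : q ∈ N
  sub_mem : q - p ∈ J

theorem IsRelProj.quot_eq (hJ : IsIdealIn N J) {p q : H →L[ℂ] H} (hp : IsRelProj N J p p)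
    (hq : IsRelProj N J p q) : hJ.quot ⟨q, hq.mem⟩ = hJ.quot ⟨p, hp.mem⟩ :=
  hJ.quot_eq.2 hq.sub_mem

theorem IsRelProj.idem {p q : H →L[ℂ] H} (hq : IsRelProj N J p q) :
    IsIdempotentElem (⟨q, hq.mem⟩ : N.toStarSubalgebra) :=
  Subtype.ext hq.proj.isIdempotentElem

/-- The class of the projection `q` relative to the projection `p`. -/
def IsRelProj.cls (hJ : IsIdealIn N J) {p q : H →L[ℂ] H} (hp : IsRelProj N J p p)
    (hq : IsRelProj N J p q) : KZeroUnital (Unitization ℂ J) :=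
  hJ.isExtension.relCls hp.idem hq.idem (hp.quot_eq hJ hq)

theorem IsRelProj.sub {p q r : H →L[ℂ] H} (hq : IsRelProj N J p q)
    (hr : IsRelProj N J p r) : q - r ∈ J := by
  rw [← sub_sub_sub_cancel_right q r p]
  exact _root_.sub_mem hq.sub_mem hr.sub_mem

theorem IsRelProj.projMeet_idem {p q r : H →L[ℂ] H} (hq : IsRelProj N J p q)
    (hr : IsRelProj N J p r) : ∃ h : projMeet (1 - r) q ∈ N,
      IsIdempotentElem (⟨_, h⟩ : N.toStarSubalgebra) :=
  ⟨projMeet_mem_vonNeumann hr.proj.one_sub hq.proj (_root_.sub_mem (one_mem N) hr.mem) hq.mem,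
    Subtype.ext (isStarProjection_projMeet _ _).isIdempotentElem⟩

theorem mul_projMeet_one_sub {q r : H →L[ℂ] H} (hq : IsStarProjection q)
    (hr : IsStarProjection r) :
    q * projMeet (1 - r) q = projMeet (1 - r) q ∧ projMeet (1 - r) q * q = projMeet (1 - r) q :=
  ⟨mul_projMeet_right hr.one_sub hq, star_eq_of_mul (isStarProjection_projMeet _ _) hq
    (mul_projMeet_right hr.one_sub hq)⟩

/-- Writing the index as a coboundary with respect to a fixed base projection `p` is what makes sums
over a partition telescope. The partial isometry of `exists_partialIsometry` equals `p` modulo `J`,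
as `cls_sub_cls` requires. -/
theorem projPairIndex_val (hJ : IsIdealIn N J) {p q r : H →L[ℂ] H} (hp : IsRelProj N J p p)
    (hq : IsRelProj N J p q) (hr : IsRelProj N J p r) :
    (projPairIndex J q r).val = hp.cls hJ hq - hp.cls hJ hr := by
  obtain ⟨hk, ik⟩ := hq.projMeet_idem hr
  obtain ⟨hl, il⟩ := hr.projMeet_idem hq
  have zk : hJ.quot ⟨_, hk⟩ = 0 := hJ.quot_eq_zero.2
    (projMeet_mem_ideal hJ hq.proj hr.proj hq.mem hr.mem (hq.sub hr))
  have zl : hJ.quot ⟨_, hl⟩ = 0 := hJ.quot_eq_zero.2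
    (projMeet_mem_ideal hJ hr.proj hq.proj hr.mem hq.mem (hr.sub hq))
  obtain ⟨x, hxN, h₁, h₂, hx⟩ :=
    exists_partialIsometry hJ hq.proj hr.proj hq.mem hr.mem (hq.sub hr)
  have hxp : x - p ∈ J := by
    rw [← sub_add_sub_cancel x q p]
    exact add_mem hx hq.sub_mem
  have hxs : star x - p ∈ J := by
    have := star_mem hxp
    rwa [star_sub, hp.proj.isSelfAdjoint.star_eq] at this
  obtain ⟨k₁, k₂⟩ := mul_projMeet_one_sub hq.proj hr.proj
  obtain ⟨l₁, l₂⟩ := mul_projMeet_one_sub hr.proj hq.proj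
  change (projClass J _).val - (projClass J _).val = _
  rw [projClass_val hJ ik zk, projClass_val hJ il zl]
  exact hJ.isExtension.cls_sub_cls hp.idem hq.idem (hp.quot_eq hJ hq) hr.idem (hp.quot_eq hJ hr)
    ik zk il zl (Subtype.ext k₂) (Subtype.ext k₁) (Subtype.ext l₂) (Subtype.ext l₁)
    (x := ⟨star x, star_mem hxN⟩) (y := ⟨x, hxN⟩) (hJ.quot_eq.2 hxs) (hJ.quot_eq.2 hxp)
    (Subtype.ext h₁) (Subtype.ext h₂)

/-- If the positive spectral projections of a path all agree modulo `J`, its spectral flow is the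
index of the pair of end projections. -/
theorem spectralFlow_eq_projPairIndex (hJ : IsIdealIn N J) {T : ℝ → H →L[ℂ] H}
    (h : ∀ t, IsRelProj N J (nonnegProj (T 0)) (nonnegProj (T t))) :
    spectralFlow J T = projPairIndex J (nonnegProj (T 0)) (nonnegProj (T 1)) := by
  have hex : ∃ nt : ℕ × (ℕ → ℝ), IsFlowPartition J T nt.1 nt.2 := by
    -- One interval suffices, since all the projections have the same image modulo `J`.
    refine ⟨(1, fun i => i), by simp, by simp, fun i _ => by simp, fun i _ s _ r _ => ?_⟩
    have : quotNorm J (nonnegProj (T s) - nonnegProj (T r)) = 0 :=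
      Metric.infDist_zero_of_mem ((h s).sub (h r))
    rw [this]
    norm_num
  rw [spectralFlow, dif_pos hex]
  have hP := hex.choose_spec
  set t := hex.choose.2
  apply Subtype.ext
  -- The chosen partition is arbitrary, but the sum telescopes to its end points `0` and `1`.
  rw [AddSubgroup.val_finsetSum, Finset.sum_congr rfl fun i _ =>
    projPairIndex_val hJ (h 0) (h (t i)) (h (t (i + 1))),
    Finset.sum_range_sub' fun i => (h 0).cls hJ (h (t i)), projPairIndex_val hJ (h 0) (h 0) (h 1)]
  simp only [hP.zero, hP.one]

theorem IsUnitaryTriple.isRelProj {D : H →ₗ.[ℂ] H} {u A : H →L[ℂ] H}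
    (h : IsUnitaryTriple N J D u A) (hJc : IsClosed (J : Set (H →L[ℂ] H))) (t : ℝ) :
    IsRelProj N J (nonnegProj (boundedTransform D))
      (nonnegProj (boundedTransform (pathUnbounded D u t))) :=
  ⟨isStarProjection_nonnegProj _, (h.nonnegProj_path hJc t).1, (h.nonnegProj_path hJc t).2⟩

theorem IsUnitaryTriple.vonNeumannSpectralFlow_eq {D : H →ₗ.[ℂ] H} {u A : H →L[ℂ] H}
    (h : IsUnitaryTriple N J D u A) (hJc : IsClosed (J : Set (H →L[ℂ] H))) :
    vonNeumannSpectralFlow J D u = projPairIndex J (nonnegProj (boundedTransform D))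
      (star u * nonnegProj (boundedTransform D) * u) := by
  have h0 : boundedTransform (pathUnbounded D u 0) = boundedTransform D := by rw [h.path_zero]
  rw [vonNeumannSpectralFlow, spectralFlow_eq_projPairIndex h.ideal, h0, h.nonnegProj_one]
  intro t
  rw [h0]
  exact h.isRelProj hJc t

end Flow

end SpectralFlow

end

noncomputable section

namespace SpectralFlow

open Matrix

/-! ### The image of the boundary class in `K₀(J)`. -/

section CStar

set_option linter.unusedSectionVars false

/-- Every term on the right contains `p u - u p` or `p² - p`. As `B` is stable only under
multiplication by its multipliers and need not be an ideal of `N`, membership in `B` is read off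
from such an explicit formula. -/
theorem one_sub_compression_mul {S : Type*} [Ring S] {p u v : S} (huv : u * v = 1) :
    1 - (p * u * p + 1 - p) * (p * v * p + 1 - p) =
      p * (p * u - u * p) * (v * p) + p * u * (p * p - p) + (p * p - p) * (v * p)
        - p * u * (p * p - p) * (v * p) - (p + 2) * (p * p - p) := by
  -- The relation `u v = 1` enters only here: the two sides of the goal differ by `p p p - p p (u v)
  -- p`, which `noncomm_ring` verifies.
  have h : p * p * (u * v) * p = p * p * p := by rw [huv, mul_one]
  rw [← sub_eq_zero, ← sub_eq_zero.2 h.symm]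
  noncomm_ring

variable {H : Type*} [NormedAddCommGroup H] [InnerProductSpace ℂ H] [CompleteSpace H]
  {B J : NonUnitalStarSubalgebra ℂ (H →L[ℂ] H)}

theorem IsMultiplier.half_add_one {F : H →L[ℂ] H} (h : IsMultiplier B F) :
    IsMultiplier B ((1 / 2 : ℂ) • (F + 1)) where
  mul_mem := fun b hb => by
    rw [smul_mul_assoc, add_mul, one_mul]
    exact SMulMemClass.smul_mem _ (add_mem (h.mul_mem b hb) hb)
  star_mul_mem := fun b hb => by
    rw [star_smul, star_add, star_one, smul_mul_assoc, add_mul, one_mul]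
    exact SMulMemClass.smul_mem _ (add_mem (h.star_mul_mem b hb) hb)

theorem one_sub_compression_mul_mem {p u v : H →L[ℂ] H} (hp : IsMultiplier B p)
    (hu : IsMultiplier B u) (hv : IsMultiplier B v) (huv : u * v = 1) (h₁ : p * p - p ∈ B)
    (h₂ : p * u - u * p ∈ B) :
    1 - (p * u * p + 1 - p) * (p * v * p + 1 - p) ∈ B := by
  have hvp : ∀ b ∈ B, b * (v * p) ∈ B := fun b hb => by
    rw [← mul_assoc]
    exact hp.mem_mul _ (hv.mem_mul _ hb)
  have hpu : p * u * (p * p - p) ∈ B := by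
    rw [mul_assoc]
    exact hp.mul_mem _ (hu.mul_mem _ h₁)
  rw [one_sub_compression_mul huv]
  refine sub_mem (sub_mem (add_mem (add_mem ?_ hpu) (hvp _ h₁)) (hvp _ hpu)) ?_
  · exact hvp _ (hp.mul_mem _ h₂)
  · rw [add_mul, two_mul]
    exact add_mem (hp.mul_mem _ h₁) (add_mem h₁ h₁)

variable [IsClosed (B : Set (H →L[ℂ] H))] [IsClosed (J : Set (H →L[ℂ] H))]

/-- The adjointable operator `S` on `B` is given by multiplication by `T`. -/
structure Represents (S : Adjointable B) (T : H →L[ℂ] H) : Prop where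
  fst : ∀ b : B, (S.fst b : H →L[ℂ] H) = T * b
  snd : ∀ b : B, (S.snd b : H →L[ℂ] H) = b * T

theorem represents_leftMul {T : H →L[ℂ] H} (h : IsMultiplier B T) : Represents (leftMul h) T :=
  ⟨fun _ => rfl, fun _ => rfl⟩

theorem represents_leftReg (b : B) : Represents (leftReg B b) (b : H →L[ℂ] H) :=
  ⟨fun _ => rfl, fun _ => rfl⟩

theorem represents_algebraMap (c : ℂ) :
    Represents (algebraMap ℂ (Adjointable B) c) (algebraMap ℂ (H →L[ℂ] H) c) where
  fst := fun b => by
    rw [Algebra.algebraMap_eq_smul_one, Algebra.algebraMap_eq_smul_one, smul_mul_assoc, one_mul]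
    rfl
  snd := fun b => by
    rw [Algebra.algebraMap_eq_smul_one, Algebra.algebraMap_eq_smul_one, mul_smul_comm, mul_one]
    rfl

namespace Represents

variable {S S' : Adjointable B} {T T' : H →L[ℂ] H}

/-- `T` determines `S`, although `S` need not determine `T` when `B` acts degenerately on `H`.
Identities are thus transported from operators on `H` to `ℒ(B)`. -/
theorem eq (h : Represents S T) (h' : Represents S' T) : S = S' :=
  adjointable_ext (fun b => (h.fst b).trans (h'.fst b).symm)
    (fun b => (h.snd b).trans (h'.snd b).symm)

theorem one : Represents (1 : Adjointable B) 1 := by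
  simpa only [map_one] using represents_algebraMap (B := B) 1

theorem add (h : Represents S T) (h' : Represents S' T') : Represents (S + S') (T + T') where
  fst := fun b => by rw [add_mul, ← h.fst, ← h'.fst]; rfl
  snd := fun b => by rw [mul_add, ← h.snd, ← h'.snd]; rfl

theorem sub (h : Represents S T) (h' : Represents S' T') : Represents (S - S') (T - T') where
  fst := fun b => by rw [sub_mul, ← h.fst, ← h'.fst]; rfl
  snd := fun b => by rw [mul_sub, ← h.snd, ← h'.snd]; rfl

theorem mul (h : Represents S T) (h' : Represents S' T') : Represents (S * S') (T * T') where
  fst := fun b => by rw [mul_assoc, ← h'.fst, ← h.fst]; rfl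
  snd := fun b => by rw [← mul_assoc, ← h.snd, ← h'.snd]; rfl

theorem smul (c : ℂ) (h : Represents S T) : Represents (c • S) (c • T) where
  fst := fun b => by rw [smul_mul_assoc, ← h.fst]; rfl
  snd := fun b => by rw [mul_smul_comm, ← h.snd]; rfl

theorem toCalkin_eq (h : Represents S T) (h' : Represents S' T') (hT : T - T' ∈ B) :
    toCalkin B S = toCalkin B S' :=
  toCalkin_eq_of_sub_eq ⟨_, hT⟩ ((h.sub h').eq (represents_leftReg ⟨_, hT⟩))

theorem indexIdem {a b : Adjointable B} {a' b' : H →L[ℂ] H} (ha : Represents a a')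
    (hb : Represents b b') (i k : Fin 1 ⊕ Fin 1) :
    Represents (SpectralFlow.indexIdem a b i k) (SpectralFlow.indexIdem a' b' i k) := by
  have hab := one.sub (ha.mul hb)
  have hba := one.sub (hb.mul ha)
  have h2 : 2 * a = a + a := two_mul a
  have h2' : 2 * a' = a' + a' := two_mul a'
  rcases i with i | i <;> rcases k with k | k
  · exact one.sub (hab.mul hab)
  · change Represents ((2 * a - a * b * a) * (1 - b * a)) ((2 * a' - a' * b' * a') * (1 - b' * a'))
    rw [h2, h2']
    exact ((ha.add ha).sub ((ha.mul hb).mul ha)).mul hba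
  · exact hba.mul hb
  · exact hba.mul hba

end Represents

theorem indexIdem_sub_mem {a b : H →L[ℂ] H} (ha : ∀ x ∈ B, a * x ∈ B) (hb : ∀ x ∈ B, x * b ∈ B)
    (hb' : ∀ x ∈ B, b * x ∈ B)
    (hab : 1 - a * b ∈ B) (hba : 1 - b * a ∈ B) (i k : Fin 1 ⊕ Fin 1) :
    indexIdem a b i k - algebraMap ℂ (H →L[ℂ] H) (cornerProj (Fin 1) ℂ i k) ∈ B := by
  rw [cornerProj_eq_block]
  rcases i with i | i <;> rcases k with k | k
  · change 1 - (1 - a * b) * (1 - a * b) - algebraMap ℂ _ 1 ∈ B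
    rw [map_one, sub_sub_cancel_left]
    exact neg_mem (mul_mem hab hab)
  · change (2 * a - a * b * a) * (1 - b * a) - algebraMap ℂ _ 0 ∈ B
    rw [map_zero, sub_zero, two_mul, sub_mul, add_mul, mul_assoc, mul_assoc]
    exact sub_mem (add_mem (ha _ hba) (ha _ hba)) (ha _ (hb' _ (ha _ hba)))
  · change (1 - b * a) * b - algebraMap ℂ _ 0 ∈ B
    rw [map_zero, sub_zero]
    exact hb _ hba
  · change (1 - b * a) * (1 - b * a) - algebraMap ℂ _ 0 ∈ B
    rw [map_zero, sub_zero]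
    exact mul_mem hba hba

theorem starMap_inl_add_inr {R R' : Type*} [NonUnitalCStarAlgebra R] [NonUnitalCStarAlgebra R']
    (φ : R →⋆ₙₐ[ℂ] R') (c : ℂ) (b : R) :
    (Unitization.starMap φ : Unitization ℂ R →+* Unitization ℂ R')
      (Unitization.inl c + Unitization.inr b) = Unitization.inl c + Unitization.inr (φ b) := by
  rw [RingHom.map_add]
  congr 1
  · exact Unitization.starMap_inl φ c
  · exact Unitization.starMap_inr φ b

theorem KZero.map_diff_val {R R' : Type*} [NonUnitalCStarAlgebra R] [NonUnitalCStarAlgebra R']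
    (φ : R →⋆ₙₐ[ℂ] R') {ι : Type*} [Fintype ι] {e f : Matrix ι ι (Unitization ℂ R)}
    (he : IsIdempotentElem e) (hf : IsIdempotentElem f)
    (h : e.map (scalarPart R) = f.map (scalarPart R)) :
    (KZero.map φ (KZero.diff e f he hf h)).val =
      KZeroUnital.cls _ (isIdempotentElem_map he
        (Unitization.starMap φ : Unitization ℂ R →+* Unitization ℂ R')) -
      KZeroUnital.cls _ (isIdempotentElem_map hf
        (Unitization.starMap φ : Unitization ℂ R →+* Unitization ℂ R')) := by
  rw [← KZeroUnital.map_cls _ he, ← KZeroUnital.map_cls _ hf, ← map_sub]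
  rfl

theorem isDiagLift_diagLift {R : Type*} [NonUnitalCStarAlgebra R]
    {v : (Matrix (Fin 1) (Fin 1) (Calkin R))ˣ} {a b : Adjointable R}
    (hva : v.val = single (toCalkin R a)) (hvb : v⁻¹.val = single (toCalkin R b))
    (hab : toCalkin R a * toCalkin R b = 1) (hba : toCalkin R b * toCalkin R a = 1) :
    IsDiagLift v (diagLift a b) := by
  unfold IsDiagLift
  rw [hva, hvb]
  change (block _ _ _ _).map _ = _
  rw [block_map, two_mul]
  simp only [map_sub, map_add, map_mul, map_one, hab, hba, sub_self, one_mul, add_sub_cancel_right]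
  rfl

variable {N : VonNeumannAlgebra H}

/-- The entries of `X - s` and of `Y - s` are the same operators on `H`, seen once as elements of
`B` and once as elements of `J`. Injectivity of the two embeddings makes the preimages agree. -/
theorem map_pullMatrix (hJ : IsIdealIn N J) (hBJ : B ≤ J) {ι κ : Type*} {s : Matrix ι κ ℂ}
    {X : Matrix ι κ (Adjointable B)} {Y : Matrix ι κ N.toStarSubalgebra}
    (hX : ∀ i k, Represents (X i k) (Y i k : H →L[ℂ] H))
    (hY : ∀ i k, (Y i k : H →L[ℂ] H) - algebraMap ℂ (H →L[ℂ] H) (s i k) ∈ B) :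
    (pullMatrix s X).map
      (Unitization.starMap (NonUnitalStarSubalgebra.inclusion hBJ) :
        Unitization ℂ B →+* Unitization ℂ J) = liftMatrix hJ.incl s Y := by
  ext1 i k
  have e₁ : X i k - algebraMap ℂ (Adjointable B) (s i k) = leftReg B ⟨_, hY i k⟩ :=
    ((hX i k).sub (represents_algebraMap _)).eq (represents_leftReg ⟨_, hY i k⟩)
  have e₂ : Y i k - algebraMap ℂ N.toStarSubalgebra (s i k) =
      hJ.incl ⟨_, hBJ (hY i k)⟩ := rfl
  refine (starMap_inl_add_inr _ _ _).trans ?_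
  rw [e₁, Function.leftInverse_invFun (leftReg_injective B)]
  have e₃ : liftMatrix hJ.incl s Y i k = Unitization.inl (s i k) +
    Unitization.inr (Function.invFun hJ.incl (Y i k - algebraMap ℂ _ (s i k))) := rfl
  rw [e₃, e₂, Function.leftInverse_invFun hJ.isExtension.injective]
  rfl

theorem IsExtension.cls_cornerProj {R E Q : Type*} [NonUnitalCStarAlgebra R] [Ring E] [Algebra ℂ E]
    [Ring Q] {j : R →ₙₐ[ℂ] E} {π : E →+* Q} (h : IsExtension j π) :
    h.cls liftableIdem_cornerProj =
      KZeroUnital.cls (cornerProj (Fin 1) (Unitization ℂ R)) (cornerProj_idem _) := by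
  refine KZeroUnital.cls_congr ?_ _ _
  refine h.matrix_ext ?_ ?_
  · rw [cornerProj_map, liftMatrix_scalarPart]
  · rw [cornerProj_map, h.liftMatrix_map liftableIdem_cornerProj.liftable]

theorem map_pullMatrix_indexIdem (hJ : IsIdealIn N J) (hBJ : B ≤ J) {a b : Adjointable B}
    {a' b' : N.toStarSubalgebra} (ha : Represents a (a' : H →L[ℂ] H))
    (hb : Represents b (b' : H →L[ℂ] H)) (hab : 1 - (a' * b' : H →L[ℂ] H) ∈ B)
    (hba : 1 - (b' * a' : H →L[ℂ] H) ∈ B) :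
    (pullMatrix (cornerProj (Fin 1) ℂ) (indexIdem a b)).map
      (Unitization.starMap (NonUnitalStarSubalgebra.inclusion hBJ) :
        Unitization ℂ B →+* Unitization ℂ J) =
      liftMatrix hJ.incl (cornerProj (Fin 1) ℂ) (indexIdem a' b') := by
  have hY : ∀ i k, ((indexIdem a' b' i k : N.toStarSubalgebra) : H →L[ℂ] H) =
      indexIdem (a' : H →L[ℂ] H) (b' : H →L[ℂ] H) i k := by
    intro i k
    rcases i with i | i <;> rcases k with k | k <;> rfl
  have m₁ : ∀ x : B, (a' : H →L[ℂ] H) * x ∈ B := fun x => by rw [← ha.fst]; exact (a.fst x).2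
  have m₂ : ∀ x : B, (b' : H →L[ℂ] H) * x ∈ B := fun x => by rw [← hb.fst]; exact (b.fst x).2
  have m₃ : ∀ x : B, (x : H →L[ℂ] H) * b' ∈ B := fun x => by rw [← hb.snd]; exact (b.snd x).2
  refine map_pullMatrix hJ hBJ (fun i k => ?_) (fun i k => ?_)
  · exact hY i k ▸ ha.indexIdem hb i k
  · exact hY i k ▸ indexIdem_sub_mem (fun x hx => m₁ ⟨x, hx⟩) (fun x hx => m₃ ⟨x, hx⟩)
      (fun x hx => m₂ ⟨x, hx⟩) hab hba i k

set_option maxHeartbeats 1600000 in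
/-- The image of the boundary class of a `1 × 1` invertible matrix, computed from operators that
represent it and its inverse. -/
theorem map_boundaryInv (hJ : IsIdealIn N J) (hBJ : B ≤ J)
    {v : (Matrix (Fin 1) (Fin 1) (Calkin B))ˣ} {a b : Adjointable B} {a' b' : N.toStarSubalgebra}
    (ha : Represents a (a' : H →L[ℂ] H)) (hb : Represents b (b' : H →L[ℂ] H))
    (hva : v.val = single (toCalkin B a)) (hvb : v⁻¹.val = single (toCalkin B b))
    (hab : 1 - (a' * b' : H →L[ℂ] H) ∈ B) (hba : 1 - (b' * a' : H →L[ℂ] H) ∈ B)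
    (hπ : hJ.quot a' * hJ.quot b' = 1) (hπ' : hJ.quot b' * hJ.quot a' = 1) :
    (KZero.map (NonUnitalStarSubalgebra.inclusion hBJ) (boundaryInv v)).val =
      hJ.isExtension.cls (liftableIdem_indexIdem hπ hπ') -
        hJ.isExtension.cls liftableIdem_cornerProj := by
  have c₁ : toCalkin B a * toCalkin B b = 1 :=
    (map_mul _ _ _).symm.trans (((Represents.one).toCalkin_eq (ha.mul hb) hab).symm.trans
      (map_one _))
  have c₂ : toCalkin B b * toCalkin B a = 1 :=
    (map_mul _ _ _).symm.trans (((Represents.one).toCalkin_eq (hb.mul ha) hba).symm.trans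
      (map_one _))
  -- The boundary class does not depend on the lift. The Whitehead lift is chosen because its
  -- entries are polynomials in `a` and `b`, meaningful both in `ℒ(B)` and in `N`.
  have hw := isDiagLift_diagLift hva hvb c₁ c₂
  have hconj : conjCorner (diagLift a b) = indexIdem a b := by
    rw [conjCorner, cornerProj_eq_block, indexIdem_eq]
  rw [boundaryInv_eq hw, hJ.isExtension.cls_cornerProj]
  refine (KZero.map_diff_val _ _ _ _).trans (congrArg₂ _ ?_ ?_)
  · refine KZeroUnital.cls_congr ?_ _ _
    rw [hconj]
    exact map_pullMatrix_indexIdem hJ hBJ ha hb hab hba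
  · exact KZeroUnital.cls_congr (cornerProj_map _) _ _

end CStar

end SpectralFlow

end

noncomputable section

namespace SpectralFlow

open Matrix

/-! ### The index of the compression of `u` as the index of the pair `(p, u* p u)`. -/

section Comparison

set_option linter.unusedSectionVars false

variable {H : Type*} [NormedAddCommGroup H] [InnerProductSpace ℂ H] [CompleteSpace H]
  {N : VonNeumannAlgebra H} {J B : NonUnitalStarSubalgebra ℂ (H →L[ℂ] H)}

theorem mul_eq_zero_of_star_mul_self {x e : H →L[ℂ] H} (h : star x * x * e = 0) : x * e = 0 := by
  rw [← CStarRing.star_mul_self_eq_zero_iff, star_mul, mul_assoc, ← mul_assoc (star x), h, mul_zero]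

/-- Completing `u x`, with `x` a partial isometry from a subprojection of `p` to a subprojection of
`u* p u`, by `1 - p`. -/
theorem completed_partialIsometry {p u k l x : H →L[ℂ] H} (hp : IsStarProjection p)
    (hu : u ∈ unitary (H →L[ℂ] H)) (hk : IsStarProjection k) (hpk : p * k = k) (hkp : k * p = k)
    (hl : star u * p * u * l = l) (h₁ : star x * x = p - k)
    (h₂ : x * star x = star u * p * u - l) :
    star (u * x + 1 - p) * (u * x + 1 - p) = 1 - k ∧
      (u * x + 1 - p) * star (u * x + 1 - p) = 1 - u * l * star u ∧
      (u * x + 1 - p) * k = 0 := by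
  obtain ⟨hu₁, hu₂⟩ := Unitary.mem_iff.1 hu
  have hpp : p * p = p := hp.isIdempotentElem
  have hps : star p = p := hp.isSelfAdjoint.star_eq
  -- The initial projection of `x` lies under `p` and its final projection under `u* p u`. So `u x`
  -- maps into the range of `p`, orthogonal on both sides to `1 - p`, and the cross terms vanish.
  have e₁ : x * (1 - p) = 0 := mul_eq_zero_of_star_mul_self (by
    rw [h₁, mul_sub, mul_one, sub_mul, hpp, hkp, sub_self])
  have e₂ : x * k = 0 := mul_eq_zero_of_star_mul_self (by
    rw [h₁, sub_mul, hpk, hk.isIdempotentElem, sub_self])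
  have e₃ : star x * (1 - star u * p * u) = 0 := mul_eq_zero_of_star_mul_self (by
    have hq : star u * p * u * (star u * p * u) = star u * p * u := by
      calc _ = star u * p * (u * star u) * p * u := by simp only [mul_assoc]
        _ = star u * (p * p) * u := by rw [hu₂, mul_one, mul_assoc (star u)]
        _ = _ := by rw [hpp]
    have hlq : l * (star u * p * u) = l := by
      have hls : star l = l := by
        have e : l = star u * p * u - x * star x := by rw [h₂, sub_sub_cancel]
        rw [e, star_sub, star_mul, star_mul, star_mul, star_star, star_star, hps, ← mul_assoc]
      have := congrArg star hl
      rwa [star_mul, star_mul, star_mul, star_star, hps, hls, ← mul_assoc (star u)] at this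
    rw [star_star, h₂, mul_sub, mul_one, sub_mul, hq, hlq, sub_self])
  have e₄ : (1 - p) * (u * x) = 0 := by
    have h := congrArg star e₃
    rw [star_mul, star_star, star_zero, star_sub, star_one, star_mul, star_mul, star_star, hps,
      ← mul_assoc (star u), sub_mul, one_mul, sub_eq_zero] at h
    rw [sub_mul, one_mul, sub_eq_zero]
    calc u * x = u * (star u * p * u * x) := by rw [← h]
      _ = u * star u * p * (u * x) := by simp only [mul_assoc]
      _ = _ := by rw [hu₂, one_mul]
  have e₅ : u * x * (1 - p) = 0 := by rw [mul_assoc, e₁, mul_zero]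
  have e₆ : star (u * x) * (1 - p) = 0 := by
    have := congrArg star e₄
    rwa [star_mul, star_zero, star_sub, star_one, hps] at this
  have e₇ : (1 - p) * star (u * x) = 0 := by
    have := congrArg star e₅
    rwa [star_mul, star_zero, star_sub, star_one, hps] at this
  have e₈ : (1 - p) * (1 - p) = 1 - p := hp.isIdempotentElem.one_sub
  have hs : star (1 - p) = 1 - p := by rw [star_sub, star_one, hps]
  have f₁ : star (u * x) * (u * x) = p - k := by
    rw [star_mul, ← h₁]
    calc _ = star x * (star u * u) * x := by simp only [mul_assoc]
      _ = _ := by rw [hu₁, mul_one]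
  have f₂ : u * x * star (u * x) = p - u * l * star u := by
    rw [star_mul]
    calc _ = u * (x * star x) * star u := by simp only [mul_assoc]
      _ = u * star u * p * (u * star u) - u * l * star u := by rw [h₂]; noncomm_ring
      _ = _ := by rw [hu₂, one_mul, mul_one]
  rw [add_sub_assoc, star_add, hs]
  refine ⟨?_, ?_, ?_⟩
  · rw [add_mul, mul_add, mul_add, e₄, e₆, e₈, f₁]
    abel
  · rw [add_mul, mul_add, mul_add, e₅, e₇, e₈, f₂]
    abel
  · rw [add_mul, mul_assoc, e₂, mul_zero, sub_mul, one_mul, hpk, sub_self, add_zero]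

theorem compression_eq_of_comm {S : Type*} [Ring S] {p u : S} (hp : p * p = p)
    (hu : p * u = u * p) : p * u * p + 1 - p = u * p + 1 - p := by
  rw [hu, mul_assoc, hp]

variable [IsClosed (J : Set (H →L[ℂ] H))] [IsClosed (B : Set (H →L[ℂ] H))]

set_option maxHeartbeats 1600000 in
/-- The index class of the compression of `u` to `p` is the index of the pair `(p, u* p u)`. -/
theorem cls_indexIdem_compression (hJ : IsIdealIn N J) {p u P : H →L[ℂ] H}
    (hp : IsStarProjection p) (hpN : p ∈ N) (hu : u ∈ unitary (H →L[ℂ] H)) (huN : u ∈ N)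
    (hPN : P ∈ N) (hpP : p - P ∈ J) (hpq : p - star u * p * u ∈ J) {a b : N.toStarSubalgebra}
    (ha : (a : H →L[ℂ] H) = P * u * P + 1 - P) (hb : (b : H →L[ℂ] H) = P * star u * P + 1 - P)
    (hab : hJ.quot a * hJ.quot b = 1) (hba : hJ.quot b * hJ.quot a = 1) :
    hJ.isExtension.cls (liftableIdem_indexIdem hab hba) -
        hJ.isExtension.cls liftableIdem_cornerProj =
      (projPairIndex J p (star u * p * u)).val := by
  obtain ⟨hu₁, hu₂⟩ := Unitary.mem_iff.1 hu
  have hq : IsStarProjection (star u * p * u) := by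
    refine ⟨?_, ?_⟩
    · unfold IsIdempotentElem
      calc _ = star u * p * (u * star u) * p * u := by simp only [mul_assoc]
        _ = star u * (p * p) * u := by rw [hu₂, mul_one, mul_assoc (star u)]
        _ = _ := by rw [hp.isIdempotentElem]
    · rw [IsSelfAdjoint, star_mul, star_mul, star_star, hp.isSelfAdjoint.star_eq, ← mul_assoc]
  have hqN : star u * p * u ∈ N := mul_mem (mul_mem (star_mem huN) hpN) huN
  have hqp : star u * p * u - p ∈ J := by
    rw [← neg_sub]
    exact neg_mem hpq
  have rp : IsRelProj N J p p := ⟨hp, hpN, by rw [sub_self]; exact zero_mem J⟩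
  have rq : IsRelProj N J p (star u * p * u) := ⟨hq, hqN, hqp⟩
  obtain ⟨hkN, ik⟩ := rp.projMeet_idem rq
  obtain ⟨hlN, il⟩ := rq.projMeet_idem rp
  have hkJ := projMeet_mem_ideal hJ hp hq hpN hqN hpq
  have hlJ := projMeet_mem_ideal hJ hq hp hqN hpN hqp
  have zk : hJ.quot ⟨_, hkN⟩ = 0 := hJ.quot_eq_zero.2 hkJ
  have zl : hJ.quot ⟨_, hlN⟩ = 0 := hJ.quot_eq_zero.2 hlJ
  obtain ⟨x, hxN, h₁, h₂, hx⟩ := exists_partialIsometry hJ hp hq hpN hqN hpq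
  obtain ⟨k₁, k₂⟩ := mul_projMeet_one_sub hp hq
  obtain ⟨l₁, -⟩ := mul_projMeet_one_sub hq hp
  obtain ⟨v₁, v₂, v₃⟩ :=
    completed_partialIsometry hp hu (isStarProjection_projMeet _ _) k₁ k₂ l₁ h₁ h₂
  change _ = (projClass J _).val - (projClass J _).val
  rw [projClass_val hJ ik zk, projClass_val hJ il zl]
  set k := projMeet (1 - star u * p * u) p
  set l := projMeet (1 - p) (star u * p * u)
  -- A partial isometry that agrees modulo `J` with the compression of `u`, but with defect
  -- projections known exactly: `1 - V* V = k` and `1 - V V* = u l u*`.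
  set V := u * x + 1 - p with hV
  have hVN : V ∈ N := sub_mem (add_mem (mul_mem huN hxN) (one_mem N)) hpN
  let p' : N.toStarSubalgebra := ⟨p, hpN⟩
  let P' : N.toStarSubalgebra := ⟨P, hPN⟩
  let u' : N.toStarSubalgebra := ⟨u, huN⟩
  let x' : N.toStarSubalgebra := ⟨x, hxN⟩
  let v : N.toStarSubalgebra := ⟨V, hVN⟩
  have qpP : hJ.quot P' = hJ.quot p' := (hJ.quot_eq.2 hpP).symm
  have qx : hJ.quot x' = hJ.quot p' := hJ.quot_eq.2 hx
  have qxs : hJ.quot (star x') = hJ.quot p' := hJ.quot_eq.2 (by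
    have := star_mem hx
    rwa [star_sub, hp.isSelfAdjoint.star_eq] at this)
  have qpp : hJ.quot p' * hJ.quot p' = hJ.quot p' := by
    rw [← map_mul]
    exact congrArg _ (Subtype.ext hp.isIdempotentElem)
  have quu : hJ.quot u' * hJ.quot (star u') = 1 := by
    rw [← map_mul, ← map_one hJ.quot]
    exact congrArg _ (Subtype.ext hu₂)
  have quu' : hJ.quot (star u') * hJ.quot u' = 1 := by
    rw [← map_mul, ← map_one hJ.quot]
    exact congrArg _ (Subtype.ext hu₁)
  have qconj : hJ.quot (star u') * hJ.quot p' * hJ.quot u' = hJ.quot p' := by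
    rw [← map_mul, ← map_mul]
    exact hJ.quot_eq.2 hqp
  have qpu : hJ.quot p' * hJ.quot u' = hJ.quot u' * hJ.quot p' := by
    conv_rhs => rw [← qconj, ← mul_assoc, ← mul_assoc, quu, one_mul]
  have qpu' : hJ.quot p' * hJ.quot (star u') = hJ.quot (star u') * hJ.quot p' := by
    conv_lhs => rw [← qconj, mul_assoc, quu, mul_one]
  have ea : a = P' * u' * P' + 1 - P' := Subtype.ext ha
  have eb : b = P' * star u' * P' + 1 - P' := Subtype.ext hb
  have ev : v = u' * x' + 1 - p' := rfl
  have ew : star v = star x' * star u' + 1 - p' := Subtype.ext (by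
    change star V = star x * star u + 1 - p
    rw [hV, star_sub, star_add, star_mul, star_one, hp.isSelfAdjoint.star_eq])
  -- In `N / J` the elements `P`, `x` and `p` coincide and `p` commutes with `u`, so `P u P + 1 - P`
  -- and `u x + 1 - p` have the same image.
  have qa : hJ.quot a = hJ.quot v := by
    rw [ea, ev]
    simp only [map_sub, map_add, map_mul, map_one, qpP, qx]
    exact compression_eq_of_comm qpp qpu
  have qb : hJ.quot b = hJ.quot (star v) := by
    rw [eb, ew]
    simp only [map_sub, map_add, map_mul, map_one, qpP, qxs]
    rw [compression_eq_of_comm qpp qpu', qpu']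
  have hvw : hJ.quot v * hJ.quot (star v) = 1 := by rw [← qa, ← qb, hab]
  have hwv : hJ.quot (star v) * hJ.quot v = 1 := by rw [← qa, ← qb, hba]
  rw [hJ.isExtension.cls_indexIdem_congr hab hba hvw hwv qa qb]
  let k' : N.toStarSubalgebra := ⟨k, hkN⟩
  let l' : N.toStarSubalgebra := ⟨l, hlN⟩
  have g₁ : 1 - star v * v = k' := Subtype.ext (by
    change 1 - star V * V = k
    rw [v₁, sub_sub_cancel])
  have g₂ : 1 - v * star v = u' * l' * star u' := Subtype.ext (by
    change 1 - V * star V = u * l * star u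
    rw [v₂, sub_sub_cancel])
  have g₃ : v * k' = 0 := Subtype.ext v₃
  have uu : star u' * u' = 1 := Subtype.ext hu₁
  have ll : l' * l' = l' := il
  have c₁ : v * star v * v = v := by
    rw [mul_assoc, ← sub_sub_cancel 1 (star v * v), g₁, mul_sub, mul_one, g₃, sub_zero]
  have c₂ : star v * v * star v = star v := by
    have := congrArg star c₁
    rwa [star_mul, star_mul, star_star, ← mul_assoc] at this
  have il' : IsIdempotentElem (u' * l' * star u') := by
    unfold IsIdempotentElem
    calc _ = u' * l' * (star u' * u') * l' * star u' := by simp only [mul_assoc]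
      _ = u' * (l' * l') * star u' := by rw [uu, mul_one, mul_assoc u']
      _ = _ := by rw [ll]
  have zl' : hJ.quot l' = 0 := zl
  have zm : hJ.quot (u' * l' * star u') = 0 := by
    rw [map_mul, map_mul, zl', mul_zero, zero_mul]
  have i₁ : IsIdempotentElem (1 - star v * v) := by rw [g₁]; exact ik
  have i₂ : IsIdempotentElem (1 - v * star v) := by rw [g₂]; exact il'
  have z₁ : hJ.quot (1 - star v * v) = 0 := by rw [g₁]; exact zk
  have z₂ : hJ.quot (1 - v * star v) = 0 := by rw [g₂]; exact zm
  rw [hJ.isExtension.cls_indexIdem_sub hvw hwv c₁ c₂ i₁ i₂ z₁ z₂]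
  refine congrArg₂ _ (hJ.isExtension.cls_congr _ _ rfl (congrArg single g₁))
    ((hJ.isExtension.cls_congr _ (liftableIdem_single il' zm) rfl (congrArg single g₂)).trans ?_)
  -- It remains that `[u l u*] = [l]`, through the intertwiners `u l` and `l u*`, which lie in `J`.
  refine hJ.isExtension.cls_eq _ _ (a := 0) (b := 0) (x := single (u' * l'))
    (y := single (l' * star u')) (liftable_zero ?_) (liftable_zero ?_) (mul_zero _) (mul_zero _)
    ?_ ?_
  · rw [single_map, map_mul, zl', mul_zero, single_zero]
  · rw [single_map, map_mul, zl', zero_mul, single_zero]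
  · rw [single_mul, mul_assoc, ← mul_assoc l', ll, ← mul_assoc]
  · rw [single_mul, mul_assoc, ← mul_assoc (star u'), uu, one_mul, ll]

theorem pF_mem {F : H →L[ℂ] H} (hF : F ^ 2 - 1 ∈ B) :
    (1 / 2 : ℂ) • (F + 1) * ((1 / 2 : ℂ) • (F + 1)) - (1 / 2 : ℂ) • (F + 1) ∈ B := by
  have e : (1 / 2 : ℂ) • (F + 1) * ((1 / 2 : ℂ) • (F + 1)) - (1 / 2 : ℂ) • (F + 1) =
      (1 / 4 : ℂ) • (F ^ 2 - 1) := by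
    rw [smul_mul_smul_comm, mul_add, add_mul, mul_one, one_mul, sq]
    module
  rw [e]
  exact SMulMemClass.smul_mem _ hF

theorem pF_comm_mem {F a : H →L[ℂ] H} (hF : F * a - a * F ∈ B) :
    (1 / 2 : ℂ) • (F + 1) * a - a * ((1 / 2 : ℂ) • (F + 1)) ∈ B := by
  have e : (1 / 2 : ℂ) • (F + 1) * a - a * ((1 / 2 : ℂ) • (F + 1)) =
      (1 / 2 : ℂ) • (F * a - a * F) := by
    rw [smul_mul_assoc, mul_smul_comm, mul_add, add_mul, mul_one, one_mul]
    module
  rw [e]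
  exact SMulMemClass.smul_mem _ hF

theorem represents_compression {F a : H →L[ℂ] H} (hF : IsMultiplier B F) (ha : IsMultiplier B a) :
    Represents (pF hF * leftMul ha * pF hF + 1 - pF hF)
      ((1 / 2 : ℂ) • (F + 1) * a * ((1 / 2 : ℂ) • (F + 1)) + 1 - (1 / 2 : ℂ) • (F + 1)) := by
  have hP : Represents (pF hF) ((1 / 2 : ℂ) • (F + 1)) :=
    ((represents_leftMul hF).add Represents.one).smul _
  exact (((hP.mul (represents_leftMul ha)).mul hP).add Represents.one).sub hP

set_option maxHeartbeats 1600000 in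
/-- The image in `K₀(J)` of the C*-spectral flow is the index of a pair of projections. -/
theorem IsKasparovModule.map_cstarSpectralFlow {A : StarSubalgebra ℂ (H →L[ℂ] H)}
    {F u p : H →L[ℂ] H} (hK : IsKasparovModule A F B) (hu : u ∈ A)
    (huu : u ∈ unitary (H →L[ℂ] H)) (hJ : IsIdealIn N J) (hBJ : B ≤ J) (huN : u ∈ N) (hFN : F ∈ N)
    (hp : IsStarProjection p) (hpN : p ∈ N) (hpF : p - (1 / 2 : ℂ) • (F + 1) ∈ J)
    (hpq : p - star u * p * u ∈ J) :
    KZero.map (NonUnitalStarSubalgebra.inclusion hBJ) (hK.cstarSpectralFlow hu huu) =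
      projPairIndex J p (star u * p * u) := by
  obtain ⟨hu₁, hu₂⟩ := Unitary.mem_iff.1 huu
  have hF1 : F ^ 2 - 1 ∈ B := by simpa using hK.sq_sub_one 1 (one_mem A)
  have hus : star u ∈ A := star_mem hu
  have mP := hK.multiplier_op.half_add_one
  have hPP := pF_mem hF1
  have m₁ := one_sub_compression_mul_mem mP (hK.multiplier u hu) (hK.multiplier _ hus) hu₂ hPP
    (pF_comm_mem (hK.commutator u hu))
  have m₂ := one_sub_compression_mul_mem mP (hK.multiplier _ hus) (hK.multiplier u hu) hu₁ hPP
    (pF_comm_mem (hK.commutator _ hus))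
  have ra := represents_compression hK.multiplier_op (hK.multiplier u hu)
  have rb := represents_compression hK.multiplier_op (hK.multiplier _ hus)
  have hPN : (1 / 2 : ℂ) • (F + 1) ∈ N := smul_mem_vonNeumann _ (add_mem hFN (one_mem N))
  set P : H →L[ℂ] H := (1 / 2 : ℂ) • (F + 1)
  have haN : P * u * P + 1 - P ∈ N :=
    sub_mem (add_mem (mul_mem (mul_mem hPN huN) hPN) (one_mem N)) hPN
  have hbN : P * star u * P + 1 - P ∈ N :=
    sub_mem (add_mem (mul_mem (mul_mem hPN (star_mem huN)) hPN) (one_mem N)) hPN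
  let a : N.toStarSubalgebra := ⟨_, haN⟩
  let b : N.toStarSubalgebra := ⟨_, hbN⟩
  have hab : hJ.quot a * hJ.quot b = 1 := by
    rw [← map_mul, ← map_one hJ.quot]
    exact (hJ.quot_eq.2 (hBJ m₁)).symm
  have hba : hJ.quot b * hJ.quot a = 1 := by
    rw [← map_mul, ← map_one hJ.quot]
    exact (hJ.quot_eq.2 (hBJ m₂)).symm
  apply Subtype.ext
  rw [← cls_indexIdem_compression hJ hp hpN huu huN hPN hpF hpq (a := a) (b := b) rfl rfl hab hba]
  have hsf : hK.cstarSpectralFlow hu huu = boundaryInv (Units.map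
      (Matrix.scalar (Fin 1) : Calkin B →+* Matrix (Fin 1) (Fin 1) (Calkin B)).toMonoidHom
      (hK.toeplitz hu huu)) := by
    rw [IsKasparovModule.cstarSpectralFlow, boundaryMap]
    change FreeAbelianGroup.lift _ (FreeAbelianGroup.of _) = _
    rw [FreeAbelianGroup.lift_apply_of]
  have hsc : ∀ c : Calkin B, Matrix.scalar (Fin 1) c = single c := by
    intro c
    ext i k
    rw [Subsingleton.elim i k]
    simp [single]
  rw [hsf]
  exact map_boundaryInv hJ hBJ ra rb (hsc _) (hsc _) m₁ m₂ hab hba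

end Comparison

end SpectralFlow

end

/-! ### Equality of the two spectral flows. -/

theorem mainTheorem6 {H : Type*} [NormedAddCommGroup H] [InnerProductSpace ℂ H] [CompleteSpace H]
    {𝒜 : Type*} [Ring 𝒜] [StarRing 𝒜] [Algebra ℂ 𝒜]
    (N : VonNeumannAlgebra H)
    (J : NonUnitalStarSubalgebra ℂ (H →L[ℂ] H)) [IsClosed (J : Set (H →L[ℂ] H))]
    (ρ : 𝒜 →⋆ₐ[ℂ] (H →L[ℂ] H)) (D : H →ₗ.[ℂ] H)
    (hD : SpectralFlow.IsVonNeumannSpectralTriple N J ρ D)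
    (B : NonUnitalStarSubalgebra ℂ (H →L[ℂ] H)) [IsClosed (B : Set (H →L[ℂ] H))]
    (hBJ : B ≤ J) (hB : SpectralFlow.IsSigmaUnital B)
    (hK : SpectralFlow.IsKasparovModule ρ.range.topologicalClosure
      (SpectralFlow.boundedTransform D) B)
    (u : 𝒜) (hu : u ∈ unitary 𝒜) :
    SpectralFlow.vonNeumannSpectralFlow J D (ρ u) =
      SpectralFlow.KZero.map (NonUnitalStarSubalgebra.inclusion hBJ)
        (hK.cstarSpectralFlow (ρ.range.le_topologicalClosure ⟨u, rfl⟩)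
          (Unitary.map_mem ρ hu)) := by
  obtain ⟨A, h⟩ := hD.isUnitaryTriple hu
  have hJc : IsClosed (J : Set (H →L[ℂ] H)) := inferInstance
  obtain ⟨hFN, -, hpF⟩ := h.nonnegProj_sub_mem
  have r₀ := h.isRelProj hJc 0
  have r₁ := h.isRelProj hJc 1
  rw [h.path_zero] at r₀
  rw [h.nonnegProj_one] at r₁
  rw [h.vonNeumannSpectralFlow_eq hJc, hK.map_cstarSpectralFlow _ _ h.ideal hBJ h.mem hFN
    r₀.proj r₀.mem hpF (r₀.sub r₁)]
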